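/- Let $n\ge 4$ and $\lambda=(n-2,2)\vdash n$. Let $S=\{s_1,\dots,s_{n-1}\}$, $s_i=(i,i+1)$, be the simple reflections of $S_n$, and let $S^\lambda$ be the real Specht module, i.e. the span of the polytabloids in the real permutation module on tabloids of shape $\lambda$. Let $\mathcal H$ be the Hecke algebra of $S_n$ over $\mathbb Z[v,v^{-1}]$, with generators $\delta_s$ ($s\in S$), the braid relations and $\delta_s^2=(v^{-1}-v)\delta_s+1$, and with standard basis $(\delta_x)_{x\in S_n}$. Let $b_x=\delta_x+\sum_{y<x}h_{y,x}\delta_y$ with $h_{y,x}\in v\mathbb Z[v]$ be its bar-invariant Kazhdan–Lusztig basis ($<$ is the Bruhat order), put $h_{x,x}=1$ and $h_{y,x}=0$ for $y\not\le x$, and let $\tilde b_x=\sum_{y\le x}(-1)^{\ell(x)+\ell(y)}\overline{h_{y,x}}\,\delta_y$. Left cells are the equivalence classes of the preorder $\le_L$ generated by $y\le_L x$ whenever $b_y$ occurs in $b_sb_x$ for some $s\in S$; the left cell module of a left cell $\Gamma$ is $\langle\tilde b_y\mid y\le_L\Gamma\rangle/\langle\tilde b_y\mid y<_L\Gamma\rangle$,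 with basis $(\tilde b_x)_{x\in\Gamma}$. A basis $(e_x)_{x\in\Gamma}$ of a real representation of $S_n$ is called a Kazhdan–Lusztig left cell basis if every $s\in S$ acts in it by the matrix by which $\delta_s$ acts at $v=1$ on the left cell module of $\Gamma$. A proper invariant cone in $S^\lambda$ is a closed convex cone $C\subseteq S^\lambda$ (closed under non-negative linear combinations) with $C\cap(-C)=\{0\}$ and non-empty interior, such that $(1+s)C\subseteq C$ for all $s\in S$. Let $(e_x)$ be a Kazhdan–Lusztig left cell basis of $S^\lambda$, and let $K$ be the cone of its non-negative linear combinations. 1. $K$ is the maximal proper invariant cone in $S^\lambda$ (unique up to sign): $K$ is a proper invariant cone, and every proper invariant cone $C$ in $S^\lambda$ satisfies $C\subseteq K$ or $C\subseteq -K$. 2. Equivalently, for every non-degenerate symmetric $S_n$-invariant bilinear form on $S^\lambda$, the cone $K^*$ spanned by the basis dual to $(e_x)$ is the minimal proper invariant cone in $S^\lambda$ (unique up to sign): $K^*$ is a proper invariant cone, and every proper invariant cone $C$ in $S^\lambda$ satisfies $K^*\subseteq C$ or $-K^*\subseteq C$. -/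

import Mathlib

noncomputable section

open scoped LaurentPolynomial Polynomial

namespace KLCone

/-! ### The symmetric group as a Coxeter group -/

/-- The simple reflection `s_i = (i, i+1)` of the symmetric group on `n` letters (the letters and
the simple reflections are numbered from `0`). -/
def simpleRefl {n : ℕ} (i : Fin (n - 1)) : Equiv.Perm (Fin n) :=
  Equiv.swap ⟨i.1, by have := i.2; omega⟩ ⟨i.1 + 1, by have := i.2; omega⟩

/-- The permutation expressed by a word in the simple reflections. -/
def wordProd {n : ℕ} (w : List (Fin (n - 1))) : Equiv.Perm (Fin n) :=
  (w.map simpleRefl).prod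

/-- The Coxeter length: the least length of a word in the simple reflections expressing `x`. -/
def length {n : ℕ} (x : Equiv.Perm (Fin n)) : ℕ :=
  sInf {k | ∃ w : List (Fin (n - 1)), w.length = k ∧ wordProd w = x}

theorem exists_word {n : ℕ} (x : Equiv.Perm (Fin n)) :
    ∃ w : List (Fin (n - 1)), wordProd w = x := by
  cases n with
  | zero => exact ⟨[], Subsingleton.elim _ _⟩
  | succ m =>
    have hx : x ∈ Submonoid.closure
        (Set.range fun i : Fin m => Equiv.swap i.castSucc i.succ) := by
      rw [Equiv.Perm.mclosure_swap_castSucc_succ]; trivial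
    induction hx using Submonoid.closure_induction with
    | mem x hx =>
      obtain ⟨i, rfl⟩ := hx
      exact ⟨[i], by simp [wordProd, simpleRefl]; rfl⟩
    | one => exact ⟨[], by simp [wordProd]⟩
    | mul x y _ _ hx hy =>
      obtain ⟨u, hu⟩ := hx
      obtain ⟨w, hw⟩ := hy
      exact ⟨u ++ w, by rw [← hu, ← hw]; simp [wordProd]⟩

theorem exists_reduced_word {n : ℕ} (x : Equiv.Perm (Fin n)) :
    ∃ w : List (Fin (n - 1)), w.length = length x ∧ wordProd w = x := by
  obtain ⟨w, hw⟩ := exists_word x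
  exact Nat.sInf_mem (s := {k | ∃ w : List (Fin (n - 1)), w.length = k ∧ wordProd w = x})
    ⟨w.length, w, rfl, hw⟩

/-- A reduced expression of `x`. -/
def reducedWord {n : ℕ} (x : Equiv.Perm (Fin n)) : List (Fin (n - 1)) :=
  (exists_reduced_word x).choose

/-- The Bruhat order: the reflexive transitive closure of `x → x t`, where `t` is a transposition
and `ℓ(x) < ℓ(x t)`. -/
def BruhatLE {n : ℕ} : Equiv.Perm (Fin n) → Equiv.Perm (Fin n) → Prop :=
  Relation.ReflTransGen fun x y =>
    length x < length y ∧ ∃ t : Equiv.Perm (Fin n), t.IsSwap ∧ x * t = y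

/-! ### The Hecke algebra of the symmetric group and its bar involution -/

/-- The defining relations of the Hecke algebra of `S_n` over `ℤ[v, v⁻¹]`; here `v` is `T 1`. -/
inductive HeckeRel (n : ℕ) :
    FreeAlgebra ℤ[T;T⁻¹] (Fin (n - 1)) → FreeAlgebra ℤ[T;T⁻¹] (Fin (n - 1)) → Prop
  | quadratic (i : Fin (n - 1)) :
      HeckeRel n (FreeAlgebra.ι _ i * FreeAlgebra.ι _ i)
        ((LaurentPolynomial.T (-1) - LaurentPolynomial.T 1 : ℤ[T;T⁻¹]) • FreeAlgebra.ι _ i + 1)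
  | braid (i j : Fin (n - 1)) (h : i.1 + 1 = j.1) :
      HeckeRel n (FreeAlgebra.ι _ i * FreeAlgebra.ι _ j * FreeAlgebra.ι _ i)
        (FreeAlgebra.ι _ j * FreeAlgebra.ι _ i * FreeAlgebra.ι _ j)
  | comm (i j : Fin (n - 1)) (h : i.1 + 1 < j.1) :
      HeckeRel n (FreeAlgebra.ι _ i * FreeAlgebra.ι _ j)
        (FreeAlgebra.ι _ j * FreeAlgebra.ι _ i)

/-- The Hecke algebra of `S_n` over `ℤ[v, v⁻¹]`, by generators and relations. -/
def Hecke (n : ℕ) : Type := RingQuot (HeckeRel n)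

instance (n : ℕ) : Ring (Hecke n) := inferInstanceAs (Ring (RingQuot (HeckeRel n)))

instance (n : ℕ) : Algebra ℤ[T;T⁻¹] (Hecke n) :=
  inferInstanceAs (Algebra ℤ[T;T⁻¹] (RingQuot (HeckeRel n)))

/-- The projection of the free algebra onto the Hecke algebra. -/
def heckeMk (n : ℕ) : FreeAlgebra ℤ[T;T⁻¹] (Fin (n - 1)) →ₐ[ℤ[T;T⁻¹]] Hecke n :=
  RingQuot.mkAlgHom ℤ[T;T⁻¹] (HeckeRel n)

theorem heckeMk_rel {n : ℕ} {x y : FreeAlgebra ℤ[T;T⁻¹] (Fin (n - 1))} (h : HeckeRel n x y) :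
    heckeMk n x = heckeMk n y :=
  RingQuot.mkAlgHom_rel ℤ[T;T⁻¹] h

/-- The generator `δ_s` of the Hecke algebra, for the simple reflection `s = s_i`. -/
def gen {n : ℕ} (i : Fin (n - 1)) : Hecke n :=
  heckeMk n (FreeAlgebra.ι _ i)

/-- The standard basis element `δ_x`, the product of the generators along a reduced expression. -/
def std {n : ℕ} (x : Equiv.Perm (Fin n)) : Hecke n :=
  ((reducedWord x).map gen).prod

theorem gen_sq {n : ℕ} (i : Fin (n - 1)) :
    (gen i : Hecke n) * gen i
      = (LaurentPolynomial.T (-1) - LaurentPolynomial.T 1 : ℤ[T;T⁻¹]) • gen i + 1 := by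
  have h := heckeMk_rel (HeckeRel.quadratic i)
  simp only [map_mul, map_add, map_smul, map_one] at h
  exact h

theorem gen_braid {n : ℕ} (i j : Fin (n - 1)) (hij : i.1 + 1 = j.1) :
    (gen i : Hecke n) * gen j * gen i = gen j * gen i * gen j := by
  have h := heckeMk_rel (HeckeRel.braid i j hij)
  simp only [map_mul] at h
  exact h

theorem gen_comm {n : ℕ} (i j : Fin (n - 1)) (hij : i.1 + 1 < j.1) :
    (gen i : Hecke n) * gen j = gen j * gen i := by
  have h := heckeMk_rel (HeckeRel.comm i j hij)
  simp only [map_mul] at h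
  exact h

/-- The inverse of the generator `δ_s`, which is `δ_s + (v - v⁻¹)`. -/
def genInv {n : ℕ} (i : Fin (n - 1)) : Hecke n :=
  gen i + algebraMap ℤ[T;T⁻¹] (Hecke n) (LaurentPolynomial.T 1 - LaurentPolynomial.T (-1))

theorem gen_mul_genInv {n : ℕ} (i : Fin (n - 1)) : (gen i : Hecke n) * genInv i = 1 := by
  rw [genInv, mul_add, gen_sq, ← Algebra.commutes, ← Algebra.smul_def, add_right_comm,
    ← add_smul]
  simp

theorem genInv_mul_gen {n : ℕ} (i : Fin (n - 1)) : (genInv i : Hecke n) * gen i = 1 := by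
  rw [genInv, add_mul, gen_sq, ← Algebra.smul_def, add_right_comm, ← add_smul]
  simp

/-- The Hecke algebra as a ring, with the scalars `ℤ[v, v⁻¹]` acting through `v ↦ v⁻¹`. -/
def HeckeTwist (n : ℕ) : Type := Hecke n

instance (n : ℕ) : Ring (HeckeTwist n) := inferInstanceAs (Ring (Hecke n))

instance (n : ℕ) : Algebra ℤ[T;T⁻¹] (HeckeTwist n) :=
  RingHom.toAlgebra'
    (((algebraMap ℤ[T;T⁻¹] (Hecke n)).comp
      (LaurentPolynomial.invert (R := ℤ)).toRingEquiv.toRingHom : ℤ[T;T⁻¹] →+* Hecke n))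
    (fun c x => Algebra.commutes (A := Hecke n) (LaurentPolynomial.invert c) x)

theorem genInv_sq {n : ℕ} (i : Fin (n - 1)) :
    (genInv i : Hecke n) * genInv i
      = algebraMap ℤ[T;T⁻¹] (Hecke n)
          (LaurentPolynomial.invert (LaurentPolynomial.T (-1) - LaurentPolynomial.T 1)) * genInv i
        + 1 := by
  have h : (genInv i : Hecke n) - algebraMap ℤ[T;T⁻¹] (Hecke n)
      (LaurentPolynomial.invert (LaurentPolynomial.T (-1) - LaurentPolynomial.T 1)) = gen i := by
    simp [genInv]
  rw [← sub_eq_iff_eq_add', ← sub_mul, h, gen_mul_genInv]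

theorem genInv_braid {n : ℕ} (i j : Fin (n - 1)) (hij : i.1 + 1 = j.1) :
    (genInv i : Hecke n) * genInv j * genInv i = genInv j * genInv i * genInv j := by
  refine left_inv_eq_right_inv (a := gen i * gen j * gen i) ?_ ?_
  · simp only [mul_assoc]
    rw [← mul_assoc (genInv i) (gen i), genInv_mul_gen, one_mul,
      ← mul_assoc (genInv j) (gen j), genInv_mul_gen, one_mul, genInv_mul_gen]
  · rw [gen_braid i j hij]
    simp only [mul_assoc]
    rw [← mul_assoc (gen j) (genInv j), gen_mul_genInv, one_mul,
      ← mul_assoc (gen i) (genInv i), gen_mul_genInv, one_mul, gen_mul_genInv]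

theorem genInv_comm {n : ℕ} (i j : Fin (n - 1)) (hij : i.1 + 1 < j.1) :
    (genInv i : Hecke n) * genInv j = genInv j * genInv i := by
  refine left_inv_eq_right_inv (a := gen j * gen i) ?_ ?_
  · simp only [mul_assoc]
    rw [← mul_assoc (genInv j) (gen j), genInv_mul_gen, one_mul, genInv_mul_gen]
  · rw [← gen_comm i j hij]
    simp only [mul_assoc]
    rw [← mul_assoc (gen j) (genInv j), gen_mul_genInv, one_mul, gen_mul_genInv]

/-- `δ_s⁻¹` as an element of the Hecke algebra with twisted scalars. -/
def genInvTwist {n : ℕ} (i : Fin (n - 1)) : HeckeTwist n := (genInv i : Hecke n)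

theorem genInvTwist_rel (n : ℕ) ⦃x y : FreeAlgebra ℤ[T;T⁻¹] (Fin (n - 1))⦄
    (h : HeckeRel n x y) :
    FreeAlgebra.lift ℤ[T;T⁻¹] (genInvTwist (n := n)) x
      = FreeAlgebra.lift ℤ[T;T⁻¹] (genInvTwist (n := n)) y := by
  cases h with
  | quadratic i =>
    simp only [map_mul, map_add, map_smul, map_one, FreeAlgebra.lift_ι_apply]
    exact genInv_sq i
  | braid i j hij =>
    simp only [map_mul, FreeAlgebra.lift_ι_apply]
    exact genInv_braid i j hij
  | comm i j hij =>
    simp only [map_mul, FreeAlgebra.lift_ι_apply]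
    exact genInv_comm i j hij

/-- The bar involution, as an algebra homomorphism to the algebra with twisted scalars. -/
def barTwist (n : ℕ) : RingQuot (HeckeRel n) →ₐ[ℤ[T;T⁻¹]] HeckeTwist n :=
  RingQuot.liftAlgHom ℤ[T;T⁻¹]
    ⟨FreeAlgebra.lift ℤ[T;T⁻¹] (genInvTwist (n := n)), genInvTwist_rel n⟩

/-- The bar involution of the Hecke algebra: the ring homomorphism with `v ↦ v⁻¹` and
`δ_s ↦ δ_s⁻¹`. -/
def bar (n : ℕ) : Hecke n →+* Hecke n := (barTwist n).toRingHom

theorem bar_gen {n : ℕ} (i : Fin (n - 1)) : bar n (gen i) = genInv i := by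
  have h := RingQuot.liftAlgHom_mkAlgHom_apply ℤ[T;T⁻¹]
    (FreeAlgebra.lift ℤ[T;T⁻¹] (genInvTwist (n := n)))
    (genInvTwist_rel n) (FreeAlgebra.ι _ i)
  rw [FreeAlgebra.lift_ι_apply] at h
  exact h

theorem bar_algebraMap {n : ℕ} (c : ℤ[T;T⁻¹]) :
    bar n (algebraMap _ _ c) = algebraMap _ _ (LaurentPolynomial.invert c) :=
  (barTwist n).commutes c

/-! ### The Kazhdan–Lusztig basis, left cells and left cell representations -/

/-- `b` is the Kazhdan–Lusztig basis of the Hecke algebra of `S_n` and `h y x = h_{y,x}` are the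
Kazhdan–Lusztig polynomials: `b` is the bar-invariant basis with
`b_x = δ_x + ∑_{y < x} h_{y,x}(v) δ_y`, where `h_{y,x} ∈ v ℤ[v]`. -/
structure IsKazhdanLusztigBasis {n : ℕ}
    (b : Module.Basis (Equiv.Perm (Fin n)) ℤ[T;T⁻¹] (Hecke n))
    (h : Equiv.Perm (Fin n) → Equiv.Perm (Fin n) → ℤ[X]) : Prop where
  bar_eq : ∀ x, bar n (b x) = b x
  eq_sum : ∀ x, b x = ∑ y, Polynomial.toLaurent (h y x) • std y
  diag : ∀ x, h x x = 1
  dvd : ∀ y x, y ≠ x → BruhatLE y x → Polynomial.X ∣ h y x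
  eq_zero : ∀ y x, ¬ BruhatLE y x → h y x = 0

/-- The second Kazhdan–Lusztig basis, the one that carries the `W`-graph:
`b̃_x = ∑_y (-1)^{ℓ(x)+ℓ(y)} h_{y,x}(v⁻¹) δ_y`. -/
def twistedKL {n : ℕ} (h : Equiv.Perm (Fin n) → Equiv.Perm (Fin n) → ℤ[X])
    (x : Equiv.Perm (Fin n)) : Hecke n :=
  ∑ y, ((-1) ^ (length x + length y)
    * LaurentPolynomial.invert (Polynomial.toLaurent (h y x)) : ℤ[T;T⁻¹]) • std y

/-- The left preorder `y ≤_L x`: the reflexive transitive closure of "`b_y` occurs in `b_s b_x` for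
some simple reflection `s`". -/
def LeftLE {n : ℕ} (b : Module.Basis (Equiv.Perm (Fin n)) ℤ[T;T⁻¹] (Hecke n)) :
    Equiv.Perm (Fin n) → Equiv.Perm (Fin n) → Prop :=
  Relation.ReflTransGen fun y x => ∃ i, b.repr (b (simpleRefl i) * b x) y ≠ 0

/-- The left cell of `z`. -/
def leftCell {n : ℕ} (b : Module.Basis (Equiv.Perm (Fin n)) ℤ[T;T⁻¹] (Hecke n))
    (z : Equiv.Perm (Fin n)) : Set (Equiv.Perm (Fin n)) :=
  {x | LeftLE b x z ∧ LeftLE b z x}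

/-- Specialization `v = 1`, with values in `ℝ`. -/
def evalOne : ℤ[T;T⁻¹] →+* ℝ := LaurentPolynomial.eval₂ (Int.castRingHom ℝ) 1

/-- The basis `e` of the real representation `ρ` of `S_n` is a Kazhdan–Lusztig left cell basis:
for some left cell `Γ` (enumerated by `c`), the simple reflections act in the basis `e` by the
matrices by which the `δ_s` act, at `v = 1`, on the left cell module with basis
`(b̃_x)_{x ∈ Γ}`. The left cell module is the quotient of the span of the `b̃_y`, `y ≤_L Γ`, by the
span of the `b̃_y`, `y <_L Γ`; so its matrices are the `Γ × Γ` blocks of the matrices of the `δ_s`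
in the basis `b̃` of the Hecke algebra. -/
def IsLeftCellBasis {n : ℕ} {V ι : Type*} [AddCommGroup V] [Module ℝ V] [Fintype ι]
    (ρ : Representation ℝ (Equiv.Perm (Fin n)) V) (e : Module.Basis ι ℝ V) : Prop :=
  ∃ (b b' : Module.Basis (Equiv.Perm (Fin n)) ℤ[T;T⁻¹] (Hecke n))
    (h : Equiv.Perm (Fin n) → Equiv.Perm (Fin n) → ℤ[X])
    (z : Equiv.Perm (Fin n)) (c : ι → Equiv.Perm (Fin n)),
    IsKazhdanLusztigBasis b h ∧ (∀ x, b' x = twistedKL h x) ∧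
    Function.Injective c ∧ Set.range c = leftCell b z ∧
    ∀ (i : Fin (n - 1)) (k : ι),
      ρ (simpleRefl i) (e k) = ∑ l, evalOne (b'.repr (gen i * b' (c k)) (c l)) • e l

/-! ### Specht modules -/

/-- Young tableaux of shape `μ` with entries `0, …, n - 1`, each occurring once. -/
abbrev Tableau (μ : YoungDiagram) (n : ℕ) : Type := {c : ℕ × ℕ // c ∈ μ.cells} ≃ Fin n

/-- The row of the entry `k`. -/
def Tableau.row {μ : YoungDiagram} {n : ℕ} (t : Tableau μ n) (k : Fin n) : ℕ := (t.symm k).1.1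

/-- The column of the entry `k`. -/
def Tableau.col {μ : YoungDiagram} {n : ℕ} (t : Tableau μ n) (k : Fin n) : ℕ := (t.symm k).1.2

/-- The tableau `σ t`, obtained by applying `σ` to all entries of `t`. -/
def Tableau.perm {μ : YoungDiagram} {n : ℕ} (σ : Equiv.Perm (Fin n)) (t : Tableau μ n) :
    Tableau μ n := Equiv.trans t σ

/-- Two tableaux are row equivalent if their rows have the same entries. -/
def rowSetoid (μ : YoungDiagram) (n : ℕ) : Setoid (Tableau μ n) where
  r t t' := ∀ k, Tableau.row t k = Tableau.row t' k
  iseqv := ⟨fun _ _ => rfl, fun h k => (h k).symm, fun h h' k => (h k).trans (h' k)⟩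

/-- Tabloids: row equivalence classes of tableaux. -/
def Tabloid (μ : YoungDiagram) (n : ℕ) : Type := Quotient (rowSetoid μ n)

/-- The tabloid `{t}`. -/
def Tabloid.mk {μ : YoungDiagram} {n : ℕ} (t : Tableau μ n) : Tabloid μ n :=
  Quotient.mk (rowSetoid μ n) t

/-- The action `σ {t} = {σ t}` on tabloids. -/
instance (μ : YoungDiagram) (n : ℕ) : MulAction (Equiv.Perm (Fin n)) (Tabloid μ n) where
  smul σ := Quotient.map (Tableau.perm σ) fun _ _ h k => h (σ.symm k)
  one_smul q := by
    induction q using Quotient.inductionOn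
    rfl
  mul_smul σ τ q := by
    induction q using Quotient.inductionOn
    rfl

/-- The permutation representation on the real vector space `M^μ` with basis the tabloids (realized
as real functions on tabloids, the tabloid `q` being the indicator function of `q`). -/
def tabloidRep (μ : YoungDiagram) (n : ℕ) :
    Representation ℝ (Equiv.Perm (Fin n)) (Tabloid μ n → ℝ) where
  toFun σ := LinearMap.funLeft ℝ ℝ fun q => σ⁻¹ • q
  map_one' := by ext f q; simp [LinearMap.funLeft_apply]
  map_mul' σ τ := by ext f q; simp [LinearMap.funLeft_apply, mul_smul]

open Classical in
/-- The polytabloid of `t`: the signed sum of the tabloids `{σ t}` over the `σ` that preserve the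
columns of `t`. -/
def polytabloid {μ : YoungDiagram} {n : ℕ} (t : Tableau μ n) : Tabloid μ n → ℝ :=
  ∑ σ : Equiv.Perm (Fin n) with ∀ k, Tableau.col t (σ k) = Tableau.col t k,
    ((Equiv.Perm.sign σ : ℤ) : ℝ) • Pi.single (Tabloid.mk (Tableau.perm σ t)) 1

theorem tabloidRep_polytabloid {μ : YoungDiagram} {n : ℕ} (σ : Equiv.Perm (Fin n))
    (t : Tableau μ n) :
    tabloidRep μ n σ (polytabloid t) = polytabloid (Tableau.perm σ t) := by
  classical
  rw [polytabloid, polytabloid, map_sum]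
  refine Finset.sum_bij' (fun τ _ => σ * τ * σ⁻¹) (fun τ _ => σ⁻¹ * τ * σ) ?_ ?_ ?_ ?_ ?_
  · intro τ hτ
    simp only [Finset.mem_filter, Finset.mem_univ, true_and] at hτ ⊢
    intro k
    have := hτ (σ.symm k)
    simpa [Tableau.col, Tableau.perm] using this
  · intro τ hτ
    simp only [Finset.mem_filter, Finset.mem_univ, true_and] at hτ ⊢
    intro k
    have := hτ (σ k)
    simpa [Tableau.col, Tableau.perm] using this
  · intro τ _; group
  · intro τ _; group
  · intro τ _
    have hq : Tabloid.mk (Tableau.perm (σ * τ * σ⁻¹) (Tableau.perm σ t))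
        = σ • Tabloid.mk (Tableau.perm τ t) := by
      change Tabloid.mk _ = Tabloid.mk (Tableau.perm σ (Tableau.perm τ t))
      congr 1
      ext c
      simp [Tableau.perm]
    rw [map_smul, hq]
    congr 1
    · have h : Equiv.Perm.sign (σ * τ * σ⁻¹) = Equiv.Perm.sign τ := by
        rw [map_mul, map_mul, mul_right_comm, ← map_mul, mul_inv_cancel, map_one, one_mul]
      rw [h]
    · ext q
      simp [tabloidRep, LinearMap.funLeft_apply, Pi.single_apply, inv_smul_eq_iff]

/-- The Specht module `S^μ` over `ℝ`, as a subrepresentation of `M^μ`: the span of the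
polytabloids. -/
def spechtSub (μ : YoungDiagram) (n : ℕ) : Subrepresentation (tabloidRep μ n) where
  toSubmodule := Submodule.span ℝ (Set.range polytabloid)
  apply_mem_toSubmodule σ v hv := by
    have h : Submodule.span ℝ (Set.range (polytabloid (μ := μ) (n := n)))
        ≤ (Submodule.span ℝ (Set.range polytabloid)).comap (tabloidRep μ n σ) := by
      rw [Submodule.span_le]
      rintro _ ⟨t, rfl⟩
      simp only [Submodule.comap_coe, Set.mem_preimage, tabloidRep_polytabloid]
      exact Submodule.subset_span ⟨_, rfl⟩
    exact h hv

/-- The underlying vector space of the Specht module, with the topology of a finite-dimensional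
real vector space. -/
abbrev Specht (μ : YoungDiagram) (n : ℕ) : Type := (spechtSub μ n).toSubmodule

/-- The action of `S_n` on the Specht module. -/
abbrev spechtRep (μ : YoungDiagram) (n : ℕ) :
    Representation ℝ (Equiv.Perm (Fin n)) (Specht μ n) :=
  (spechtSub μ n).toRepresentation

/-- The partition `(n - 2, 2)` of `n`. -/
def twoRow (n : ℕ) (hn : 4 ≤ n) : YoungDiagram :=
  YoungDiagram.ofRowLens [n - 2, 2] (by
    simp [List.sortedGE_iff_pairwise]; omega)

/-! ### Invariant cones -/

/-- A proper (closed, pointed, solid) cone in a representation of `S_n` that is invariant under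
`1 + s` for all simple reflections `s`. -/
structure IsProperInvariantCone {n : ℕ} {V : Type*} [AddCommGroup V] [Module ℝ V]
    [TopologicalSpace V] (ρ : Representation ℝ (Equiv.Perm (Fin n)) V) (C : PointedCone ℝ V) :
    Prop where
  isClosed : IsClosed (C : Set V)
  pointed : ∀ v, v ∈ C → -v ∈ C → v = 0
  solid : (interior (C : Set V)).Nonempty
  invariant : ∀ (i : Fin (n - 1)) (v : V), v ∈ C → v + ρ (simpleRefl i) v ∈ C

/-- `K` is the maximal proper invariant cone. If `C` is a proper invariant cone then so is `-C`, so
"the" maximal cone is meant up to sign: every proper invariant cone lies in `K` or in `-K`. -/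
def IsMaximalInvariantCone {n : ℕ} {V : Type*} [AddCommGroup V] [Module ℝ V]
    [TopologicalSpace V] (ρ : Representation ℝ (Equiv.Perm (Fin n)) V) (K : PointedCone ℝ V) :
    Prop :=
  IsProperInvariantCone ρ K ∧
    ∀ C : PointedCone ℝ V, IsProperInvariantCone ρ C →
      (∀ v ∈ C, v ∈ K) ∨ (∀ v ∈ C, -v ∈ K)

/-- `K` is the minimal proper invariant cone, up to sign: every proper invariant cone contains `K`
or `-K`. -/
def IsMinimalInvariantCone {n : ℕ} {V : Type*} [AddCommGroup V] [Module ℝ V]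
    [TopologicalSpace V] (ρ : Representation ℝ (Equiv.Perm (Fin n)) V) (K : PointedCone ℝ V) :
    Prop :=
  IsProperInvariantCone ρ K ∧
    ∀ C : PointedCone ℝ V, IsProperInvariantCone ρ C →
      (∀ v ∈ K, v ∈ C) ∨ (∀ v ∈ K, -v ∈ C)

end KLCone

end

/-! An element of the Specht module of shape (n-2,2) is read as a quadratic form ∑ a_{p,q} x_p x_q
without squares whose coefficient matrix has zero row sums. The common (-1)-eigenspace of s_i and
s_j is zero if |i-j| = 1, and is the line of (x_i - x_{i+1})(x_j - x_{j+1}) if |i-j| ≥ 2.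

In a left cell basis the simple reflections act through a symmetric W-graph
(`exists_isWGraphBasis`). Hence such an eigenvector is a combination of basis elements having both i
and j as descents, and these lie on the same line. So the basis contains a multiple of every
product. Star operations, which are edges of weight one, force a common scale c (`hasScale_succ`),
and symmetry of the weights yields the vectors c (x_j - x_{j+1})(x_{j-1} - x_{j+2}) as well
(`exists_nested`). Together these are the whole basis (`classify`).

The coordinates in this basis are positive multiples of c⁻¹ `corner a b`, where `corner a b` sums
a_{p,q} over the first a and first b letters. It is invariant under all s_t with t ≠ a, b (counted
from one). On vectors fixed by these s_t it is discretely harmonic in each argument, so it equals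
a(n-b) `corner 1 (n-1)` (`corner_of_fixed`). Moreover `corner 1 (n-1)` is faithful on the vectors
fixed by s_2, …, s_{n-2} (`eq_zero_of_fixed`).

The rest is convexity. A closed cone C stable under the maps 1 + s contains, along with v, a
parabolic-fixed vector with the same values of all parabolic-invariant functionals
(`exists_fixed_mem`). If the outer coordinate took both signs on C, symmetrization would produce a
line inside C. So it has one sign, and symmetrizing for each other coordinate transports this sign:
C lies in K or -K. Dually, C contains plus or minus the dual vector of the outer coordinate, and
symmetrizing that vector produces positive multiples of all other dual vectors. -/

noncomputable section

open scoped LaurentPolynomial Polynomial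

namespace KLCone

/-! ### Length and descents in the symmetric group -/

section SymmetricGroup

variable {n : ℕ}

/-- The left end of the simple reflection `s_i`. -/
def lo (i : Fin (n - 1)) : Fin n := ⟨i.1, by have := i.2; omega⟩

/-- The right end of the simple reflection `s_i`. -/
def hi (i : Fin (n - 1)) : Fin n := ⟨i.1 + 1, by have := i.2; omega⟩

theorem simpleRefl_eq_swap (i : Fin (n - 1)) : simpleRefl i = Equiv.swap (lo i) (hi i) := rfl

theorem lo_lt_hi (i : Fin (n - 1)) : lo i < hi i := by
  simp [lo, hi, Fin.lt_def]

@[simp] theorem simpleRefl_mul_self (i : Fin (n - 1)) : simpleRefl i * simpleRefl i = 1 :=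
  Equiv.swap_mul_self _ _

@[simp] theorem simpleRefl_mul_cancel_left (i : Fin (n - 1)) (x : Equiv.Perm (Fin n)) :
    simpleRefl i * (simpleRefl i * x) = x := by
  rw [← mul_assoc, simpleRefl_mul_self, one_mul]

@[simp] theorem simpleRefl_inv (i : Fin (n - 1)) : (simpleRefl i)⁻¹ = simpleRefl i :=
  Equiv.swap_inv _ _

@[simp] theorem simpleRefl_lo (i : Fin (n - 1)) : simpleRefl i (lo i) = hi i :=
  Equiv.swap_apply_left _ _

@[simp] theorem simpleRefl_hi (i : Fin (n - 1)) : simpleRefl i (hi i) = lo i :=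
  Equiv.swap_apply_right _ _

theorem simpleRefl_of_ne (i : Fin (n - 1)) {a : Fin n} (h : a ≠ lo i) (h' : a ≠ hi i) :
    simpleRefl i a = a :=
  Equiv.swap_apply_of_ne_of_ne h h'

theorem simpleRefl_val (i : Fin (n - 1)) (a : Fin n) :
    (simpleRefl i a).1 = if a.1 = i.1 then i.1 + 1 else if a.1 = i.1 + 1 then i.1 else a.1 := by
  rw [simpleRefl, Equiv.swap_apply_def]
  simp only [Fin.ext_iff]
  split_ifs <;> rfl

/-- `s_i` is a left ascent of `x`. -/
def Asc (i : Fin (n - 1)) (x : Equiv.Perm (Fin n)) : Prop := x⁻¹ (lo i) < x⁻¹ (hi i)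

theorem not_asc_iff (i : Fin (n - 1)) (x : Equiv.Perm (Fin n)) :
    ¬ Asc i x ↔ x⁻¹ (hi i) < x⁻¹ (lo i) := by
  rw [Asc, not_lt, le_iff_lt_or_eq, or_iff_left]
  intro h
  exact (lo_lt_hi i).ne (x⁻¹.injective h).symm

theorem asc_simpleRefl_mul (i : Fin (n - 1)) (x : Equiv.Perm (Fin n)) :
    Asc i (simpleRefl i * x) ↔ ¬ Asc i x := by
  rw [not_asc_iff]
  simp [Asc]

/-- The inversions of `p`. -/
def inversions (p : Equiv.Perm (Fin n)) : Finset (Fin n × Fin n) :=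
  Finset.univ.filter fun a => a.1 < a.2 ∧ p a.2 < p a.1

theorem mem_inversions {p : Equiv.Perm (Fin n)} {a b : Fin n} :
    (a, b) ∈ inversions p ↔ a < b ∧ p b < p a := by
  simp [inversions]

/-- The reflection preserves the order of every pair of letters except (`lo i`, `hi i`). Applying it
to both entries therefore matches all other inversions, and the exceptional pair is the one new
inversion. -/
theorem card_inversions_mul_simpleRefl (p : Equiv.Perm (Fin n)) (i : Fin (n - 1))
    (h : p (lo i) < p (hi i)) :
    (inversions (p * simpleRefl i)).card = (inversions p).card + 1 := by
  have hinv : ∀ c, simpleRefl i (simpleRefl i c) = c := fun c => by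
    rw [← Equiv.Perm.mul_apply, simpleRefl_mul_self, Equiv.Perm.one_apply]
  have hlt : ∀ a b : Fin n, a < b → ¬ (a = lo i ∧ b = hi i) →
      simpleRefl i a < simpleRefl i b := by
    intro a b h1 h2
    simp only [Fin.lt_def, Fin.ext_iff, lo, hi, simpleRefl_val] at h1 h2 ⊢
    split_ifs <;> omega
  have key : ((inversions (p * simpleRefl i)).erase (lo i, hi i)).card = (inversions p).card := by
    refine Finset.card_nbij' (fun a => (simpleRefl i a.1, simpleRefl i a.2))
      (fun a => (simpleRefl i a.1, simpleRefl i a.2)) ?_ ?_ ?_ ?_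
    · rintro ⟨a, b⟩ hab
      rw [Finset.mem_coe, Finset.mem_erase, mem_inversions] at hab
      exact mem_inversions.2 ⟨hlt a b hab.2.1 fun h => hab.1 (by rw [h.1, h.2]), hab.2.2⟩
    · rintro ⟨a, b⟩ hab
      rw [Finset.mem_coe, mem_inversions] at hab
      rw [Finset.mem_coe, Finset.mem_erase, mem_inversions, Equiv.Perm.mul_apply,
        Equiv.Perm.mul_apply, hinv, hinv]
      refine ⟨fun he => ?_, hlt a b hab.1 ?_, hab.2⟩
      · rw [Prod.mk.injEq] at he
        have h1 := (hinv a).symm.trans (congrArg _ he.1)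
        have h2 := (hinv b).symm.trans (congrArg _ he.2)
        rw [simpleRefl_lo] at h1
        rw [simpleRefl_hi] at h2
        rw [h1, h2] at hab
        exact absurd hab.1 (lo_lt_hi i).not_gt
      · rintro ⟨rfl, rfl⟩
        exact absurd h hab.2.not_gt
    · rintro ⟨a, b⟩ _
      simp [hinv]
    · rintro ⟨a, b⟩ _
      simp [hinv]
  rw [← key, Finset.card_erase_add_one]
  rw [mem_inversions]
  exact ⟨lo_lt_hi i, by simpa using h⟩

theorem card_inversions_inv_simpleRefl_mul (x : Equiv.Perm (Fin n)) (i : Fin (n - 1)) :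
    (Asc i x → (inversions (simpleRefl i * x)⁻¹).card = (inversions x⁻¹).card + 1) ∧
    (¬ Asc i x → (inversions (simpleRefl i * x)⁻¹).card + 1 = (inversions x⁻¹).card) := by
  refine ⟨fun h => ?_, fun h => ?_⟩
  · rw [mul_inv_rev, simpleRefl_inv, card_inversions_mul_simpleRefl _ _ h]
  · have h' := (asc_simpleRefl_mul i x).2 h
    have := card_inversions_mul_simpleRefl (simpleRefl i * x)⁻¹ i h'
    rw [← this, mul_inv_rev, simpleRefl_inv, mul_assoc, simpleRefl_mul_self, mul_one]

theorem card_inversions_wordProd_le (w : List (Fin (n - 1))) :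
    (inversions (wordProd w)⁻¹).card ≤ w.length := by
  induction w with
  | nil =>
    simp only [wordProd, List.map_nil, List.prod_nil, inv_one, List.length_nil, inversions,
      Equiv.Perm.one_apply, Nat.le_zero, Finset.card_eq_zero, Finset.filter_eq_empty_iff]
    rintro a _ ⟨h, h'⟩
    exact absurd h h'.not_gt
  | cons i u ih =>
    have hc : wordProd (i :: u) = simpleRefl i * wordProd u := by simp [wordProd]
    rw [hc, List.length_cons]
    have := card_inversions_inv_simpleRefl_mul (wordProd u) i
    by_cases h : Asc i (wordProd u)
    · have := this.1 h; omega
    · have := this.2 h; omega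

theorem eq_one_of_forall_asc (x : Equiv.Perm (Fin n)) (h : ∀ i, Asc i x) : x = 1 := by
  have hm : StrictMono (x⁻¹ : Equiv.Perm (Fin n)) := by
    cases n with
    | zero => exact fun a => a.elim0
    | succ m => exact Fin.strictMono_iff_lt_succ.2 fun i => h i
  have : (x⁻¹ : Equiv.Perm (Fin n)) = 1 := by
    have h1 : (⇑(x⁻¹ : Equiv.Perm (Fin n))) = id := by
      have := hm.range_inj (g := id) strictMono_id
      exact this.1 (by rw [(x⁻¹).surjective.range_eq, Set.range_id])
    ext a
    rw [h1]; rfl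
  simpa using this

theorem exists_word_length_eq_card_inversions (x : Equiv.Perm (Fin n)) :
    ∃ w : List (Fin (n - 1)), w.length = (inversions x⁻¹).card ∧ wordProd w = x := by
  induction hk : (inversions x⁻¹).card generalizing x with
  | zero =>
    refine ⟨[], rfl, ?_⟩
    rw [eq_one_of_forall_asc x fun i => ?_]
    · simp [wordProd]
    · by_contra h
      have := (card_inversions_inv_simpleRefl_mul x i).2 h
      omega
  | succ k ih =>
    by_cases hx : ∀ i, Asc i x
    · rw [eq_one_of_forall_asc x hx] at hk
      have := card_inversions_wordProd_le (n := n) []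
      simp [wordProd] at this
      simp [this] at hk
    · push Not at hx
      obtain ⟨i, hi⟩ := hx
      have := (card_inversions_inv_simpleRefl_mul x i).2 hi
      obtain ⟨w, hw, hw'⟩ := ih (simpleRefl i * x) (by omega)
      refine ⟨i :: w, by simp [hw], ?_⟩
      have hc : wordProd (i :: w) = simpleRefl i * wordProd w := by simp [wordProd]
      rw [hc, hw', simpleRefl_mul_cancel_left]

theorem length_eq_card_inversions (x : Equiv.Perm (Fin n)) :
    length x = (inversions x⁻¹).card := by
  apply le_antisymm
  · exact Nat.sInf_le (exists_word_length_eq_card_inversions x)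
  · obtain ⟨w, hw, hw'⟩ := exists_reduced_word x
    rw [← hw, ← hw']
    exact card_inversions_wordProd_le w

theorem length_of_asc {i : Fin (n - 1)} {x : Equiv.Perm (Fin n)} (h : Asc i x) :
    length (simpleRefl i * x) = length x + 1 := by
  rw [length_eq_card_inversions, length_eq_card_inversions]
  exact (card_inversions_inv_simpleRefl_mul x i).1 h

theorem length_of_not_asc {i : Fin (n - 1)} {x : Equiv.Perm (Fin n)} (h : ¬ Asc i x) :
    length (simpleRefl i * x) + 1 = length x := by
  rw [length_eq_card_inversions, length_eq_card_inversions]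
  exact (card_inversions_inv_simpleRefl_mul x i).2 h

theorem wordProd_cons (i : Fin (n - 1)) (w : List (Fin (n - 1))) :
    wordProd (i :: w) = simpleRefl i * wordProd w := by simp [wordProd]

theorem length_wordProd_le (w : List (Fin (n - 1))) : length (wordProd w) ≤ w.length := by
  rw [length_eq_card_inversions]; exact card_inversions_wordProd_le w

theorem length_one : length (1 : Equiv.Perm (Fin n)) = 0 := by
  simpa [wordProd] using length_wordProd_le (n := n) []

theorem eq_of_bruhatLE {x y : Equiv.Perm (Fin n)} (h : BruhatLE x y) :
    x = y ∨ length x < length y := by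
  induction h with
  | refl => exact Or.inl rfl
  | tail _ h ih =>
    rcases ih with rfl | ih
    · exact Or.inr h.1
    · exact Or.inr (ih.trans h.1)

theorem hi_eq_lo {i j : Fin (n - 1)} (h : i.1 + 1 = j.1) : hi i = lo j := by
  simp [hi, lo, h]

theorem simpleRefl_comm {i j : Fin (n - 1)} (h : i.1 + 1 < j.1) :
    simpleRefl i * simpleRefl j = simpleRefl j * simpleRefl i := by
  ext a
  simp only [Equiv.Perm.mul_apply, simpleRefl_val]
  split_ifs <;> omega

theorem simpleRefl_braid {i j : Fin (n - 1)} (h : i.1 + 1 = j.1) :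
    simpleRefl i * simpleRefl j * simpleRefl i = simpleRefl j * simpleRefl i * simpleRefl j := by
  have h1 : lo i ≠ hi j := by simp [lo, hi, Fin.ext_iff]; omega
  have h2 : lo i ≠ lo j := by simp [lo, Fin.ext_iff]; omega
  have h3 : lo j ≠ hi j := (lo_lt_hi j).ne
  rw [simpleRefl_eq_swap, simpleRefl_eq_swap, hi_eq_lo h,
    Equiv.swap_mul_swap_mul_swap h2 h1, Equiv.swap_comm (lo i) (lo j),
    Equiv.swap_comm (lo j) (hi j), Equiv.swap_mul_swap_mul_swap h3.symm h1.symm,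
    Equiv.swap_comm]

theorem asc_mul_of_comm {i j : Fin (n - 1)} (h : i.1 + 1 < j.1 ∨ j.1 + 1 < i.1)
    (x : Equiv.Perm (Fin n)) : Asc i (simpleRefl j * x) ↔ Asc i x := by
  have h1 : simpleRefl j (lo i) = lo i :=
    simpleRefl_of_ne _ (by simp [lo, Fin.ext_iff]; omega) (by simp [lo, hi, Fin.ext_iff]; omega)
  have h2 : simpleRefl j (hi i) = hi i :=
    simpleRefl_of_ne _ (by simp [lo, hi, Fin.ext_iff]; omega) (by simp [hi, Fin.ext_iff]; omega)
  simp [Asc, mul_inv_rev, Equiv.Perm.mul_apply, h1, h2]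

theorem simpleRefl_hi_of_succ {i j : Fin (n - 1)} (h : i.1 + 1 = j.1) :
    simpleRefl i (hi j) = hi j ∧ simpleRefl j (lo i) = lo i :=
  ⟨simpleRefl_of_ne _ (by simp [lo, hi, Fin.ext_iff]; omega) (by simp [hi, Fin.ext_iff]; omega),
   simpleRefl_of_ne _ (by simp [lo, Fin.ext_iff]; omega) (by simp [lo, hi, Fin.ext_iff]; omega)⟩

/-- The left star operation. -/
theorem exists_star {i j : Fin (n - 1)} (h : i.1 + 1 = j.1) {x : Equiv.Perm (Fin n)}
    (hx : ¬ Asc i x) (hx' : Asc j x) :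
    ∃ y, Asc i y ∧ ¬ Asc j y ∧ (y = simpleRefl j * x ∨ x = simpleRefl i * y) := by
  have hs := simpleRefl_hi_of_succ h
  rw [not_asc_iff, hi_eq_lo h] at hx
  rw [Asc] at hx'
  -- Among the three letters moved by s_i and s_j, `x⁻¹` is smallest at the middle one. The order of
  -- the outer two decides between s_j x and s_i x.
  by_cases hc : x⁻¹ (lo i) < x⁻¹ (hi j)
  · refine ⟨simpleRefl j * x, ?_, ?_, Or.inl rfl⟩
    · simpa [Asc, hi_eq_lo h, hs] using hc
    · rw [asc_simpleRefl_mul]; simpa [Asc] using hx'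
  · refine ⟨simpleRefl i * x, ?_, ?_, Or.inr (by simp)⟩
    · rw [asc_simpleRefl_mul, not_asc_iff, hi_eq_lo h]; exact hx
    · have : x⁻¹ (hi j) ≠ x⁻¹ (lo i) := by
        intro he
        have := x⁻¹.injective he
        simp [hi, lo, Fin.ext_iff] at this
        omega
      have h2 : x⁻¹ (hi j) < x⁻¹ (lo i) := lt_of_le_of_ne (not_lt.1 hc) this
      rw [not_asc_iff]
      simpa [hs, ← hi_eq_lo h] using h2

end SymmetricGroup

/-! ### The standard basis of the Hecke algebra -/

section Standard

variable {n : ℕ}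

theorem exists_words_of_comm {a b : Fin (n - 1)} (hab : a.1 + 1 < b.1) {x : Equiv.Perm (Fin n)}
    (ha : ¬ Asc a x) (hb : ¬ Asc b x) :
    ∃ p q : List (Fin (n - 1)), wordProd p = simpleRefl a * x ∧ wordProd q = simpleRefl b * x ∧
      p.length + 1 = length x ∧ q.length + 1 = length x ∧
      gen a * (p.map (gen (n := n))).prod = gen b * (q.map gen).prod := by
  obtain ⟨t, ht, ht'⟩ := exists_reduced_word (simpleRefl b * (simpleRefl a * x))
  have l1 := length_of_not_asc ha
  have hb' : ¬ Asc b (simpleRefl a * x) := by rwa [asc_mul_of_comm (Or.inr hab)]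
  have l2 := length_of_not_asc hb'
  refine ⟨b :: t, a :: t, ?_, ?_, ?_, ?_, ?_⟩
  · rw [wordProd_cons, ht', simpleRefl_mul_cancel_left]
  · rw [wordProd_cons, ht', ← mul_assoc (simpleRefl b), ← simpleRefl_comm hab, mul_assoc,
      simpleRefl_mul_cancel_left]
  · rw [List.length_cons]; omega
  · rw [List.length_cons]; omega
  · rw [List.map_cons, List.map_cons, List.prod_cons, List.prod_cons, ← mul_assoc, ← mul_assoc,
      gen_comm a b hab]

/-- `x⁻¹` decreases along the three letters involved, so x = s_a s_b s_a t with lengths adding up.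
The words b a t and a b t then differ, once prefixed by a and b, by one braid relation. -/
theorem exists_words_of_braid {a b : Fin (n - 1)} (hab : a.1 + 1 = b.1) {x : Equiv.Perm (Fin n)}
    (ha : ¬ Asc a x) (hb : ¬ Asc b x) :
    ∃ p q : List (Fin (n - 1)), wordProd p = simpleRefl a * x ∧ wordProd q = simpleRefl b * x ∧
      p.length + 1 = length x ∧ q.length + 1 = length x ∧
      gen a * (p.map (gen (n := n))).prod = gen b * (q.map gen).prod := by
  have hs := simpleRefl_hi_of_succ hab
  have hlh := hi_eq_lo hab
  have hb' : ¬ Asc b (simpleRefl a * x) := by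
    rw [not_asc_iff] at ha hb ⊢
    rw [mul_inv_rev, simpleRefl_inv, Equiv.Perm.mul_apply, Equiv.Perm.mul_apply, hs.1, ← hlh,
      simpleRefl_hi]
    rw [← hlh] at hb
    exact hb.trans ha
  have ha' : ¬ Asc a (simpleRefl b * (simpleRefl a * x)) := by
    rw [not_asc_iff] at ha hb ⊢
    rw [mul_inv_rev, mul_inv_rev, simpleRefl_inv, simpleRefl_inv, Equiv.Perm.mul_apply,
      Equiv.Perm.mul_apply, Equiv.Perm.mul_apply, Equiv.Perm.mul_apply, hs.2, simpleRefl_lo, hlh,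
      simpleRefl_lo, hs.1]
    exact hb
  obtain ⟨t, ht, ht'⟩ :=
    exists_reduced_word (simpleRefl a * (simpleRefl b * (simpleRefl a * x)))
  have l1 := length_of_not_asc ha
  have l2 := length_of_not_asc hb'
  have l3 := length_of_not_asc ha'
  refine ⟨b :: a :: t, a :: b :: t, ?_, ?_, ?_, ?_, ?_⟩
  · rw [wordProd_cons, wordProd_cons, ht', simpleRefl_mul_cancel_left,
      simpleRefl_mul_cancel_left]
  · have h1 : simpleRefl a * (simpleRefl b * (simpleRefl a * x))
        = simpleRefl b * (simpleRefl a * (simpleRefl b * x)) := by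
      rw [← mul_assoc, ← mul_assoc, simpleRefl_braid hab, mul_assoc, mul_assoc]
    rw [wordProd_cons, wordProd_cons, ht', h1, simpleRefl_mul_cancel_left,
      simpleRefl_mul_cancel_left]
  · rw [List.length_cons, List.length_cons]; omega
  · rw [List.length_cons, List.length_cons]; omega
  · simp only [List.map_cons, List.prod_cons, ← mul_assoc]
    rw [gen_braid a b hab]

theorem exists_words_of_descents {a b : Fin (n - 1)} (hab : a ≠ b) {x : Equiv.Perm (Fin n)}
    (ha : ¬ Asc a x) (hb : ¬ Asc b x) :
    ∃ p q : List (Fin (n - 1)), wordProd p = simpleRefl a * x ∧ wordProd q = simpleRefl b * x ∧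
      p.length + 1 = length x ∧ q.length + 1 = length x ∧
      gen a * (p.map (gen (n := n))).prod = gen b * (q.map gen).prod := by
  wlog h : a.1 < b.1 generalizing a b
  · obtain ⟨p, q, h1, h2, h3, h4, h5⟩ := this hab.symm hb ha (by
      have := Fin.val_ne_of_ne hab; omega)
    exact ⟨q, p, h2, h1, h4, h3, h5.symm⟩
  rcases Nat.lt_or_ge (a.1 + 1) b.1 with h' | h'
  · exact exists_words_of_comm h' ha hb
  · exact exists_words_of_braid (by omega) ha hb

/-- Matsumoto's theorem for the generators of the Hecke algebra. -/
theorem prod_gen_eq_of_reduced (N : ℕ) : ∀ w w' : List (Fin (n - 1)),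
    w.length = N → w'.length = N → wordProd w = wordProd w' → length (wordProd w) = N →
    (w.map (gen (n := n))).prod = (w'.map gen).prod := by
  induction N with
  | zero =>
    intro w w' hw hw' _ _
    rw [List.length_eq_zero_iff.1 hw, List.length_eq_zero_iff.1 hw']
  | succ N ih =>
    intro w w' hw hw' hww hl
    obtain ⟨i, u, rfl⟩ := List.exists_cons_of_length_eq_add_one hw
    obtain ⟨j, u', rfl⟩ := List.exists_cons_of_length_eq_add_one hw'
    generalize hx : wordProd (i :: u) = x at hww hl
    -- The first letter of a reduced word is a left descent, and by induction its tail may be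
    -- exchanged for any reduced word of the same element.
    have tail : ∀ (a : Fin (n - 1)) (r : List (Fin (n - 1))), (a :: r).length = N + 1 →
        wordProd (a :: r) = x →
        ¬ Asc a x ∧ ∀ t : List (Fin (n - 1)), wordProd t = simpleRefl a * x → t.length = N →
          (r.map (gen (n := n))).prod = (t.map gen).prod := by
      intro a r hr hra
      have hpr : wordProd r = simpleRefl a * x := by
        rw [← hra, wordProd_cons, simpleRefl_mul_cancel_left]
      have hrN : r.length = N := by simpa using hr
      have hle := length_wordProd_le r
      have ha : ¬ Asc a x := by
        intro h
        have h1 := length_of_asc h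
        rw [← hpr] at h1
        omega
      have h2 := length_of_not_asc ha
      refine ⟨ha, fun t ht htl => ih r t hrN htl (hpr.trans ht.symm) ?_⟩
      rw [hpr]; omega
    obtain ⟨hdi, hi⟩ := tail i u hw hx
    obtain ⟨hdj, hj⟩ := tail j u' hw' hww.symm
    rw [List.map_cons, List.map_cons, List.prod_cons, List.prod_cons]
    by_cases hij : i = j
    · subst hij
      rw [hi u' (by rw [hww, wordProd_cons, simpleRefl_mul_cancel_left]) (by simpa using hw')]
    · obtain ⟨p, q, h1, h2, h3, h4, h5⟩ := exists_words_of_descents hij hdi hdj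
      rw [hi p h1 (by omega), hj q h2 (by omega), h5]

theorem gen_mul_std_of_asc {i : Fin (n - 1)} {x : Equiv.Perm (Fin n)} (h : Asc i x) :
    gen i * std x = std (simpleRefl i * x) := by
  have hx := (exists_reduced_word x).choose_spec
  have hs := (exists_reduced_word (simpleRefl i * x)).choose_spec
  have hl := length_of_asc h
  have := prod_gen_eq_of_reduced (length x + 1) (i :: reducedWord x)
    (reducedWord (simpleRefl i * x)) (by rw [List.length_cons]; exact congrArg (· + 1) hx.1)
    (hs.1.trans hl) (by rw [wordProd_cons]; exact (congrArg _ hx.2).trans hs.2.symm)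
    (by rw [wordProd_cons, ← hl]; exact congrArg (fun y => length (simpleRefl i * y)) hx.2)
  simpa [std] using this

theorem gen_mul_std_of_not_asc {i : Fin (n - 1)} {x : Equiv.Perm (Fin n)} (h : ¬ Asc i x) :
    gen i * std x = std (simpleRefl i * x)
      + (LaurentPolynomial.T (-1) - LaurentPolynomial.T 1 : ℤ[T;T⁻¹]) • std x := by
  have h1 := gen_mul_std_of_asc ((asc_simpleRefl_mul i x).2 h)
  rw [simpleRefl_mul_cancel_left] at h1
  rw [← h1, ← mul_assoc, gen_sq, add_mul, one_mul, smul_mul_assoc, add_comm]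

theorem std_one : std (1 : Equiv.Perm (Fin n)) = 1 := by
  have this : reducedWord (1 : Equiv.Perm (Fin n)) = [] :=
    List.length_eq_zero_iff.1
      ((exists_reduced_word (1 : Equiv.Perm (Fin n))).choose_spec.1.trans length_one)
  simp [std, this]

theorem std_simpleRefl (i : Fin (n - 1)) : std (simpleRefl i) = gen i := by
  have h : Asc i 1 := by simp [Asc, lo_lt_hi]
  have := gen_mul_std_of_asc h
  rw [std_one, mul_one, mul_one] at this
  exact this.symm

open Classical in
theorem gen_mul_sum_std (i : Fin (n - 1)) (a : Equiv.Perm (Fin n) → ℤ[T;T⁻¹]) :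
    gen i * ∑ y, a y • std y = ∑ y, (a (simpleRefl i * y)
      + if Asc i y then 0 else
          (LaurentPolynomial.T (-1) - LaurentPolynomial.T 1) * a y) • std y := by
  have h1 : ∑ y, a (simpleRefl i * y) • std y = ∑ y, a y • std (simpleRefl i * y) :=
    Fintype.sum_equiv (Equiv.mulLeft (simpleRefl i)) _ _ fun y => by simp
  simp only [add_smul, Finset.sum_add_distrib]
  rw [h1, ← Finset.sum_add_distrib, Finset.mul_sum]
  refine Finset.sum_congr rfl fun y _ => ?_
  rw [mul_smul_comm]
  split_ifs with h
  · rw [gen_mul_std_of_asc h, zero_smul, add_zero]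
  · rw [gen_mul_std_of_not_asc h, smul_add, smul_smul, mul_comm]

end Standard

/-! ### The Kazhdan–Lusztig basis -/

section KazhdanLusztig

open Polynomial (toLaurent)
open LaurentPolynomial (T invert)

/-- The subgroup `v ℤ[v]` of `ℤ[v, v⁻¹]`. -/
def vIdeal : AddSubgroup ℤ[T;T⁻¹] where
  carrier := {a | ∃ p : ℤ[X], toLaurent (Polynomial.X * p) = a}
  zero_mem' := ⟨0, by simp⟩
  add_mem' := by
    rintro _ _ ⟨p, rfl⟩ ⟨q, rfl⟩
    exact ⟨p + q, by rw [mul_add, map_add]⟩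
  neg_mem' := by
    rintro _ ⟨p, rfl⟩
    exact ⟨-p, by rw [mul_neg, map_neg]⟩

theorem toLaurent_mem_vIdeal {p : ℤ[X]} (h : p.coeff 0 = 0) : toLaurent p ∈ vIdeal := by
  obtain ⟨q, rfl⟩ := Polynomial.X_dvd_iff.2 h
  exact ⟨q, rfl⟩

theorem mul_toLaurent_mem_vIdeal {a : ℤ[T;T⁻¹]} (ha : a ∈ vIdeal) (q : ℤ[X]) :
    a * toLaurent q ∈ vIdeal := by
  obtain ⟨p, rfl⟩ := ha
  exact ⟨p * q, by rw [← mul_assoc, map_mul]⟩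

theorem coeff_eq_zero_of_mem_vIdeal {a : ℤ[T;T⁻¹]} (ha : a ∈ vIdeal) {k : ℤ} (hk : k ≤ 0) :
    a.coeff k = 0 := by
  obtain ⟨p, rfl⟩ := ha
  rw [LaurentPolynomial.coeff_toLaurent, ← Finsupp.notMem_support_iff,
    Finsupp.mapDomain_support_of_injective Nat.castEmbedding.injective]
  simp only [Finset.mem_image, not_exists, not_and]
  rintro m hm rfl
  have : m = 0 := by simpa using hk
  subst this
  simp at hm

/-- All exponents are positive, while invariance under v ↦ v⁻¹ makes the support symmetric. -/
theorem eq_zero_of_mem_vIdeal_of_invert_eq {a : ℤ[T;T⁻¹]} (ha : a ∈ vIdeal)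
    (h : invert a = a) : a = 0 := by
  refine LaurentPolynomial.ext fun k => ?_
  rcases le_total k 0 with hk | hk
  · rw [coeff_eq_zero_of_mem_vIdeal ha hk]; rfl
  · rw [← h, LaurentPolynomial.invert_apply, coeff_eq_zero_of_mem_vIdeal ha (by omega)]; rfl

variable {n : ℕ} {b : Module.Basis (Equiv.Perm (Fin n)) ℤ[T;T⁻¹] (Hecke n)}
  {h : Equiv.Perm (Fin n) → Equiv.Perm (Fin n) → ℤ[X]}

theorem bar_smul (c : ℤ[T;T⁻¹]) (a : Hecke n) : bar n (c • a) = invert c • bar n a := by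
  rw [Algebra.smul_def, map_mul, bar_algebraMap, ← Algebra.smul_def]

namespace IsKazhdanLusztigBasis

theorem length_lt (hb : IsKazhdanLusztigBasis b h)
    {y x : Equiv.Perm (Fin n)} (hyx : y ≠ x) (h0 : h y x ≠ 0) :
    length y < length x := by
  by_contra hlt
  refine h0 (hb.eq_zero y x fun hle => ?_)
  rcases eq_of_bruhatLE hle with h1 | h1
  · exact hyx h1
  · exact hlt h1

theorem coeff_zero (hb : IsKazhdanLusztigBasis b h)
    [DecidableEq (Equiv.Perm (Fin n))] (y x : Equiv.Perm (Fin n)) :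
    (h y x).coeff 0 = if y = x then 1 else 0 := by
  split_ifs with hyx
  · rw [hyx, hb.diag]; simp
  · rw [← Polynomial.X_dvd_iff]
    by_cases hle : BruhatLE y x
    · exact hb.dvd y x hyx hle
    · rw [hb.eq_zero y x hle]; exact dvd_zero _

/-- The transition matrix is unitriangular for the length with entries in ℤ[v], so its inverse has
entries in ℤ[v] too. -/
theorem repr_std (hb : IsKazhdanLusztigBasis b h)
    (x y : Equiv.Perm (Fin n)) : ∃ q : ℤ[X], b.repr (std x) y = toLaurent q := by
  classical
  induction hk : length x using Nat.strong_induction_on generalizing x with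
  | _ k ih =>
  have h1 : std x = b x - ∑ z ∈ Finset.univ.erase x, toLaurent (h z x) • std z := by
    rw [eq_sub_iff_add_eq, hb.eq_sum x, ← Finset.add_sum_erase _ _ (Finset.mem_univ x), hb.diag]
    simp
  have h2 : ∀ z, z ≠ x → ∃ q : ℤ[X],
      toLaurent (h z x) * b.repr (std z) y = toLaurent q := by
    intro z hz
    by_cases h0 : h z x = 0
    · exact ⟨0, by simp [h0]⟩
    · obtain ⟨q, hq⟩ := ih _ (hk ▸ hb.length_lt hz h0) z rfl
      exact ⟨h z x * q, by rw [hq, map_mul]⟩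
  choose! q hq using h2
  refine ⟨(if y = x then 1 else 0) - ∑ z ∈ Finset.univ.erase x, q z, ?_⟩
  rw [h1, map_sub, map_sub, map_sum, map_sum, Finsupp.sub_apply, Finsupp.finsetSum_apply]
  congr 1
  · rw [b.repr_self, Finsupp.single_apply]
    simp only [eq_comm]
    split_ifs <;> simp
  · refine Finset.sum_congr rfl fun z hz => ?_
    rw [← hq z (Finset.ne_of_mem_erase hz), map_smul, Finsupp.smul_apply, smul_eq_mul]

/-- The uniqueness principle behind every multiplication formula below. In the basis `b` the
coordinates of the element still lie in vℤ[v], and bar-invariance of `b` makes them invariant under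
v ↦ v⁻¹, so they vanish. -/
theorem sum_std_eq_zero (hb : IsKazhdanLusztigBasis b h)
    {a : Equiv.Perm (Fin n) → ℤ[T;T⁻¹]} (ha : ∀ y, a y ∈ vIdeal)
    (hbar : bar n (∑ y, a y • std y) = ∑ y, a y • std y) : ∑ y, a y • std y = 0 := by
  set d := ∑ y, a y • std y with hd
  have hmem : ∀ z, b.repr d z ∈ vIdeal := by
    intro z
    rw [hd, map_sum, Finsupp.finsetSum_apply]
    refine sum_mem fun y _ => ?_
    obtain ⟨q, hq⟩ := hb.repr_std y z
    rw [map_smul, Finsupp.smul_apply, smul_eq_mul, hq]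
    exact mul_toLaurent_mem_vIdeal (ha y) q
  have hinv : ∀ z, invert (b.repr d z) = b.repr d z := by
    intro z
    have h1 : bar n d = ∑ y, invert (b.repr d y) • b y := by
      conv_lhs => rw [← b.sum_repr d]
      rw [map_sum]
      simp only [bar_smul, hb.bar_eq]
    rw [hbar] at h1
    have h2 := congrArg (fun a => b.repr a z) h1
    simp only [b.repr_sum_self] at h2
    exact h2.symm
  rw [← b.sum_repr d]
  refine Finset.sum_eq_zero fun z _ => ?_
  rw [eq_zero_of_mem_vIdeal_of_invert_eq (hmem z) (hinv z), zero_smul]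

theorem apply_simpleRefl (hb : IsKazhdanLusztigBasis b h) (i : Fin (n - 1)) :
    b (simpleRefl i) = gen i + (T 1 : ℤ[T;T⁻¹]) • (1 : Hecke n) := by
  classical
  have h1 : b (simpleRefl i) - (gen i + (T 1 : ℤ[T;T⁻¹]) • (1 : Hecke n))
      = ∑ y, (toLaurent (h y (simpleRefl i)
        - ((if y = simpleRefl i then 1 else 0) + if y = 1 then Polynomial.X else 0))) • std y := by
    simp only [map_sub, map_add, sub_smul, add_smul, Finset.sum_sub_distrib,
      Finset.sum_add_distrib]
    rw [← hb.eq_sum]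
    congr 2
    · rw [Finset.sum_eq_single (simpleRefl i)] <;> simp +contextual [std_simpleRefl]
    · rw [Finset.sum_eq_single 1] <;> simp +contextual [std_one]
  rw [← sub_eq_zero, h1]
  refine hb.sum_std_eq_zero (fun y => toLaurent_mem_vIdeal ?_) ?_
  · rw [Polynomial.coeff_sub, Polynomial.coeff_add, hb.coeff_zero]
    split_ifs <;> simp
  · rw [← h1, map_sub, map_add, hb.bar_eq, bar_gen, bar_smul, map_one, genInv,
      Algebra.algebraMap_eq_smul_one]
    rw [LaurentPolynomial.invert_T, add_assoc, ← add_smul, sub_add_cancel]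

-- The integers on the right are the constant terms of the coefficients of b_s b_x on the standard
-- basis. Subtracting leaves a bar-invariant element with coefficients in vℤ[v], which
-- `sum_std_eq_zero` kills.
open Classical in
theorem sum_of_asc (hb : IsKazhdanLusztigBasis b h)
    {i : Fin (n - 1)} {x : Equiv.Perm (Fin n)} (hx : Asc i x) :
    b (simpleRefl i) * b x = ∑ y, (((if Asc i y then 0 else
      (if y = simpleRefl i * x then 1 else 0) + (h y x).coeff 1 : ℤ)) : ℤ[T;T⁻¹]) • b y := by
  set N : Equiv.Perm (Fin n) → ℤ := fun y => if Asc i y then 0 else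
      (if y = simpleRefl i * x then 1 else 0) + (h y x).coeff 1 with hN
  have h1 : b (simpleRefl i) * b x = ∑ y, ((toLaurent (h (simpleRefl i * y) x)
      + if Asc i y then 0 else (T (-1) - T 1) * toLaurent (h y x))
      + T 1 * toLaurent (h y x)) • std y := by
    simp only [add_smul _ (T 1 * _), Finset.sum_add_distrib, mul_smul (T 1)]
    rw [hb.apply_simpleRefl, add_mul, smul_one_mul, ← Finset.smul_sum, hb.eq_sum x,
      gen_mul_sum_std i fun y => toLaurent (h y x)]
  have h2 : ∑ y, (N y : ℤ[T;T⁻¹]) • b y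
      = ∑ y, (∑ z, (N z : ℤ[T;T⁻¹]) * toLaurent (h y z)) • std y := by
    simp only [Finset.sum_smul]
    rw [Finset.sum_comm]
    refine Finset.sum_congr rfl fun z _ => ?_
    rw [hb.eq_sum z, Finset.smul_sum]
    simp only [smul_smul]
  have h3 : b (simpleRefl i) * b x - ∑ y, (N y : ℤ[T;T⁻¹]) • b y = ∑ y,
      (((toLaurent (h (simpleRefl i * y) x)
      + if Asc i y then 0 else (T (-1) - T 1) * toLaurent (h y x))
      + T 1 * toLaurent (h y x)) - ∑ z, (N z : ℤ[T;T⁻¹]) * toLaurent (h y z)) • std y := by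
    simp only [sub_smul, Finset.sum_sub_distrib]
    rw [h1, h2]
  have h0 : ∀ y, (∑ z, (N z : ℤ[X]) * h y z).coeff 0 = N y := by
    intro y
    rw [Polynomial.finsetSum_coeff]
    simp only [Polynomial.coeff_intCast_mul, hb.coeff_zero]
    simp
  have h0' : ∀ y, toLaurent (∑ z, (N z : ℤ[X]) * h y z)
      = ∑ z, (N z : ℤ[T;T⁻¹]) * toLaurent (h y z) := by
    intro y
    simp
  rw [← sub_eq_zero, h3]
  refine hb.sum_std_eq_zero (fun y => ?_) ?_
  · by_cases hy : Asc i y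
    · have : simpleRefl i * y ≠ x := by
        rintro rfl
        exact (asc_simpleRefl_mul i y).1 hx hy
      rw [if_pos hy, ← h0', ← Polynomial.toLaurent_X, add_zero, ← map_mul, ← map_add, ← map_sub]
      apply toLaurent_mem_vIdeal
      rw [Polynomial.coeff_sub, h0, Polynomial.coeff_add, Polynomial.coeff_X_mul_zero,
        hb.coeff_zero, if_neg this, hN]
      simp [hy]
    · have hyx : y ≠ x := by rintro rfl; exact hy hx
      obtain ⟨q, hq⟩ : Polynomial.X ∣ h y x := by
        rw [Polynomial.X_dvd_iff, hb.coeff_zero, if_neg hyx]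
      rw [if_neg hy, ← h0', add_assoc, ← add_mul, sub_add_cancel]
      have : (T (-1) : ℤ[T;T⁻¹]) * toLaurent (h y x) = toLaurent q := by
        rw [hq, map_mul, Polynomial.toLaurent_X, ← mul_assoc, ← LaurentPolynomial.T_add]
        simp
      rw [this, ← map_add, ← map_sub]
      apply toLaurent_mem_vIdeal
      rw [Polynomial.coeff_sub, h0, Polynomial.coeff_add, hb.coeff_zero, hN]
      have hiff : simpleRefl i * y = x ↔ y = simpleRefl i * x := by
        constructor
        · rintro rfl; simp
        · rintro rfl; simp
      simp [hy, hq, Polynomial.coeff_X_mul, hiff]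
  · rw [← h3, map_sub, map_mul, hb.bar_eq, hb.bar_eq, map_sum]
    simp only [bar_smul, hb.bar_eq, map_intCast]

theorem apply_simpleRefl_mul_self (hb : IsKazhdanLusztigBasis b h) (i : Fin (n - 1)) :
    b (simpleRefl i) * b (simpleRefl i) = (T 1 + T (-1) : ℤ[T;T⁻¹]) • b (simpleRefl i) := by
  rw [hb.apply_simpleRefl, mul_add, add_mul, gen_sq, smul_one_mul, mul_smul_one, smul_add,
    add_smul, sub_smul, smul_add, smul_add, smul_smul, smul_smul,
    ← LaurentPolynomial.T_add, ← LaurentPolynomial.T_add]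
  simp only [neg_add_cancel, LaurentPolynomial.T_zero, one_smul]
  abel

theorem coeff_one_eq_zero (hb : IsKazhdanLusztigBasis b h)
    {y x : Equiv.Perm (Fin n)} (hl : length x ≤ length y) :
    (h y x).coeff 1 = 0 := by
  by_cases hyx : y = x
  · rw [hyx, hb.diag, Polynomial.coeff_one]; simp
  · by_contra h0
    have := hb.length_lt hyx fun h' => h0 (by rw [h', Polynomial.coeff_zero])
    omega

/-- With w = s x shorter than x, `sum_of_asc` writes b_x as b_s b_w minus terms b_y for shorter y
that also have s as a descent. Induction on the length and b_s² = (v + v⁻¹) b_s finish. -/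
theorem mul_of_not_asc (hb : IsKazhdanLusztigBasis b h)
    {i : Fin (n - 1)} {x : Equiv.Perm (Fin n)} (hx : ¬ Asc i x) :
    b (simpleRefl i) * b x = (T 1 + T (-1) : ℤ[T;T⁻¹]) • b x := by
  classical
  induction hk : length x using Nat.strong_induction_on generalizing x with
  | _ k ih =>
  have hlw := length_of_not_asc hx
  have hw := (asc_simpleRefl_mul i x).2 hx
  set w := simpleRefl i * x with hwx
  have hxw : simpleRefl i * w = x := by simp [hwx]
  have h1 := hb.sum_of_asc hw
  rw [hxw, ← Finset.add_sum_erase _ _ (Finset.mem_univ x), if_neg hx, if_pos rfl,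
    hb.coeff_one_eq_zero (y := x) (x := w) (by omega)] at h1
  simp only [add_zero, Int.cast_one, one_smul] at h1
  have h2 : b x = b (simpleRefl i) * b w - _ := eq_sub_of_add_eq h1.symm
  rw [h2, mul_sub, ← mul_assoc, hb.apply_simpleRefl_mul_self, smul_sub, smul_mul_assoc,
    Finset.mul_sum, Finset.smul_sum]
  congr 1
  refine Finset.sum_congr rfl fun y hy => ?_
  rw [mul_smul_comm, smul_comm _ _ (b y)]
  by_cases hya : Asc i y
  · simp [hya]
  · by_cases h0 : (h y w).coeff 1 = 0
    · simp [h0, Finset.ne_of_mem_erase hy]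
    · have hyw : y ≠ w := by rintro rfl; exact hya hw
      have := hb.length_lt hyw fun h' => h0 (by rw [h', Polynomial.coeff_zero])
      rw [ih (length y) (by omega) hya rfl]

theorem linearIndependent_std (hb : IsKazhdanLusztigBasis b h)
    : LinearIndependent ℤ[T;T⁻¹] (std (n := n)) := by
  apply linearIndependent_of_top_le_span_of_card_eq_finrank
  · rw [← b.span_eq, Submodule.span_le]
    rintro _ ⟨x, rfl⟩
    rw [hb.eq_sum x]
    exact Submodule.sum_mem _ fun y _ => Submodule.smul_mem _ _ (Submodule.subset_span ⟨y, rfl⟩)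
  · exact (Module.finrank_eq_card_basis b).symm

theorem sum_std_inj (hb : IsKazhdanLusztigBasis b h) {a a' : Equiv.Perm (Fin n) → ℤ[T;T⁻¹]}
    (haa : ∑ y, a y • std y = ∑ y, a' y • std y) : a = a' := by
  ext1 y
  have := Fintype.linearIndependent_iff.1 hb.linearIndependent_std (fun y => a y - a' y)
    (by simp only [sub_smul, Finset.sum_sub_distrib, haa, sub_self]) y
  exact sub_eq_zero.1 this

theorem gen_mul (hb : IsKazhdanLusztigBasis b h) (i : Fin (n - 1)) (x : Equiv.Perm (Fin n)) :
    gen i * b x = b (simpleRefl i) * b x - (T 1 : ℤ[T;T⁻¹]) • b x := by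
  rw [hb.apply_simpleRefl, add_mul, smul_one_mul, add_sub_cancel_right]

open Classical in
/-- The coefficients of `δ_s b_x = v⁻¹ b_x` for a descent `s` of `x`. -/
theorem coeff_of_not_asc (hb : IsKazhdanLusztigBasis b h)
    {i : Fin (n - 1)} {x : Equiv.Perm (Fin n)} (hx : ¬ Asc i x)
    (y : Equiv.Perm (Fin n)) :
    (toLaurent (h (simpleRefl i * y) x)
      + if Asc i y then 0 else (T (-1) - T 1) * toLaurent (h y x))
      = T (-1) * toLaurent (h y x) := by
  revert y
  refine funext_iff.1 (hb.sum_std_inj ?_)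
  rw [← gen_mul_sum_std i fun y => toLaurent (h y x), ← hb.eq_sum, hb.gen_mul,
    hb.mul_of_not_asc hx, ← sub_smul, add_sub_cancel_left]
  simp only [mul_smul]
  rw [← Finset.smul_sum, ← hb.eq_sum]

/-- Here h_{y,x} = v h_{sy,x}, so the coefficient of v is the constant term of h_{sy,x}. -/
theorem coeff_one_of_asc_of_not_asc (hb : IsKazhdanLusztigBasis b h)
    [DecidableEq (Equiv.Perm (Fin n))] {i : Fin (n - 1)}
    {x y : Equiv.Perm (Fin n)} (hx : ¬ Asc i x) (hy : Asc i y) :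
    (h y x).coeff 1 = if x = simpleRefl i * y then 1 else 0 := by
  classical
  have h1 := hb.coeff_of_not_asc hx y
  rw [if_pos hy, add_zero] at h1
  have h2 : h y x = Polynomial.X * h (simpleRefl i * y) x := by
    apply Polynomial.toLaurent_injective
    rw [map_mul, h1, Polynomial.toLaurent_X, ← mul_assoc, ← LaurentPolynomial.T_add]
    simp
  rw [h2, Polynomial.coeff_X_mul, hb.coeff_zero]
  simp only [eq_comm]

end IsKazhdanLusztigBasis

/-- The edge weights of the Kazhdan–Lusztig `W`-graph. -/
def klMu (h : Equiv.Perm (Fin n) → Equiv.Perm (Fin n) → ℤ[X]) (y x : Equiv.Perm (Fin n)) : ℤ :=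
  (h y x).coeff 1 + (h x y).coeff 1

theorem klMu_comm (y x : Equiv.Perm (Fin n)) : klMu h y x = klMu h x y := add_comm _ _

namespace IsKazhdanLusztigBasis

-- The separate term b_{sx} in `sum_of_asc` is exactly the summand h_{x,y} of the symmetrized weight
-- `klMu`.
open Classical in
theorem mul_of_asc (hb : IsKazhdanLusztigBasis b h)
    {i : Fin (n - 1)} {x : Equiv.Perm (Fin n)} (hx : Asc i x) :
    b (simpleRefl i) * b x
      = ∑ y, ((if Asc i y then 0 else klMu h y x : ℤ) : ℤ[T;T⁻¹]) • b y := by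
  rw [hb.sum_of_asc hx]
  refine Finset.sum_congr rfl fun y _ => ?_
  congr 2
  by_cases hy : Asc i y
  · rw [if_pos hy, if_pos hy]
  · rw [if_neg hy, if_neg hy, klMu, hb.coeff_one_of_asc_of_not_asc hy hx, add_comm]

theorem klMu_simpleRefl_mul (hb : IsKazhdanLusztigBasis b h)
    {i : Fin (n - 1)} {x : Equiv.Perm (Fin n)} (hx : Asc i x) :
    klMu h (simpleRefl i * x) x = 1 := by
  classical
  have hl := length_of_asc hx
  rw [klMu, hb.coeff_one_of_asc_of_not_asc (x := simpleRefl i * x)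
    (by rw [asc_simpleRefl_mul, not_not]; exact hx) hx, if_pos rfl,
    hb.coeff_one_eq_zero (by omega), zero_add]

open Classical in
theorem repr_mul_of_asc (hb : IsKazhdanLusztigBasis b h)
    {i : Fin (n - 1)} {x y : Equiv.Perm (Fin n)} (hx : Asc i x)
    (hy : ¬ Asc i y) : b.repr (b (simpleRefl i) * b x) y = (klMu h y x : ℤ[T;T⁻¹]) := by
  rw [hb.mul_of_asc hx, b.repr_sum_self, if_neg hy]

/-- Up to the sign (-1)^{ℓ(x)}, b̃_x is the image of b_x under the ring automorphism v ↦ v⁻¹, δ_s ↦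
-δ_s, which turns δ_s b_x = v⁻¹ b_x into this formula. The substitution is carried out on
coefficients. -/
theorem gen_mul_twistedKL_of_not_asc (hb : IsKazhdanLusztigBasis b h)
    {i : Fin (n - 1)} {x : Equiv.Perm (Fin n)}
    (hx : ¬ Asc i x) : gen i * twistedKL h x = (-T 1 : ℤ[T;T⁻¹]) • twistedKL h x := by
  classical
  rw [twistedKL, gen_mul_sum_std, Finset.smul_sum]
  refine Finset.sum_congr rfl fun y _ => ?_
  rw [smul_smul]
  congr 1
  have h1 := congrArg invert (hb.coeff_of_not_asc hx y)
  rw [map_add, map_mul, LaurentPolynomial.invert_T, neg_neg] at h1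
  by_cases hy : Asc i y
  · rw [if_pos hy, map_zero, add_zero] at h1
    rw [if_pos hy, h1, length_of_asc hy]
    ring
  · rw [if_neg hy, map_mul, map_sub, LaurentPolynomial.invert_T, LaurentPolynomial.invert_T,
      neg_neg] at h1
    rw [if_neg hy, ← length_of_not_asc hy, eq_sub_of_add_eq h1]
    ring

open Classical in
theorem gen_mul_twistedKL_of_asc (hb : IsKazhdanLusztigBasis b h)
    {i : Fin (n - 1)} {x : Equiv.Perm (Fin n)}
    (hx : Asc i x) : gen i * twistedKL h x = (T (-1) : ℤ[T;T⁻¹]) • twistedKL h x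
      - ∑ y, ((if Asc i y then 0 else (-1) ^ (length x + length y) * klMu h y x : ℤ) :
          ℤ[T;T⁻¹]) • twistedKL h y := by
  -- Both sides are the coefficient of δ_y in δ_s b_x = b_s b_x - v b_x. Inverting v and inserting
  -- signs gives the claim.
  have hE : ∀ y, (toLaurent (h (simpleRefl i * y) x)
      + if Asc i y then 0 else (T (-1) - T 1) * toLaurent (h y x))
      = (∑ z, ((if Asc i z then 0 else klMu h z x : ℤ) : ℤ[T;T⁻¹]) * toLaurent (h y z))
        - T 1 * toLaurent (h y x) := by
    refine funext_iff.1 (hb.sum_std_inj ?_)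
    rw [← gen_mul_sum_std i fun y => toLaurent (h y x), ← hb.eq_sum, hb.gen_mul,
      hb.mul_of_asc hx]
    simp only [sub_smul, Finset.sum_sub_distrib, Finset.sum_smul]
    rw [Finset.sum_comm]
    congr 1
    · refine Finset.sum_congr rfl fun z _ => ?_
      rw [hb.eq_sum z, Finset.smul_sum]
      simp only [smul_smul]
    · simp only [mul_smul]
      rw [← Finset.smul_sum, ← hb.eq_sum]
  have hS : ∑ y, ((if Asc i y then 0 else (-1) ^ (length x + length y) * klMu h y x : ℤ) :
          ℤ[T;T⁻¹]) • twistedKL h y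
      = ∑ y, ((-1) ^ (length x + length y) * invert (∑ z,
          ((if Asc i z then 0 else klMu h z x : ℤ) : ℤ[T;T⁻¹]) * toLaurent (h y z))) • std y := by
    simp only [twistedKL, Finset.smul_sum, map_sum, Finset.mul_sum, Finset.sum_smul]
    rw [Finset.sum_comm]
    refine Finset.sum_congr rfl fun y _ => Finset.sum_congr rfl fun z _ => ?_
    rw [smul_smul, map_mul, map_intCast]
    congr 1
    split_ifs
    · simp
    · push_cast
      have : ((-1) ^ (length z) * (-1) ^ (length z) : ℤ[T;T⁻¹]) = 1 := by
        rw [← mul_pow]; simp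
      linear_combination ((-1) ^ (length x + length y) * klMu h z x * invert (toLaurent (h y z)))
        * this
  rw [hS]
  conv_lhs => rw [twistedKL, gen_mul_sum_std]
  rw [twistedKL, Finset.smul_sum, ← Finset.sum_sub_distrib]
  refine Finset.sum_congr rfl fun y _ => ?_
  rw [smul_smul, ← sub_smul]
  congr 1
  have h1 := congrArg invert (hE y)
  rw [map_add, map_sub, map_mul invert (T 1), LaurentPolynomial.invert_T] at h1
  rw [← sub_eq_of_eq_add h1.symm]
  by_cases hy : Asc i y
  · rw [if_pos hy, if_pos hy, map_zero, length_of_asc hy]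
    ring
  · rw [if_neg hy, if_neg hy, map_mul, map_sub, LaurentPolynomial.invert_T,
      LaurentPolynomial.invert_T, neg_neg, ← length_of_not_asc hy]
    ring

end IsKazhdanLusztigBasis

end KazhdanLusztig

/-! ### W-graphs of left cells at v = 1. -/

section WGraph

/-- The simple reflections act in the basis `e` by a symmetric integral `W`-graph with descent sets
`D` and edge weights `m`. The last condition says that the star operation raising a descent `i` to
`i + 1` is realized by an edge of weight one. -/
structure IsWGraphBasis {n : ℕ} {V ι : Type*} [AddCommGroup V] [Module ℝ V] [Fintype ι]
    (ρ : Representation ℝ (Equiv.Perm (Fin n)) V) (e : Module.Basis ι ℝ V)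
    (D : ι → Fin (n - 1) → Prop) (m : ι → ι → ℤ) : Prop where
  symm : ∀ k l, m k l = m l k
  apply_of_mem : ∀ i k, D k i → ρ (simpleRefl i) (e k) = -e k
  apply_of_notMem : ∀ i k, ¬ D k i → ∃ c : ι → ℝ, (∀ l, D l i → c l = m l k) ∧
    (∀ l, ¬ D l i → c l = 0) ∧ ρ (simpleRefl i) (e k) = e k + ∑ l, c l • e l
  star : ∀ i j : Fin (n - 1), i.1 + 1 = j.1 → ∀ k, D k i → ¬ D k j →
    ∃ l, ¬ D l i ∧ D l j ∧ m l k = 1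

theorem evalOne_T (k : ℤ) : evalOne (LaurentPolynomial.T k) = 1 := by
  simp [evalOne]

theorem IsLeftCellBasis.exists_isWGraphBasis {n : ℕ} {V ι : Type*} [AddCommGroup V] [Module ℝ V]
    [Fintype ι] {ρ : Representation ℝ (Equiv.Perm (Fin n)) V} {e : Module.Basis ι ℝ V}
    (he : IsLeftCellBasis ρ e) : ∃ D m, IsWGraphBasis ρ e D m := by
  classical
  obtain ⟨b, b', h, z, c, hb, hb', hc, hcr, hact⟩ := he
  -- Star neighbours share a left cell: b_y occurs in b_{s_j} b_x and b_x occurs in b_{s_i} b_y.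
  have hstar : ∀ x y : Equiv.Perm (Fin n), ∀ i j : Fin (n - 1), ¬ Asc i x → Asc j x → Asc i y →
      ¬ Asc j y → klMu h y x = 1 → x ∈ leftCell b z → y ∈ leftCell b z := by
    intro x y i j hxi hxj hyi hyj hmu hx
    have h1 : LeftLE b y x := by
      refine Relation.ReflTransGen.single ⟨j, ?_⟩
      rw [hb.repr_mul_of_asc hxj hyj, hmu]
      simp
    have h2 : LeftLE b x y := by
      refine Relation.ReflTransGen.single ⟨i, ?_⟩
      rw [hb.repr_mul_of_asc hyi hxi, klMu_comm, hmu]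
      simp
    exact ⟨h1.trans hx.1, hx.2.trans h2⟩
  -- The sign stays inside the weight, which avoids a parity argument for `klMu`. It only has to be
  -- evaluated on star edges, where the lengths differ by one and the weight becomes +1.
  refine ⟨fun k i => ¬ Asc i (c k),
    fun l k => -((-1) ^ (length (c k) + length (c l)) * klMu h (c l) (c k)), ?_, ?_, ?_, ?_⟩
  · intro k l
    rw [klMu_comm, add_comm]
  · intro i k hk
    rw [hact, hb', hb.gen_mul_twistedKL_of_not_asc hk, ← hb', Finset.sum_eq_single k]
    · simp [evalOne_T]
    · intro l _ hl
      rw [map_smul, Finsupp.smul_apply, b'.repr_self, Finsupp.single_apply,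
        if_neg fun h' => hl (hc h').symm]
      simp
    · simp
  · intro i k hk
    rw [not_not] at hk
    refine ⟨fun l => if Asc i (c l) then 0 else
      ((-((-1) ^ (length (c k) + length (c l)) * klMu h (c l) (c k)) : ℤ) : ℝ), ?_, ?_, ?_⟩
    · intro l hl
      exact if_neg hl
    · intro l hl
      exact if_pos (not_not.1 hl)
    · have h1 : ∀ l, evalOne (b'.repr (gen i * b' (c k)) (c l))
          = (if k = l then 1 else 0) + if Asc i (c l) then 0 else
      ((-((-1) ^ (length (c k) + length (c l)) * klMu h (c l) (c k)) : ℤ) : ℝ) := by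
        intro l
        have h2 : gen i * b' (c k) = (LaurentPolynomial.T (-1) : ℤ[T;T⁻¹]) • b' (c k)
            - ∑ y, ((if Asc i y then 0 else
              (-1) ^ (length (c k) + length y) * klMu h y (c k) : ℤ) : ℤ[T;T⁻¹]) • b' y := by
          simp only [hb']
          exact hb.gen_mul_twistedKL_of_asc hk
        rw [h2, map_sub, Finsupp.sub_apply, b'.repr_sum_self, map_smul, Finsupp.smul_apply,
          b'.repr_self, Finsupp.single_apply, map_sub, map_intCast, smul_eq_mul, map_mul,
          evalOne_T, one_mul]
        simp only [hc.eq_iff]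
        split_ifs <;> simp [sub_eq_add_neg]
      simp only [hact, h1, add_smul, Finset.sum_add_distrib]
      congr 1
      simp
  · intro i j hij k hk hk'
    rw [not_not] at hk'
    obtain ⟨y, hyi, hyj, hy⟩ := exists_star hij hk hk'
    have hmu : klMu h y (c k) = 1 := by
      rcases hy with rfl | hy
      · exact hb.klMu_simpleRefl_mul hk'
      · rw [hy, klMu_comm]; exact hb.klMu_simpleRefl_mul hyi
    have hmem : y ∈ leftCell b z :=
      hstar (c k) y i j hk hk' hyi hyj hmu (hcr ▸ Set.mem_range_self k)
    rw [← hcr] at hmem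
    obtain ⟨l, rfl⟩ := hmem
    refine ⟨l, not_not.2 hyi, hyj, ?_⟩
    have hodd : Odd (length (c k) + length (c l)) := by
      rcases hy with hy | hy
      · rw [hy, length_of_asc hk']; exact ⟨length (c k), by ring⟩
      · rw [hy, length_of_asc hyi]; exact ⟨length (c l), by ring⟩
    rw [hmu, hodd.neg_one_pow]
    norm_num

end WGraph

/-! ### The Specht module of shape `(n - 2, 2)` in coordinates -/

section Coordinates

variable {n : ℕ}

theorem mem_cells_twoRow {hn : 4 ≤ n} {c : ℕ × ℕ} :
    c ∈ (twoRow n hn).cells ↔ (c.1 = 0 ∧ c.2 < n - 2) ∨ (c.1 = 1 ∧ c.2 < 2) := by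
  rw [YoungDiagram.mem_cells, twoRow, YoungDiagram.mem_ofRowLens]
  obtain ⟨a, b⟩ := c
  constructor
  · rintro ⟨h, h'⟩
    simp only [List.length_cons, List.length_nil] at h
    interval_cases a
    · exact Or.inl ⟨rfl, by simpa using h'⟩
    · exact Or.inr ⟨rfl, by simpa using h'⟩
  · rintro (⟨h, h'⟩ | ⟨h, h'⟩)
    · simp only at h; subst h; exact ⟨by simp, by simpa using h'⟩
    · simp only at h; subst h; exact ⟨by simp, by simpa using h'⟩

theorem card_cells_twoRow (hn : 4 ≤ n) : (twoRow n hn).cells.card = n := by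
  have h : (twoRow n hn).cells
      = ({0} ×ˢ Finset.range (n - 2)) ∪ ({1} ×ˢ Finset.range 2) := by
    ext ⟨a, b⟩
    rw [mem_cells_twoRow]
    simp only [Finset.mem_union, Finset.mem_product, Finset.mem_singleton, Finset.mem_range]
  rw [h, Finset.card_union_of_disjoint]
  · simp; omega
  · rw [Finset.disjoint_left]
    rintro ⟨a, b⟩ h1 h2
    simp at h1 h2
    omega

instance (μ : YoungDiagram) : Finite (Tabloid μ n) :=
  inferInstanceAs (Finite (Quotient (rowSetoid μ n)))

instance (μ : YoungDiagram) : Fintype (Tabloid μ n) := Fintype.ofFinite _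

/-- The row of the entry `k` of a tabloid. -/
def Tabloid.row {μ : YoungDiagram} (τ : Tabloid μ n) (k : Fin n) : ℕ :=
  Quotient.lift (s := rowSetoid μ n) (fun t => Tableau.row t k) (fun _ _ h => h k) τ

theorem Tabloid.ext_row {μ : YoungDiagram} {τ τ' : Tabloid μ n}
    (h : ∀ k, Tabloid.row τ k = Tabloid.row τ' k) : τ = τ' := by
  induction τ using Quotient.inductionOn
  induction τ' using Quotient.inductionOn
  exact Quotient.sound (s := rowSetoid μ n) h

theorem Tabloid.row_smul {μ : YoungDiagram} (σ : Equiv.Perm (Fin n)) (τ : Tabloid μ n)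
    (k : Fin n) : Tabloid.row (σ • τ) k = Tabloid.row τ (σ⁻¹ k) := by
  induction τ using Quotient.inductionOn
  rfl

/-- A cell of the diagram `(n - 2, 2)` in one of its first two columns. -/
def cell (hn : 4 ≤ n) (a b : Fin 2) : {c : ℕ × ℕ // c ∈ (twoRow n hn).cells} :=
  ⟨(a.1, b.1), mem_cells_twoRow.2 (by have := a.2; have := b.2; simp only; omega)⟩

variable {hn : 4 ≤ n}

theorem Tableau.row_eq_one_iff (t : Tableau (twoRow n hn) n) (k : Fin n) :
    Tableau.row t k = 1 ↔ k = t (cell hn 1 0) ∨ k = t (cell hn 1 1) := by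
  rw [← t.symm_apply_eq, ← t.symm_apply_eq, Tableau.row]
  obtain ⟨⟨a, b⟩, hc⟩ := t.symm k
  have := mem_cells_twoRow.1 hc
  simp only [cell, Subtype.mk.injEq, Prod.mk.injEq] at this ⊢
  simp
  omega

theorem Tableau.row_le_one (t : Tableau (twoRow n hn) n) (k : Fin n) : Tableau.row t k ≤ 1 := by
  have := mem_cells_twoRow.1 (t.symm k).2
  rw [Tableau.row]
  omega

theorem Tabloid.row_le_one (τ : Tabloid (twoRow n hn) n) (k : Fin n) : Tabloid.row τ k ≤ 1 := by
  induction τ using Quotient.inductionOn with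
  | _ t => exact Tableau.row_le_one t k

theorem Tabloid.exists_pair (τ : Tabloid (twoRow n hn) n) :
    ∃ x y : Fin n, x ≠ y ∧ ∀ k, Tabloid.row τ k = 1 ↔ k = x ∨ k = y := by
  induction τ using Quotient.inductionOn with
  | _ t =>
    refine ⟨t (cell hn 1 0), t (cell hn 1 1), fun h => ?_, fun k => Tableau.row_eq_one_iff t k⟩
    have := t.injective h
    simp [cell] at this

/-- The coefficient of the tabloid with second row `{p, q}`; it is zero for `p = q`. -/
def pairCoeff (p q : Fin n) : (Tabloid (twoRow n hn) n → ℝ) →ₗ[ℝ] ℝ :=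
  if p = q then 0 else
    ∑ τ, (if Tabloid.row τ p = 1 ∧ Tabloid.row τ q = 1 then 1 else 0 : ℝ) • LinearMap.proj τ

theorem pairCoeff_self (p : Fin n) (v : Tabloid (twoRow n hn) n → ℝ) : pairCoeff p p v = 0 := by
  simp [pairCoeff]

theorem pairCoeff_of_ne {p q : Fin n} (h : p ≠ q) (v : Tabloid (twoRow n hn) n → ℝ) :
    pairCoeff p q v = ∑ τ, if Tabloid.row τ p = 1 ∧ Tabloid.row τ q = 1 then v τ else 0 := by
  rw [pairCoeff, if_neg h, LinearMap.sum_apply]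
  refine Finset.sum_congr rfl fun τ _ => ?_
  rw [LinearMap.smul_apply, LinearMap.proj_apply, ite_smul, one_smul, zero_smul]

theorem pairCoeff_comm (p q : Fin n) (v : Tabloid (twoRow n hn) n → ℝ) :
    pairCoeff p q v = pairCoeff q p v := by
  by_cases h : p = q
  · rw [h]
  · rw [pairCoeff_of_ne h, pairCoeff_of_ne (Ne.symm h)]
    simp only [and_comm]

theorem pairCoeff_tabloidRep (σ : Equiv.Perm (Fin n)) (p q : Fin n)
    (v : Tabloid (twoRow n hn) n → ℝ) :
    pairCoeff p q (tabloidRep _ n σ v) = pairCoeff (σ⁻¹ p) (σ⁻¹ q) v := by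
  by_cases h : p = q
  · rw [h, pairCoeff_self, pairCoeff_self]
  · rw [pairCoeff_of_ne h, pairCoeff_of_ne fun h' => h (σ⁻¹.injective h')]
    refine Fintype.sum_equiv (MulAction.toPerm σ⁻¹) _ _ fun τ => ?_
    have hσ : ∀ k, σ (σ⁻¹ k) = k := σ.apply_symm_apply
    simp only [MulAction.toPerm_apply, Tabloid.row_smul, inv_inv, hσ]
    rfl

/-- A tabloid of this shape is determined by the two entries of its second row. -/
theorem eq_zero_of_pairCoeff {v : Tabloid (twoRow n hn) n → ℝ}
    (h : ∀ p q, pairCoeff p q v = 0) : v = 0 := by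
  funext τ
  obtain ⟨x, y, hxy, hr⟩ := Tabloid.exists_pair τ
  have h1 := h x y
  rw [pairCoeff_of_ne hxy, Finset.sum_eq_single τ] at h1
  · rwa [if_pos ⟨(hr x).2 (Or.inl rfl), (hr y).2 (Or.inr rfl)⟩] at h1
  · intro τ' _ hne
    rw [if_neg]
    rintro ⟨hx, hy⟩
    refine hne (Tabloid.ext_row fun k => ?_)
    obtain ⟨x', y', hxy', hr'⟩ := Tabloid.exists_pair τ'
    rw [hr'] at hx hy
    have hk : Tabloid.row τ' k = 1 ↔ Tabloid.row τ k = 1 := by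
      rw [hr, hr']
      rcases hx with rfl | rfl <;> rcases hy with rfl | rfl
      · exact absurd rfl hxy
      · rfl
      · exact or_comm
      · exact absurd rfl hxy
    have h1 := Tabloid.row_le_one τ k
    have h2 := Tabloid.row_le_one τ' k
    omega
  · simp

theorem sum_pairCoeff (p : Fin n) (v : Tabloid (twoRow n hn) n → ℝ) :
    ∑ q, pairCoeff p q v = ∑ τ, if Tabloid.row τ p = 1 then v τ else 0 := by
  have h1 : ∀ q, pairCoeff p q v
      = ∑ τ, if q ≠ p ∧ Tabloid.row τ p = 1 ∧ Tabloid.row τ q = 1 then v τ else 0 := by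
    intro q
    by_cases h : p = q
    · simp [h, pairCoeff_self]
    · rw [pairCoeff_of_ne h]; simp [Ne.symm h]
  simp only [h1]
  rw [Finset.sum_comm]
  refine Finset.sum_congr rfl fun τ _ => ?_
  obtain ⟨x, y, hxy, hr⟩ := Tabloid.exists_pair τ
  by_cases hp : Tabloid.row τ p = 1
  · have hp' := (hr p).1 hp
    simp only [hp, true_and, if_true]
    rcases hp' with rfl | rfl
    · rw [Finset.sum_eq_single y]
      · rw [if_pos ⟨hxy.symm, (hr y).2 (Or.inr rfl)⟩]
      · intro q _ hq
        rw [if_neg]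
        rintro ⟨h2, h3⟩
        rcases (hr q).1 h3 with h | h
        · exact h2 h
        · exact hq h
      · simp
    · rw [Finset.sum_eq_single x]
      · rw [if_pos ⟨hxy, (hr x).2 (Or.inl rfl)⟩]
      · intro q _ hq
        rw [if_neg]
        rintro ⟨h2, h3⟩
        rcases (hr q).1 h3 with h | h
        · exact hq h
        · exact h2 h
      · simp
  · simp [hp]

theorem Tableau.cell_of_col {t : Tableau (twoRow n hn) n} {k : Fin n} {b : Fin 2}
    (h : Tableau.col t k ≠ b.1) (a : Fin 2) : k ≠ t (cell hn a b) := by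
  rintro rfl
  exact h (by simp [Tableau.col, cell])

theorem Tableau.col_swap (t : Tableau (twoRow n hn) n) (b : Fin 2) (k : Fin n) :
    Tableau.col t (Equiv.swap (t (cell hn 0 b)) (t (cell hn 1 b)) k) = Tableau.col t k := by
  rw [Equiv.swap_apply_def]
  split_ifs with h1 h2
  · simp [h1, Tableau.col, cell]
  · simp [h2, Tableau.col, cell]
  · rfl

theorem Tableau.cell_ne (t : Tableau (twoRow n hn) n) (b : Fin 2) :
    t (cell hn 0 b) ≠ t (cell hn 1 b) := by
  intro h
  have := t.injective h
  simp [cell] at this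

theorem polytabloid_eq (t : Tableau (twoRow n hn) n) (τ : Tabloid (twoRow n hn) n) :
    open Classical in polytabloid t τ
      = ∑ σ : Equiv.Perm (Fin n) with ∀ k, Tableau.col t (σ k) = Tableau.col t k,
          ((Equiv.Perm.sign σ : ℤ) : ℝ) * if τ = Tabloid.mk (Tableau.perm σ t) then 1 else 0 := by
  classical
  rw [polytabloid, Finset.sum_apply]
  refine Finset.sum_congr rfl fun σ _ => ?_
  rw [Pi.smul_apply, Pi.single_apply, smul_eq_mul]

theorem Tableau.col_inv_apply {μ : YoungDiagram} {t : Tableau μ n} {σ : Equiv.Perm (Fin n)}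
    (h : ∀ k, Tableau.col t (σ k) = Tableau.col t k) (k : Fin n) :
    Tableau.col t (σ⁻¹ k) = Tableau.col t k := by
  have := h (σ⁻¹ k)
  rw [show σ (σ⁻¹ k) = k from σ.apply_symm_apply k] at this
  exact this.symm

/-- One of the two columns of height two does not contain p. Right multiplication by its
transposition reverses the sign of each term and leaves the row of p unchanged, so the terms cancel
in pairs. This is the source of the zero row sums. -/
theorem sum_row_polytabloid (t : Tableau (twoRow n hn) n) (p : Fin n) :
    ∑ τ, (if Tabloid.row τ p = 1 then polytabloid t τ else 0) = 0 := by
  classical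
  simp only [polytabloid_eq, ← Finset.sum_filter]
  rw [Finset.sum_comm]
  have h1 : ∀ σ : Equiv.Perm (Fin n),
      ∑ τ : Tabloid (twoRow n hn) n with Tabloid.row τ p = 1, ((Equiv.Perm.sign σ : ℤ) : ℝ)
        * (if τ = Tabloid.mk (Tableau.perm σ t) then 1 else 0)
      = ((Equiv.Perm.sign σ : ℤ) : ℝ) * if Tableau.row t (σ⁻¹ p) = 1 then 1 else 0 := by
    intro σ
    rw [← Finset.mul_sum, Finset.sum_ite_eq']
    congr 1
    simp only [Finset.mem_filter, Finset.mem_univ, true_and]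
    rfl
  simp only [h1]
  obtain ⟨b, hb⟩ : ∃ b : Fin 2, Tableau.col t p ≠ b.1 := by
    by_cases h : Tableau.col t p = 0
    · exact ⟨1, by simp [h]⟩
    · exact ⟨0, h⟩
  set π := Equiv.swap (t (cell hn 0 b)) (t (cell hn 1 b)) with hπ
  have hππ : π * π = 1 := Equiv.swap_mul_self _ _
  refine Finset.sum_involution (fun σ _ => σ * π) ?_ ?_ ?_ ?_
  · intro σ hσ
    have hσ' := (Finset.mem_filter.1 hσ).2
    have hfix : π (σ⁻¹ p) = σ⁻¹ p := by
      have hc : Tableau.col t (σ⁻¹ p) ≠ b.1 := by rwa [Tableau.col_inv_apply hσ']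
      exact Equiv.swap_apply_of_ne_of_ne (Tableau.cell_of_col hc 0) (Tableau.cell_of_col hc 1)
    have hinv : (σ * π)⁻¹ p = σ⁻¹ p := by
      rw [mul_inv_rev, hπ, Equiv.swap_inv, ← hπ, Equiv.Perm.mul_apply, hfix]
    rw [hinv, map_mul, hπ, Equiv.Perm.sign_swap (Tableau.cell_ne t b)]
    split_ifs <;> simp
  · intro σ _ _ h
    have h2 : π = 1 := by simpa using h
    rw [hπ, Equiv.swap_eq_one_iff] at h2
    exact Tableau.cell_ne t b h2
  · intro σ hσ
    have hσ' := (Finset.mem_filter.1 hσ).2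
    refine Finset.mem_filter.2 ⟨Finset.mem_univ _, fun k => ?_⟩
    rw [Equiv.Perm.mul_apply, hσ', hπ, Tableau.col_swap]
  · intro σ _
    rw [mul_assoc, hππ, mul_one]

theorem sum_pairCoeff_of_mem {v : Tabloid (twoRow n hn) n → ℝ}
    (hv : v ∈ (spechtSub (twoRow n hn) n).toSubmodule) (p : Fin n) :
    ∑ q, pairCoeff p q v = 0 := by
  have h : (spechtSub (twoRow n hn) n).toSubmodule
      ≤ LinearMap.ker (∑ q, pairCoeff (hn := hn) p q) := by
    refine Submodule.span_le.2 ?_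
    rintro _ ⟨t, rfl⟩
    simp only [SetLike.mem_coe, LinearMap.mem_ker, LinearMap.sum_apply]
    rw [sum_pairCoeff, sum_row_polytabloid]
  have := h hv
  simpa using this

/-- The tabloid of t has coefficient 1, because only the identity preserves both the rows and the
columns of t. -/
theorem polytabloid_ne_zero (t : Tableau (twoRow n hn) n) : polytabloid t ≠ 0 := by
  classical
  intro h
  have h1 := congrFun h (Tabloid.mk t)
  rw [polytabloid_eq, Finset.sum_eq_single 1] at h1
  · simp only [Equiv.Perm.sign_one, Units.val_one, Int.cast_one, one_mul, Pi.zero_apply] at h1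
    rw [if_pos (by rfl)] at h1
    exact one_ne_zero h1
  · intro σ hσ hne
    rw [if_neg, mul_zero]
    intro heq
    have hσ' := (Finset.mem_filter.1 hσ).2
    refine hne (inv_eq_one.1 (Equiv.ext fun k => ?_))
    have hrow : Tableau.row t k = Tableau.row t (σ⁻¹ k) :=
      congrArg (fun τ => Tabloid.row τ k) heq
    have hcol := Tableau.col_inv_apply hσ' k
    apply t.symm.injective
    exact Subtype.ext (Prod.ext hrow.symm hcol)
  · intro h'
    exact absurd (Finset.mem_filter.2 ⟨Finset.mem_univ _, fun k => rfl⟩) h'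

theorem tabloidRep_swap_polytabloid (t : Tableau (twoRow n hn) n) (b : Fin 2) :
    tabloidRep _ n (Equiv.swap (t (cell hn 0 b)) (t (cell hn 1 b))) (polytabloid t)
      = -polytabloid t := by
  classical
  set π := Equiv.swap (t (cell hn 0 b)) (t (cell hn 1 b)) with hπ
  have hππ : π * π = 1 := Equiv.swap_mul_self _ _
  have hcol : ∀ k, Tableau.col t (π k) = Tableau.col t k := Tableau.col_swap t b
  have hcol' : ∀ k, Tableau.col (Tableau.perm π t) k = Tableau.col t k := fun k =>
    Tableau.col_inv_apply hcol k
  rw [tabloidRep_polytabloid]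
  funext τ
  rw [Pi.neg_apply, polytabloid_eq, polytabloid_eq, ← Finset.sum_neg_distrib]
  refine Finset.sum_bij' (fun σ _ => σ * π) (fun σ _ => σ * π) ?_ ?_ ?_ ?_ ?_
  · intro σ hσ
    have hσ' := (Finset.mem_filter.1 hσ).2
    refine Finset.mem_filter.2 ⟨Finset.mem_univ _, fun k => ?_⟩
    rw [Equiv.Perm.mul_apply, ← hcol', hσ', hcol', hcol]
  · intro σ hσ
    have hσ' := (Finset.mem_filter.1 hσ).2
    refine Finset.mem_filter.2 ⟨Finset.mem_univ _, fun k => ?_⟩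
    rw [Equiv.Perm.mul_apply, hcol', hcol', hσ', hcol]
  · intro σ _
    rw [mul_assoc, hππ, mul_one]
  · intro σ _
    rw [mul_assoc, hππ, mul_one]
  · intro σ _
    rw [map_mul, hπ, Equiv.Perm.sign_swap (Tableau.cell_ne t b), ← hπ]
    have : Tableau.perm σ (Tableau.perm π t) = Tableau.perm (σ * π) t := rfl
    rw [this]
    split_ifs <;> simp

/-- Prescribing the two columns of height two gives polytabloids that are antisymmetric under two
chosen commuting reflections. -/
theorem exists_tableau (hn : 4 ≤ n) {a : Fin 2 → Fin 2 → Fin n}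
    (ha : Function.Injective fun c : Fin 2 × Fin 2 => a c.1 c.2) :
    ∃ t : Tableau (twoRow n hn) n, ∀ c d, t (cell hn c d) = a c d := by
  classical
  have hcard : Fintype.card {c : ℕ × ℕ // c ∈ (twoRow n hn).cells} = Fintype.card (Fin n) := by
    rw [Fintype.card_coe, card_cells_twoRow, Fintype.card_fin]
  let t₀ : Tableau (twoRow n hn) n := Fintype.equivOfCardEq hcard
  have h₀ : Function.Injective fun c : Fin 2 × Fin 2 => t₀ (cell hn c.1 c.2) := by
    rintro ⟨c, d⟩ ⟨c', d'⟩ h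
    have := t₀.injective h
    simp only [cell, Subtype.mk.injEq, Prod.mk.injEq] at this
    exact Prod.ext (Fin.ext this.1) (Fin.ext this.2)
  let E := (Equiv.ofInjective _ h₀).symm.trans (Equiv.ofInjective _ ha)
  refine ⟨Tableau.perm (Equiv.extendSubtype E) t₀, fun c d => ?_⟩
  have hmem : t₀ (cell hn c d) ∈ Set.range fun c : Fin 2 × Fin 2 => t₀ (cell hn c.1 c.2) :=
    ⟨(c, d), rfl⟩
  change Equiv.extendSubtype E (t₀ (cell hn c d)) = a c d
  rw [Equiv.extendSubtype_apply_of_mem E _ hmem]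
  have : (Equiv.ofInjective _ h₀).symm ⟨t₀ (cell hn c d), hmem⟩ = (c, d) := by
    rw [Equiv.symm_apply_eq]; rfl
  simp [E, this]

end Coordinates

/-! ### Specht vectors as quadratic forms, and their corner sums. -/

section QuadraticForms

variable {n : ℕ} {hn : 4 ≤ n}

/-- The coefficients `a_{p,q}` of an element `∑_{p<q} a_{p,q} x_p x_q` of the Specht module. -/
def coeffAt (p q : Fin n) : Specht (twoRow n hn) n →ₗ[ℝ] ℝ :=
  (pairCoeff p q).comp (spechtSub (twoRow n hn) n).toSubmodule.subtype

theorem coeffAt_self (p : Fin n) (v : Specht (twoRow n hn) n) : coeffAt p p v = 0 :=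
  pairCoeff_self p v.1

theorem coeffAt_comm (p q : Fin n) (v : Specht (twoRow n hn) n) :
    coeffAt p q v = coeffAt q p v :=
  pairCoeff_comm p q v.1

theorem sum_coeffAt (p : Fin n) (v : Specht (twoRow n hn) n) : ∑ q, coeffAt p q v = 0 :=
  sum_pairCoeff_of_mem v.2 p

theorem coeffAt_spechtRep (σ : Equiv.Perm (Fin n)) (p q : Fin n) (v : Specht (twoRow n hn) n) :
    coeffAt p q (spechtRep _ n σ v) = coeffAt (σ⁻¹ p) (σ⁻¹ q) v :=
  pairCoeff_tabloidRep σ p q v.1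

theorem ext_coeffAt {v w : Specht (twoRow n hn) n} (h : ∀ p q, coeffAt p q v = coeffAt p q w) :
    v = w := by
  rw [← sub_eq_zero]
  refine Subtype.ext (eq_zero_of_pairCoeff fun p q => ?_)
  have : coeffAt p q (v - w) = 0 := by rw [map_sub, h, sub_self]
  exact this

/-- The symmetric bilinear form `∑ a_{p,q} x_p y_q`, linear in the element of the Specht module as
well. -/
def quad : (Fin n → ℝ) →ₗ[ℝ] (Fin n → ℝ) →ₗ[ℝ] (Specht (twoRow n hn) n →ₗ[ℝ] ℝ) :=
  LinearMap.mk₂ ℝ (fun x y => ∑ p, ∑ q, (x p * y q) • coeffAt p q)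
    (fun x x' y => by
      simp only [Pi.add_apply, add_mul, add_smul, Finset.sum_add_distrib])
    (fun c x y => by
      simp only [Pi.smul_apply, smul_eq_mul, Finset.smul_sum, smul_smul, mul_assoc])
    (fun x y y' => by
      simp only [Pi.add_apply, mul_add, add_smul, Finset.sum_add_distrib])
    (fun c x y => by
      simp only [Pi.smul_apply, smul_eq_mul, Finset.smul_sum, smul_smul, mul_left_comm])

theorem quad_apply (x y : Fin n → ℝ) (v : Specht (twoRow n hn) n) :
    quad x y v = ∑ p, ∑ q, x p * y q * coeffAt p q v := by
  simp [quad]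

theorem quad_comm (x y : Fin n → ℝ) (v : Specht (twoRow n hn) n) :
    quad x y v = quad y x v := by
  rw [quad_apply, quad_apply, Finset.sum_comm]
  refine Finset.sum_congr rfl fun p _ => Finset.sum_congr rfl fun q _ => ?_
  rw [coeffAt_comm, mul_comm (x q)]

theorem quad_one_right (x : Fin n → ℝ) (v : Specht (twoRow n hn) n) : quad x 1 v = 0 := by
  rw [quad_apply]
  simp only [Pi.one_apply, mul_one, ← Finset.mul_sum, sum_coeffAt, mul_zero, Finset.sum_const_zero]

theorem quad_single (p q : Fin n) (v : Specht (twoRow n hn) n) :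
    quad (Pi.single p 1) (Pi.single q 1) v = coeffAt p q v := by
  rw [quad_apply, Finset.sum_eq_single p, Finset.sum_eq_single q]
  · simp
  · intro q' _ h
    simp [h]
  · simp
  · intro p' _ h
    simp [h]
  · simp

theorem quad_spechtRep (σ : Equiv.Perm (Fin n)) (x y : Fin n → ℝ) (v : Specht (twoRow n hn) n) :
    quad x y (spechtRep _ n σ v) = quad (x ∘ σ) (y ∘ σ) v := by
  rw [quad_apply, quad_apply]
  symm
  refine Fintype.sum_equiv σ _ _ fun p => Fintype.sum_equiv σ _ _ fun q => ?_
  rw [coeffAt_spechtRep, show σ⁻¹ (σ p) = p from σ.symm_apply_apply p,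
    show σ⁻¹ (σ q) = q from σ.symm_apply_apply q]
  rfl

/-- The indicator function of the first `i` letters. -/
def ind (i : ℕ) (p : Fin n) : ℝ := if p.1 < i then 1 else 0

theorem ind_zero : (ind 0 : Fin n → ℝ) = 0 := by
  funext p
  simp [ind]

theorem ind_self : (ind n : Fin n → ℝ) = 1 := by
  funext p
  simp [ind]

theorem single_eq_ind_sub (p : Fin n) : (Pi.single p 1 : Fin n → ℝ) = ind (p.1 + 1) - ind p.1 := by
  funext q
  rw [Pi.single_apply, Pi.sub_apply, ind, ind]
  simp only [Fin.ext_iff]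
  split_ifs <;> first | omega | norm_num

theorem ind_comp_of_ne {t : Fin (n - 1)} {i : ℕ} (h : t.1 + 1 ≠ i) :
    (ind i : Fin n → ℝ) ∘ simpleRefl t = ind i := by
  funext p
  simp only [Function.comp_apply, ind, simpleRefl_val]
  split_ifs <;> first | rfl | omega

/-- This is why corner sums of fixed vectors are harmonic: invariance under s_t says that the value
at position t + 1 is the mean of its two neighbours. -/
theorem ind_comp_self (t : Fin (n - 1)) :
    (ind (t.1 + 1) : Fin n → ℝ) ∘ simpleRefl t = ind t.1 + ind (t.1 + 2) - ind (t.1 + 1) := by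
  funext p
  simp only [Function.comp_apply, Pi.add_apply, Pi.sub_apply, ind, simpleRefl_val]
  split_ifs <;> first | omega | norm_num

/-- The functional `∑_{p ≤ i, q ≤ j} a_{p,q} = -∑_{p ≤ i, q > j} a_{p,q}` (with letters counted
from one). -/
def corner (i j : ℕ) : Specht (twoRow n hn) n →ₗ[ℝ] ℝ := quad (ind i) (ind j)

theorem corner_comm (i j : ℕ) (v : Specht (twoRow n hn) n) : corner i j v = corner j i v :=
  quad_comm _ _ v

theorem corner_zero_left (j : ℕ) (v : Specht (twoRow n hn) n) : corner 0 j v = 0 := by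
  simp [corner, ind_zero]

theorem corner_self_right (i : ℕ) (v : Specht (twoRow n hn) n) : corner i n v = 0 := by
  rw [corner, ind_self, quad_one_right]

theorem coeffAt_eq_corner (p q : Fin n) (v : Specht (twoRow n hn) n) :
    coeffAt p q v = corner (p.1 + 1) (q.1 + 1) v - corner p.1 (q.1 + 1) v
      - corner (p.1 + 1) q.1 v + corner p.1 q.1 v := by
  rw [← quad_single, single_eq_ind_sub, single_eq_ind_sub]
  simp only [map_sub, LinearMap.sub_apply, corner]
  ring

/-- The mixed second difference of corner sums at (i, i) is the coefficient of a square, which is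
zero. So corner sums with index gap one are determined by the diagonal ones. -/
theorem two_mul_corner_succ {i : ℕ} (hi : i < n) (v : Specht (twoRow n hn) n) :
    2 * corner i (i + 1) v = corner i i v + corner (i + 1) (i + 1) v := by
  have h := coeffAt_eq_corner ⟨i, hi⟩ ⟨i, hi⟩ v
  rw [coeffAt_self, corner_comm (i + 1) i] at h
  linarith

theorem corner_one_one (v : Specht (twoRow n hn) n) : corner 1 1 v = 0 := by
  have h := two_mul_corner_succ (i := 0) (by omega) v
  rw [corner_zero_left, corner_zero_left] at h
  linarith

theorem corner_pred_pred (v : Specht (twoRow n hn) n) : corner (n - 1) (n - 1) v = 0 := by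
  have h := two_mul_corner_succ (i := n - 1) (by omega) v
  rw [Nat.sub_add_cancel (by omega), corner_self_right, corner_self_right] at h
  linarith

theorem eq_zero_of_corner {v : Specht (twoRow n hn) n}
    (h : ∀ i j, i ≤ j → j ≤ n → corner i j v = 0) : v = 0 := by
  have h' : ∀ i j, i ≤ n → j ≤ n → corner i j v = 0 := by
    intro i j hi hj
    rcases le_total i j with hij | hij
    · exact h i j hij hj
    · rw [corner_comm]; exact h j i hij hi
  refine ext_coeffAt fun p q => ?_
  have := p.2
  have := q.2
  rw [coeffAt_eq_corner, h' _ _ (by omega) (by omega), h' _ _ (by omega) (by omega),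
    h' _ _ (by omega) (by omega), h' _ _ (by omega) (by omega)]
  simp

theorem corner_simpleRefl_of_ne {t : Fin (n - 1)} {i j : ℕ} (hi : t.1 + 1 ≠ i) (hj : t.1 + 1 ≠ j)
    (v : Specht (twoRow n hn) n) : corner i j (spechtRep _ n (simpleRefl t) v) = corner i j v := by
  rw [corner, quad_spechtRep, ind_comp_of_ne hi, ind_comp_of_ne hj]

theorem corner_simpleRefl_left (t : Fin (n - 1)) {j : ℕ} (hj : t.1 + 1 ≠ j)
    (v : Specht (twoRow n hn) n) : corner (t.1 + 1) j (spechtRep _ n (simpleRefl t) v)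
      = corner t.1 j v + corner (t.1 + 2) j v - corner (t.1 + 1) j v := by
  rw [corner, quad_spechtRep, ind_comp_of_ne hj, ind_comp_self]
  simp only [map_add, map_sub, LinearMap.sub_apply, LinearMap.add_apply, corner]

theorem corner_simpleRefl_diag (t : Fin (n - 1)) (v : Specht (twoRow n hn) n) :
    corner (t.1 + 1) (t.1 + 1) (spechtRep _ n (simpleRefl t) v)
      = 2 * corner t.1 (t.1 + 2) v - corner (t.1 + 1) (t.1 + 1) v := by
  have ht := t.2
  have h1 := two_mul_corner_succ (i := t.1) (by omega) v
  have h2 := two_mul_corner_succ (i := t.1 + 1) (by omega) v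
  rw [corner, quad_spechtRep, ind_comp_self]
  simp only [map_add, map_sub, LinearMap.sub_apply, LinearMap.add_apply]
  change _ = 2 * corner t.1 (t.1 + 2) v - corner (t.1 + 1) (t.1 + 1) v
  simp only [← corner.eq_def]
  rw [corner_comm (t.1 + 2) t.1, corner_comm (t.1 + 2) (t.1 + 1), corner_comm (t.1 + 1) t.1]
  linarith

theorem eq_mul_of_harmonic {u : ℕ → ℝ} {N : ℕ} (h0 : u 0 = 0)
    (h : ∀ m, m + 1 < N → 2 * u (m + 1) = u m + u (m + 2)) :
    ∀ k ≤ N, u k = k * u 1 := by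
  intro k
  induction k using Nat.strong_induction_on with
  | _ k ih =>
  intro hk
  match k with
  | 0 => simp [h0]
  | 1 => simp
  | k + 2 =>
    have h1 := h k (by omega)
    rw [ih (k + 1) (by omega) (by omega), ih k (by omega) (by omega)] at h1
    push_cast at h1 ⊢
    linarith

theorem eq_zero_of_harmonic {u : ℕ → ℝ} {N : ℕ} (h0 : u 0 = 0) (hN : u N = 0)
    (h : ∀ m, m + 1 < N → 2 * u (m + 1) = u m + u (m + 2)) : ∀ k ≤ N, u k = 0 := by
  intro k hk
  have h1 := eq_mul_of_harmonic h0 h N le_rfl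
  rw [hN] at h1
  rw [eq_mul_of_harmonic h0 h k hk]
  rcases mul_eq_zero.1 h1.symm with h2 | h2
  · have : k = 0 := by have := Nat.cast_eq_zero.1 h2; omega
    simp [this]
  · rw [h2, mul_zero]

/-- A vector fixed by the simple reflections at positions other than `i` and `j`. -/
theorem corner_of_fixed {i j : ℕ} (hi : 1 ≤ i) (hij : i ≤ j) (hj : j < n)
    {z : Specht (twoRow n hn) n}
    (hz : ∀ t : Fin (n - 1), t.1 + 1 ≠ i → t.1 + 1 ≠ j → spechtRep _ n (simpleRefl t) z = z) :
    corner i j z = i * (n - j : ℕ) * corner 1 (n - 1) z := by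
  -- One argument runs from 0 up to i, then the other from n down to j. The positions strictly in
  -- between carry reflections fixing z, so both functions are linear.
  have h1 : ∀ k ≤ i, corner k j z = k * corner 1 j z := by
    refine eq_mul_of_harmonic (u := fun k => corner k j z) (corner_zero_left j z) fun m hm => ?_
    have h := corner_simpleRefl_left ⟨m, by omega⟩ (j := j) (by simp only; omega) z
    rw [hz _ (by simp only; omega) (by simp only; omega)] at h
    simp only at h
    linarith
  have h2 : ∀ k ≤ n - j, corner (n - k) 1 z = k * corner (n - 1) 1 z := by
    refine eq_mul_of_harmonic (u := fun k => corner (n - k) 1 z)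
      (by rw [Nat.sub_zero, corner_comm, corner_self_right]) fun m hm => ?_
    have h := corner_simpleRefl_left ⟨n - (m + 2), by omega⟩ (j := 1) (by simp only; omega) z
    rw [hz _ (by simp only; omega) (by simp only; omega)] at h
    simp only [show n - (m + 2) + 1 = n - (m + 1) by omega, show n - (m + 2) + 2 = n - m by omega]
      at h
    linarith
  have h3 := h2 (n - j) le_rfl
  rw [show n - (n - j) = j by omega] at h3
  rw [h1 i le_rfl, corner_comm 1 j, h3, corner_comm (n - 1) 1]
  ring

/-- The triangle of corner sums is filled with zeros line by line. Each line is harmonic from the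
diagonal to the outer edge n - 1, and invariance on the diagonal identifies the next diagonal entry
with an entry, two steps off the diagonal, of the preceding line. -/
theorem eq_zero_of_fixed {z : Specht (twoRow n hn) n}
    (hz : ∀ t : Fin (n - 1), t.1 + 1 ≠ 1 → t.1 + 1 ≠ n - 1 → spechtRep _ n (simpleRefl t) z = z)
    (h0 : corner 1 (n - 1) z = 0) : z = 0 := by
  -- The disjunction covers lines starting on the diagonal and the outer edge. In both cases the
  -- interior positions avoid 1, n - 1 and j.
  have line : ∀ a j N, a + N = n - 1 → (a = j ∨ j = n - 1 ∧ 1 ≤ a) → 1 ≤ j → corner a j z = 0 →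
      corner (n - 1) j z = 0 → ∀ k ≤ N, corner (a + k) j z = 0 := by
    intro a j N haN haj hj h1 h2
    refine eq_zero_of_harmonic (u := fun k => corner (a + k) j z) h1 (by rw [haN]; exact h2)
      fun m hm => ?_
    have h := corner_simpleRefl_left ⟨a + m, by omega⟩ (j := j) (by simp only; omega) z
    rw [hz _ (by simp only; omega) (by simp only; omega)] at h
    simp only at h
    rw [show a + (m + 1) = a + m + 1 by ring, show a + (m + 2) = a + m + 2 by ring]
    linarith
  have hend : ∀ k ≤ n - 2, corner (1 + k) (n - 1) z = 0 :=
    line 1 (n - 1) (n - 2) (by omega) (Or.inr ⟨rfl, le_rfl⟩) (by omega) h0 (corner_pred_pred z)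
  have key : ∀ i N, i + 1 + N = n - 1 → ∀ k ≤ N, corner (i + 1 + k) (i + 1) z = 0 := by
    intro i
    induction i with
    | zero =>
      intro N hN
      exact line 1 1 N (by omega) (Or.inl rfl) le_rfl (corner_one_one z)
        (by rw [corner_comm]; exact h0)
    | succ i ih =>
      intro N hN
      refine line (i + 1 + 1) (i + 1 + 1) N hN (Or.inl rfl) (by omega) ?_ ?_
      · by_cases hlast : i + 1 + 1 = n - 1
        · rw [hlast, corner_pred_pred]
        · have h := corner_simpleRefl_diag ⟨i + 1, by omega⟩ z
          rw [hz _ (by simp only; omega) (by simp only; omega)] at h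
          simp only at h
          have h1 := ih (N + 1) (by omega) 2 (by omega)
          rw [corner_comm] at h1
          rw [h1] at h
          linarith
      · rw [corner_comm, add_comm (i + 1)]
        exact hend (i + 1) (by omega)
  refine eq_zero_of_corner fun i j hij hj => ?_
  by_cases hi0 : i = 0
  · rw [hi0, corner_zero_left]
  · by_cases hjn : j = n
    · rw [hjn, corner_self_right]
    · have := key (i - 1) (n - 1 - i) (by omega) (j - i) (by omega)
      rw [corner_comm]
      rwa [show i - 1 + 1 + (j - i) = j by omega, show i - 1 + 1 = i by omega] at this

end QuadraticForms

/-! ### Products of linear forms and common (-1)-eigenvectors. -/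

section Products

variable {n : ℕ} {hn : 4 ≤ n}

/-- The linear form `x_k - x_{k+1}`. -/
def alt (k : Fin (n - 1)) (p : Fin n) : ℝ :=
  (if p.1 = k.1 then 1 else 0) - if p.1 = k.1 + 1 then 1 else 0

theorem alt_comp_self (k : Fin (n - 1)) : alt k ∘ simpleRefl k = -alt k := by
  funext p
  simp only [Function.comp_apply, Pi.neg_apply, alt, simpleRefl_val]
  split_ifs <;> first | omega | norm_num

theorem alt_comp_succ {k l : Fin (n - 1)} (h : k.1 + 1 = l.1) :
    alt k ∘ simpleRefl l = alt k + alt l := by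
  funext p
  simp only [Function.comp_apply, Pi.add_apply, alt, simpleRefl_val]
  split_ifs <;> first | omega | norm_num

theorem alt_succ_comp {k l : Fin (n - 1)} (h : k.1 + 1 = l.1) :
    alt l ∘ simpleRefl k = alt k + alt l := by
  funext p
  simp only [Function.comp_apply, Pi.add_apply, alt, simpleRefl_val]
  split_ifs <;> first | omega | norm_num

theorem alt_comp_of_far {k l : Fin (n - 1)} (h : k.1 + 1 < l.1 ∨ l.1 + 1 < k.1) :
    alt k ∘ simpleRefl l = alt k := by
  funext p
  simp only [Function.comp_apply, alt, simpleRefl_val]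
  split_ifs <;> first | omega | norm_num

theorem alt_lo (k : Fin (n - 1)) : alt k (lo k) = 1 := by simp [alt, lo]

theorem alt_hi (k : Fin (n - 1)) : alt k (hi k) = -1 := by simp [alt, hi]

theorem alt_of_ne {k : Fin (n - 1)} {p : Fin n} (h : p ≠ lo k) (h' : p ≠ hi k) : alt k p = 0 := by
  rw [Ne, Fin.ext_iff] at h h'
  simp only [lo, hi] at h h'
  simp [alt, h, h']

theorem sum_ind_mul_alt (i : ℕ) (k : Fin (n - 1)) :
    ∑ p, ind i p * alt k p = if i = k.1 + 1 then 1 else 0 := by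
  have hne : hi k ≠ lo k := (lo_lt_hi k).ne'
  rw [← Finset.add_sum_erase _ _ (Finset.mem_univ (lo k)),
    ← Finset.add_sum_erase _ _ (Finset.mem_erase.2 ⟨hne, Finset.mem_univ (hi k)⟩),
    Finset.sum_eq_zero, alt_lo, alt_hi]
  · simp only [ind, lo, hi]
    by_cases h1 : k.1 < i <;> by_cases h2 : k.1 + 1 < i <;> by_cases h3 : i = k.1 + 1 <;>
      first | omega | simp [h1, h2, h3]
  · intro p hp
    simp only [Finset.mem_erase] at hp
    rw [alt_of_ne hp.2.1 hp.1, mul_zero]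

/-- `v` is the product of the linear forms `x` and `y`. -/
def IsProd (v : Specht (twoRow n hn) n) (x y : Fin n → ℝ) : Prop :=
  ∀ p q, coeffAt p q v = x p * y q + y p * x q

theorem IsProd.symm {v : Specht (twoRow n hn) n} {x y : Fin n → ℝ} (hv : IsProd v x y) :
    IsProd v y x := fun p q => by rw [hv, add_comm]

theorem IsProd.simpleRefl {v : Specht (twoRow n hn) n} {x y : Fin n → ℝ} (hv : IsProd v x y)
    (t : Fin (n - 1)) :
    IsProd (spechtRep _ n (simpleRefl t) v) (x ∘ KLCone.simpleRefl t)
      (y ∘ KLCone.simpleRefl t) := by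
  intro p q
  rw [coeffAt_spechtRep, simpleRefl_inv, hv]
  rfl

theorem IsProd.ne_zero {v : Specht (twoRow n hn) n} {i j : Fin (n - 1)} (hij : i.1 + 1 < j.1)
    (hv : IsProd v (alt i) (alt j)) : v ≠ 0 := by
  rintro rfl
  have h := hv (lo i) (lo j)
  rw [map_zero, alt_lo, alt_lo, alt_of_ne (k := j) (p := lo i) (by simp [lo, Fin.ext_iff]; omega)
    (by simp [lo, hi, Fin.ext_iff]; omega)] at h
  norm_num at h

theorem corner_of_isProd {v : Specht (twoRow n hn) n} {x y : Fin n → ℝ} (hv : IsProd v x y)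
    (i j : ℕ) : corner i j v
      = (∑ p, ind i p * x p) * (∑ q, ind j q * y q)
        + (∑ p, ind i p * y p) * (∑ q, ind j q * x q) := by
  rw [corner, quad_apply, Finset.sum_mul_sum, Finset.sum_mul_sum, ← Finset.sum_add_distrib]
  refine Finset.sum_congr rfl fun p _ => ?_
  rw [← Finset.sum_add_distrib]
  refine Finset.sum_congr rfl fun q _ => ?_
  rw [hv]
  ring

/-- A form antisymmetric under s_i is divisible by x_i - x_{i+1}. The other factor has the
coefficients of the row `lo i`. -/
theorem coeffAt_of_simpleRefl_eq_neg {i : Fin (n - 1)} {v : Specht (twoRow n hn) n}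
    (hv : spechtRep _ n (simpleRefl i) v = -v) (p q : Fin n) :
    coeffAt p q v = alt i p * coeffAt (lo i) q v + alt i q * coeffAt (lo i) p v := by
  have h : ∀ p q, coeffAt (simpleRefl i p) (simpleRefl i q) v = -coeffAt p q v := by
    intro p q
    rw [← map_neg, ← hv, coeffAt_spechtRep, simpleRefl_inv]
  have hlh : coeffAt (lo i) (hi i) v = 0 := by
    have := h (lo i) (hi i)
    rw [simpleRefl_lo, simpleRefl_hi, coeffAt_comm] at this
    linarith
  have cases : ∀ p : Fin n, p = lo i ∨ p = hi i ∨ (simpleRefl i p = p ∧ alt i p = 0) := by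
    intro p
    by_cases h1 : p = lo i
    · exact Or.inl h1
    · by_cases h2 : p = hi i
      · exact Or.inr (Or.inl h2)
      · exact Or.inr (Or.inr ⟨simpleRefl_of_ne i h1 h2, alt_of_ne h1 h2⟩)
  have hhq : ∀ q, simpleRefl i q = q → coeffAt (hi i) q v = -coeffAt (lo i) q v := by
    intro q hq
    have := h (lo i) q
    rwa [simpleRefl_lo, hq] at this
  rcases cases p with rfl | rfl | ⟨hp, hp'⟩ <;> rcases cases q with rfl | rfl | ⟨hq, hq'⟩
  · simp [coeffAt_self]
  · simp [coeffAt_self, hlh, alt_lo, alt_hi]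
  · rw [alt_lo, hq']; ring
  · rw [coeffAt_comm]; simp [coeffAt_self, hlh, alt_lo, alt_hi]
  · simp [coeffAt_self, hlh]
  · rw [alt_hi, hq', hhq q hq]; ring
  · rw [coeffAt_comm, alt_lo, hp']; ring
  · rw [coeffAt_comm, alt_hi, hp', hhq p hp]; ring
  · have := h p q
    rw [hp, hq] at this
    rw [hp', hq']
    linarith

theorem coeffAt_of_neg_of_neg {i j : Fin (n - 1)} (hij : i.1 + 1 < j.1)
    {v : Specht (twoRow n hn) n} (hi' : spechtRep _ n (simpleRefl i) v = -v)
    (hj' : spechtRep _ n (simpleRefl j) v = -v) (p q : Fin n) : coeffAt p q v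
      = coeffAt (lo i) (lo j) v * (alt i p * alt j q + alt j p * alt i q) := by
  have hz : alt j (lo i) = 0 := alt_of_ne (by simp [lo, Fin.ext_iff]; omega)
    (by simp [lo, hi, Fin.ext_iff]; omega)
  have h1 : ∀ q, coeffAt (lo i) q v = alt j q * coeffAt (lo i) (lo j) v := by
    intro q
    rw [coeffAt_of_simpleRefl_eq_neg hj', hz, zero_mul, zero_add, coeffAt_comm (lo i) (lo j)]
  rw [coeffAt_of_simpleRefl_eq_neg hi', h1 q, h1 p]
  ring

theorem eq_smul_of_neg_of_neg {i j : Fin (n - 1)} (hij : i.1 + 1 < j.1)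
    {v w : Specht (twoRow n hn) n} (hi' : spechtRep _ n (simpleRefl i) v = -v)
    (hj' : spechtRep _ n (simpleRefl j) v = -v) (hw : IsProd w (alt i) (alt j)) :
    v = coeffAt (lo i) (lo j) v • w := by
  refine ext_coeffAt fun p q => ?_
  rw [coeffAt_of_neg_of_neg hij hi' hj', map_smul, hw, smul_eq_mul]

/-- A quadratic form cannot alternate in three variables unless it vanishes. -/
theorem eq_zero_of_neg_of_neg {i j : Fin (n - 1)} (hij : i.1 + 1 = j.1)
    {v : Specht (twoRow n hn) n} (hi' : spechtRep _ n (simpleRefl i) v = -v)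
    (hj' : spechtRep _ n (simpleRefl j) v = -v) : v = 0 := by
  refine ext_coeffAt fun p q => ?_
  have hz : alt j (lo i) = 0 := alt_of_ne (by simp [lo, Fin.ext_iff]; omega)
    (by simp [lo, hi, Fin.ext_iff]; omega)
  have h0 : coeffAt (lo j) (lo i) v = 0 := by
    rw [← hi_eq_lo hij, coeffAt_of_simpleRefl_eq_neg hi', coeffAt_self, alt_lo, alt_hi, mul_zero,
      zero_add, one_mul]
    have h2 : coeffAt (lo i) (hi i) v = coeffAt (hi i) (lo i) v := coeffAt_comm _ _ _
    have h3 := congrArg (coeffAt (hi i) (lo i)) hi'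
    rw [coeffAt_spechtRep, simpleRefl_inv, simpleRefl_hi, simpleRefl_lo, map_neg] at h3
    linarith
  have h1 : ∀ q, coeffAt (lo i) q v = 0 := by
    intro q
    rw [coeffAt_of_simpleRefl_eq_neg hj', hz, h0]
    ring
  rw [coeffAt_of_simpleRefl_eq_neg hi', h1 q, h1 p, map_zero]
  ring

/-- The polytabloid with columns {i, i+1} and {j, j+1} is nonzero and antisymmetric under both
reflections, hence a multiple of the product; it is then normalized. -/
theorem exists_isProd_alt {i j : Fin (n - 1)} (hij : i.1 + 1 < j.1) :
    ∃ v : Specht (twoRow n hn) n, IsProd v (alt i) (alt j) ∧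
      spechtRep _ n (simpleRefl i) v = -v ∧ spechtRep _ n (simpleRefl j) v = -v := by
  obtain ⟨t, ht⟩ := exists_tableau hn
    (a := fun c d => if d = 0 then (if c = 0 then lo i else hi i)
      else (if c = 0 then lo j else hi j)) (by
    rintro ⟨c, d⟩ ⟨c', d'⟩ h
    fin_cases c <;> fin_cases d <;> fin_cases c' <;> fin_cases d' <;>
      first
      | rfl
      | (exfalso; simp [lo, hi, Fin.ext_iff] at h; omega)
      | (exfalso; simp [lo, hi, Fin.ext_iff] at h))
  set v : Specht (twoRow n hn) n := ⟨polytabloid t, Submodule.subset_span ⟨t, rfl⟩⟩ with hv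
  have hv0 : v ≠ 0 := fun h => polytabloid_ne_zero t (congrArg Subtype.val h)
  have h1 : spechtRep _ n (simpleRefl i) v = -v := by
    have := tabloidRep_swap_polytabloid t 0
    rw [ht, ht] at this
    exact Subtype.ext this
  have h2 : spechtRep _ n (simpleRefl j) v = -v := by
    have := tabloidRep_swap_polytabloid t 1
    rw [ht, ht] at this
    exact Subtype.ext this
  have h3 := coeffAt_of_neg_of_neg hij h1 h2
  have h0 : coeffAt (lo i) (lo j) v ≠ 0 := by
    intro h
    refine hv0 (ext_coeffAt fun p q => ?_)
    rw [h3, h, zero_mul, map_zero]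
  refine ⟨(coeffAt (lo i) (lo j) v)⁻¹ • v, fun p q => ?_, ?_, ?_⟩
  · rw [map_smul, h3 p q, smul_eq_mul, inv_mul_cancel_left₀ h0]
  · rw [map_smul, h1, smul_neg]
  · rw [map_smul, h2, smul_neg]

theorem corner_isProd_alt {v : Specht (twoRow n hn) n} {i j : Fin (n - 1)}
    (hv : IsProd v (alt i) (alt j)) (a b : ℕ) : corner a b v
      = (if a = i.1 + 1 then 1 else 0) * (if b = j.1 + 1 then 1 else 0)
        + (if a = j.1 + 1 then 1 else 0) * (if b = i.1 + 1 then 1 else 0) := by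
  rw [corner_of_isProd hv]
  simp only [sum_ind_mul_alt]

theorem corner_isProd_nested {v : Specht (twoRow n hn) n} {i j k : Fin (n - 1)}
    (hv : IsProd v (alt j) (alt i + alt j + alt k)) (a b : ℕ) : corner a b v
      = (if a = j.1 + 1 then 1 else 0) * ((if b = i.1 + 1 then 1 else 0)
          + (if b = j.1 + 1 then 1 else 0) + if b = k.1 + 1 then 1 else 0)
        + ((if a = i.1 + 1 then 1 else 0) + (if a = j.1 + 1 then 1 else 0)
          + if a = k.1 + 1 then 1 else 0) * (if b = j.1 + 1 then 1 else 0) := by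
  rw [corner_of_isProd hv]
  simp only [Pi.add_apply, mul_add, Finset.sum_add_distrib, sum_ind_mul_alt]

end Products

/-! ### Left cell bases of shape (n-2,2) are product bases. -/

section Classification

/-- The reflection s_i changes a vector only by basis elements that have i as a descent. -/
theorem IsWGraphBasis.coord_simpleRefl {n : ℕ} {V ι : Type*} [AddCommGroup V] [Module ℝ V]
    [Fintype ι] {ρ : Representation ℝ (Equiv.Perm (Fin n)) V} {e : Module.Basis ι ℝ V}
    {D : ι → Fin (n - 1) → Prop} {m : ι → ι → ℤ} (hw : IsWGraphBasis ρ e D m)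
    {k : ι} {i : Fin (n - 1)} (hk : ¬ D k i) (v : V) :
    e.coord k (ρ (simpleRefl i) v) = e.coord k v := by
  classical
  have h : (e.coord k).comp (ρ (simpleRefl i)) = e.coord k := by
    refine e.ext fun l => ?_
    rw [LinearMap.comp_apply]
    by_cases hl : D l i
    · have hlk : l ≠ k := by rintro rfl; exact hk hl
      rw [hw.apply_of_mem i l hl, map_neg, e.coord_apply, e.repr_self,
        Finsupp.single_eq_of_ne' hlk, neg_zero]
    · obtain ⟨c, -, hc, h⟩ := hw.apply_of_notMem i l hl
      rw [h, map_add, e.coord_apply k (∑ l, c l • e l), e.repr_sum_self, hc k hk, add_zero]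
  exact LinearMap.congr_fun h v

theorem IsWGraphBasis.coord_eq_zero {n : ℕ} {V ι : Type*} [AddCommGroup V] [Module ℝ V]
    [Fintype ι] {ρ : Representation ℝ (Equiv.Perm (Fin n)) V} {e : Module.Basis ι ℝ V}
    {D : ι → Fin (n - 1) → Prop} {m : ι → ι → ℤ} (hw : IsWGraphBasis ρ e D m)
    {k : ι} {i : Fin (n - 1)} (hk : ¬ D k i) {v : V} (hv : ρ (simpleRefl i) v = -v) :
    e.coord k v = 0 := by
  have h := hw.coord_simpleRefl hk v
  rw [hv, map_neg] at h
  linarith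

variable {n : ℕ} {hn : 4 ≤ n}

/-- The simple reflections `s_i` and `s_j` are distinct and commute. -/
def Far (i j : Fin (n - 1)) : Prop := i.1 + 1 < j.1 ∨ j.1 + 1 < i.1

theorem Far.symm {i j : Fin (n - 1)} (h : Far i j) : Far j i := Or.symm h

theorem Far.exists_isProd {i j : Fin (n - 1)} (h : Far i j) :
    ∃ v : Specht (twoRow n hn) n, v ≠ 0 ∧ IsProd v (alt i) (alt j) ∧
      spechtRep _ n (simpleRefl i) v = -v ∧ spechtRep _ n (simpleRefl j) v = -v := by
  rcases h with h | h
  · obtain ⟨v, h1, h2⟩ := exists_isProd_alt (hn := hn) h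
    exact ⟨v, h1.ne_zero h, h1, h2⟩
  · obtain ⟨v, h1, h2, h3⟩ := exists_isProd_alt (hn := hn) h
    exact ⟨v, h1.ne_zero h, h1.symm, h3, h2⟩

theorem Far.exists_eq_smul {i j : Fin (n - 1)} (h : Far i j) {v w : Specht (twoRow n hn) n}
    (hi' : spechtRep _ n (simpleRefl i) v = -v) (hj' : spechtRep _ n (simpleRefl j) v = -v)
    (hw : IsProd w (alt i) (alt j)) : ∃ c : ℝ, v = c • w := by
  rcases h with h | h
  · exact ⟨_, eq_smul_of_neg_of_neg h hi' hj' hw⟩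
  · exact ⟨_, eq_smul_of_neg_of_neg h hj' hi' hw.symm⟩

variable {ι : Type*} {e : Module.Basis ι ℝ (Specht (twoRow n hn) n)}
  {D : ι → Fin (n - 1) → Prop} {m : ι → ι → ℤ}

/-- The basis contains `c` times the product of the forms `x_i - x_{i+1}` and `x_j - x_{j+1}`. -/
def HasScale (e : Module.Basis ι ℝ (Specht (twoRow n hn) n)) (D : ι → Fin (n - 1) → Prop) (c : ℝ)
    (i j : Fin (n - 1)) : Prop :=
  ∃ x v, D x i ∧ D x j ∧ IsProd v (alt i) (alt j) ∧ e x = c • v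

theorem HasScale.symm {c : ℝ} {i j : Fin (n - 1)} (h : HasScale e D c i j) :
    HasScale e D c j i := by
  obtain ⟨x, v, h1, h2, h3, h4⟩ := h
  exact ⟨x, v, h2, h1, h3.symm, h4⟩

variable [Fintype ι]

theorem IsWGraphBasis.not_adjacent (hw : IsWGraphBasis (spechtRep (twoRow n hn) n) e D m)
    {x : ι} {i j : Fin (n - 1)} (hij : i.1 + 1 = j.1)
    (hi' : D x i) : ¬ D x j := fun hj' =>
  e.ne_zero x (eq_zero_of_neg_of_neg hij (hw.apply_of_mem i x hi') (hw.apply_of_mem j x hj'))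

/-- Any basis element occurring in the product has both descents, by `coord_eq_zero`, and so lies on
the line of the product. -/
theorem IsWGraphBasis.exists_hasScale (hw : IsWGraphBasis (spechtRep (twoRow n hn) n) e D m)
    {i j : Fin (n - 1)} (hij : Far i j) :
    ∃ c : ℝ, c ≠ 0 ∧ HasScale e D c i j := by
  obtain ⟨v, hv0, hv, hvi, hvj⟩ := hij.exists_isProd (hn := hn)
  obtain ⟨x, hx⟩ : ∃ x, e.coord x v ≠ 0 := by
    by_contra! h
    exact hv0 (e.forall_coord_eq_zero_iff.1 h)
  have hxi : D x i := by
    by_contra h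
    exact hx (hw.coord_eq_zero h hvi)
  have hxj : D x j := by
    by_contra h
    exact hx (hw.coord_eq_zero h hvj)
  obtain ⟨c, hc⟩ := hij.exists_eq_smul (hw.apply_of_mem i x hxi) (hw.apply_of_mem j x hxj) hv
  refine ⟨c, ?_, x, v, hxi, hxj, hv, hc⟩
  rintro rfl
  rw [zero_smul] at hc
  exact e.ne_zero x hc

/-- Applying s_{i'} to the product for (i, j) adds exactly the product for (i', j), a multiple c/c'
of one basis element. The star edge contributes coefficient 1, so c = c'. -/
theorem IsWGraphBasis.hasScale_succ (hw : IsWGraphBasis (spechtRep (twoRow n hn) n) e D m)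
    {c : ℝ} {i i' j : Fin (n - 1)} (hi' : i.1 + 1 = i'.1)
    (hij' : Far i' j) (h : HasScale e D c i j) : HasScale e D c i' j := by
  classical
  obtain ⟨x, v, hxi, hxj, hv, hxv⟩ := h
  have hxi' := hw.not_adjacent hi' hxi
  obtain ⟨l, hli, hli', hml⟩ := hw.star i i' hi' x hxi hxi'
  obtain ⟨a, ha, -, hact⟩ := hw.apply_of_notMem i' x hxi'
  obtain ⟨c', hc', y, w, hyi', hyj, hwp, hyw⟩ := hw.exists_hasScale hij'
  have hs : spechtRep _ n (simpleRefl i') v = v + w := by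
    refine ext_coeffAt fun p q => ?_
    rw [hv.simpleRefl i' p q, alt_comp_succ hi', alt_comp_of_far hij'.symm, map_add, hv, hwp]
    simp only [Pi.add_apply]
    ring
  have hsum : ∑ k, a k • e k = (c * c'⁻¹) • e y := by
    have h1 : c • (v + w) = c • v + ∑ k, a k • e k := by
      rw [← hs, ← map_smul, ← hxv, hact]
    rw [smul_add] at h1
    rw [hyw, smul_smul, inv_mul_cancel_right₀ hc']
    exact (add_left_cancel h1).symm
  have hcoord := congrArg (fun u => e.repr u l) hsum
  simp only [e.repr_sum_self, map_smul, Finsupp.smul_apply, e.repr_self, ha l hli', hml,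
    Int.cast_one, smul_eq_mul, Finsupp.single_apply] at hcoord
  split_ifs at hcoord with hyl
  · have hcc : c = c' := by
      rw [mul_one, ← div_eq_mul_inv] at hcoord
      exact (div_eq_one_iff_eq hc').1 hcoord.symm
    exact ⟨y, w, hyi', hyj, hwp, by rw [hyw, hcc]⟩
  · simp at hcoord

theorem IsWGraphBasis.exists_forall_hasScale (hw : IsWGraphBasis (spechtRep (twoRow n hn) n) e D m)
    :
    ∃ c : ℝ, c ≠ 0 ∧ ∀ i j : Fin (n - 1), i.1 + 1 < j.1 → HasScale e D c i j := by
  -- Every commuting pair is reached from (0, 2) by raising the second index and then the first,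
  -- staying among commuting pairs.
  have h0 : Far (⟨0, by omega⟩ : Fin (n - 1)) ⟨2, by omega⟩ := Or.inl (by simp)
  obtain ⟨c, hc, h⟩ := hw.exists_hasScale h0
  refine ⟨c, hc, ?_⟩
  have h1 : ∀ j, (hj : j + 2 < n - 1) → HasScale e D c ⟨0, by omega⟩ ⟨j + 2, hj⟩ := by
    intro j
    induction j with
    | zero => exact fun _ => h
    | succ j ih =>
      intro hj
      exact (hw.hasScale_succ (by simp only) (Or.inr (by simp only; omega))
        (ih (by omega)).symm).symm
  have h2 : ∀ i j, (hij : i + 1 < j) → (hj : j < n - 1) →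
      HasScale e D c ⟨i, by omega⟩ ⟨j, hj⟩ := by
    intro i
    induction i with
    | zero =>
      intro j hij hj
      have := h1 (j - 2) (by omega)
      simp only [show j - 2 + 2 = j by omega] at this
      exact this
    | succ i ih =>
      intro j hij hj
      exact hw.hasScale_succ (by simp only) (Or.inl (by simp only; omega)) (ih j (by omega) hj)
  exact fun i j hij => h2 i.1 j.1 hij j.2

/-- With v the product for (i, k), the nested form is w = s_j v - v, and s_i w = w + v. The
symmetric weights turn the second relation into a sum of squares equal to 1, which isolates a single
basis element. -/
theorem IsWGraphBasis.exists_nested (hw : IsWGraphBasis (spechtRep (twoRow n hn) n) e D m)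
    {c : ℝ} {i j k : Fin (n - 1)} (hij : i.1 + 1 = j.1)
    (hjk : j.1 + 1 = k.1) (h : HasScale e D c i k) :
    ∃ x w, IsProd w (alt j) (alt i + alt j + alt k) ∧ e x = c • w := by
  classical
  obtain ⟨x, v, hxi, hxk, hv, hxv⟩ := h
  have hxj := hw.not_adjacent hij hxi
  obtain ⟨l₀, -, hl₀j, hml₀⟩ := hw.star i j hij x hxi hxj
  obtain ⟨a, ha, ha', hact⟩ := hw.apply_of_notMem j x hxj
  set w := spechtRep _ n (simpleRefl j) v - v with hwv
  have hwp : IsProd w (alt j) (alt i + alt j + alt k) := by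
    intro p q
    rw [hwv, map_sub, hv.simpleRefl j p q, hv, alt_comp_succ hij, alt_succ_comp hjk]
    simp only [Pi.add_apply]
    ring
  have hs : spechtRep _ n (simpleRefl i) w = w + v := by
    refine ext_coeffAt fun p q => ?_
    rw [hwp.simpleRefl i p q, map_add, hwp, hv]
    have hfar : alt k ∘ simpleRefl i = alt k := alt_comp_of_far (Or.inr (by omega))
    have e1 : (alt i + alt j + alt k) ∘ simpleRefl i
        = alt i ∘ simpleRefl i + alt j ∘ simpleRefl i + alt k ∘ simpleRefl i := rfl
    rw [e1, alt_comp_self, alt_succ_comp hij, hfar]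
    simp only [Pi.add_apply, Pi.neg_apply]
    ring
  have hu : c • w = ∑ l, a l • e l := by
    rw [hwv, smul_sub, ← map_smul, ← hxv, hact, add_sub_cancel_left]
  -- Compare the coordinate at x in s_i(cw) = cw + `e x`. Each `e l` contributes the weight `m x l =
  -- m l x = a l`, on top of its own coefficient `a l`.
  have hsq : ∑ l, a l * a l = 1 := by
    have h1 : e.coord x (spechtRep _ n (simpleRefl i) (c • w)) = e.coord x (c • w) + 1 := by
      rw [map_smul, hs, smul_add, ← hxv, map_add, e.coord_apply x (e x), e.repr_self,
        Finsupp.single_eq_same]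
    rw [hu, map_sum, map_sum, map_sum] at h1
    have h2 : ∀ l, e.coord x (spechtRep _ n (simpleRefl i) (a l • e l))
        = e.coord x (a l • e l) + a l * a l := by
      intro l
      by_cases hl : D l j
      · have hli : ¬ D l i := fun h => hw.not_adjacent hij h hl
        obtain ⟨b, hb, -, hb'⟩ := hw.apply_of_notMem i l hli
        rw [map_smul, map_smul, hb', map_add, e.coord_apply x (∑ l, b l • e l), e.repr_sum_self,
          hb x hxi, map_smul, smul_add, smul_eq_mul (a l) (m x l : ℝ), hw.symm x l, ← ha l hl]
      · rw [ha' l hl]; simp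
    simp only [h2, Finset.sum_add_distrib] at h1
    linarith
  have ha₀ : a l₀ = 1 := by rw [ha l₀ hl₀j, hml₀, Int.cast_one]
  have hzero : ∀ l, l ≠ l₀ → a l = 0 := by
    intro l hl
    rw [← Finset.add_sum_erase _ _ (Finset.mem_univ l₀), ha₀, mul_one, add_eq_left,
      Finset.sum_eq_zero_iff_of_nonneg fun _ _ => mul_self_nonneg _] at hsq
    exact mul_self_eq_zero.1 (hsq l (Finset.mem_erase.2 ⟨hl, Finset.mem_univ l⟩))
  refine ⟨l₀, w, hwp, ?_⟩
  rw [hu, Finset.sum_eq_single l₀, ha₀, one_smul]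
  · intro l _ hl
    rw [hzero l hl, zero_smul]
  · simp

/-- The basis is, up to a common factor `c`, the basis of products of two forms `x_i - x_{i+1}`,
completed by the forms `(x_j - x_{j+1}) (x_{j-1} - x_{j+2})`. -/
structure IsProductBasis (e : Module.Basis ι ℝ (Specht (twoRow n hn) n)) (c : ℝ)
    (f : Fin (n - 1) → Fin (n - 1) → Specht (twoRow n hn) n)
    (g : Fin (n - 1) → Specht (twoRow n hn) n) : Prop where
  ne_zero : c ≠ 0
  isProd : ∀ i j, i.1 + 1 < j.1 → IsProd (f i j) (alt i) (alt j)
  isProd_nested : ∀ i j k, i.1 + 1 = j.1 → j.1 + 1 = k.1 →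
    IsProd (g j) (alt j) (alt i + alt j + alt k)
  mem : ∀ i j, i.1 + 1 < j.1 → ∃ x, e x = c • f i j
  mem_nested : ∀ j, 0 < j.1 → j.1 + 1 < n - 1 → ∃ x, e x = c • g j

theorem IsWGraphBasis.exists_isProductBasis
    (hw : IsWGraphBasis (spechtRep (twoRow n hn) n) e D m) : ∃ c f g, IsProductBasis e c f g := by
  obtain ⟨c, hc, hS⟩ := hw.exists_forall_hasScale
  have h1 : ∀ i j : Fin (n - 1), i.1 + 1 < j.1 →
      ∃ v, IsProd v (alt i) (alt j) ∧ ∃ x, e x = c • v := by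
    intro i j hij
    obtain ⟨x, v, -, -, hv, hx⟩ := hS i j hij
    exact ⟨v, hv, x, hx⟩
  have h2 : ∀ j : Fin (n - 1), 0 < j.1 ∧ j.1 + 1 < n - 1 →
      ∃ w, (∀ i k, i.1 + 1 = j.1 → j.1 + 1 = k.1 → IsProd w (alt j) (alt i + alt j + alt k)) ∧
        ∃ x, e x = c • w := by
    intro j hj
    obtain ⟨x, w, hwp, hx⟩ := hw.exists_nested (i := ⟨j.1 - 1, by omega⟩) (j := j)
      (k := ⟨j.1 + 1, hj.2⟩) (by simp only; omega) rfl (hS _ _ (by simp only; omega))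
    refine ⟨w, fun i k hi hk => ?_, x, hx⟩
    have hi' : i = ⟨j.1 - 1, by omega⟩ := Fin.ext (by simp only; omega)
    have hk' : k = ⟨j.1 + 1, hj.2⟩ := Fin.ext hk.symm
    rw [hk', hi']
    exact hwp
  choose! f hf hf' using h1
  choose! g hg hg' using h2
  refine ⟨c, f, g, hc, hf, fun i j k hi hk => ?_, hf', fun j h h' => hg' j ⟨h, h'⟩⟩
  have := k.2
  exact hg j (by omega) i k hi hk

end Classification

/-! ### Coordinates in a product basis are corner sums. -/

namespace IsProductBasis

variable {n : ℕ} {hn : 4 ≤ n} {ι : Type*} {e : Module.Basis ι ℝ (Specht (twoRow n hn) n)} {c : ℝ}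
  {f : Fin (n - 1) → Fin (n - 1) → Specht (twoRow n hn) n}
  {g : Fin (n - 1) → Specht (twoRow n hn) n}

theorem corner_nested (hp : IsProductBasis e c f g) {j : Fin (n - 1)} (hj : 0 < j.1)
    (hj' : j.1 + 1 < n - 1) (a b : ℕ) : corner a b (g j)
      = (if a = j.1 + 1 then 1 else 0) * ((if b = j.1 then 1 else 0)
          + (if b = j.1 + 1 then 1 else 0) + if b = j.1 + 2 then 1 else 0)
        + ((if a = j.1 then 1 else 0) + (if a = j.1 + 1 then 1 else 0)
          + if a = j.1 + 2 then 1 else 0) * (if b = j.1 + 1 then 1 else 0) := by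
  have h := corner_isProd_nested (hp.isProd_nested ⟨j.1 - 1, by omega⟩ j ⟨j.1 + 1, hj'⟩
    (by simp only; omega) rfl) a b
  simp only [show j.1 - 1 + 1 = j.1 by omega] at h
  exact h

theorem corner_nested_of_lt (hp : IsProductBasis e c f g) {j : Fin (n - 1)} (hj : 0 < j.1)
    (hj' : j.1 + 1 < n - 1) {a b : ℕ} (hab : a + 1 < b) : corner a b (g j) = 0 := by
  rw [hp.corner_nested hj hj']
  by_cases h1 : a = j.1 + 1
  · rw [if_neg (show ¬ b = j.1 by omega), if_neg (show ¬ b = j.1 + 1 by omega),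
      if_neg (show ¬ b = j.1 + 2 by omega)]
    simp
  · rw [if_neg h1]
    by_cases h2 : b = j.1 + 1
    · rw [if_neg (show ¬ a = j.1 by omega), if_neg (show ¬ a = j.1 + 2 by omega)]
      simp
    · rw [if_neg h2]
      simp

theorem corner_nested_diag (hp : IsProductBasis e c f g) {j : Fin (n - 1)} (hj : 0 < j.1)
    (hj' : j.1 + 1 < n - 1) (a : ℕ) : corner a a (g j) = if a = j.1 + 1 then 2 else 0 := by
  rw [hp.corner_nested hj hj']
  by_cases h1 : a = j.1 + 1
  · subst h1; norm_num
  · simp [h1]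

theorem corner_of_lt (hp : IsProductBasis e c f g) {i j : Fin (n - 1)} (hij : i.1 + 1 < j.1)
    {a b : ℕ} (hab : a ≤ b) :
    corner a b (f i j) = if a = i.1 + 1 ∧ b = j.1 + 1 then 1 else 0 := by
  rw [corner_isProd_alt (hp.isProd i j hij)]
  by_cases h1 : a = j.1 + 1
  · rw [if_neg (show ¬ b = i.1 + 1 by omega), if_neg (show ¬ a = i.1 + 1 by omega),
      if_neg (show ¬ (a = i.1 + 1 ∧ b = j.1 + 1) by omega)]
    simp
  · rw [if_neg h1]
    split_ifs <;> first | omega | norm_num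

theorem corner_nonneg (hp : IsProductBasis e c f g) {i j : Fin (n - 1)} (hij : i.1 + 1 < j.1)
    (a b : ℕ) : 0 ≤ corner a b (f i j) := by
  rw [corner_isProd_alt (hp.isProd i j hij)]
  positivity

theorem corner_nested_nonneg (hp : IsProductBasis e c f g) {j : Fin (n - 1)} (hj : 0 < j.1)
    (hj' : j.1 + 1 < n - 1) (a b : ℕ) : 0 ≤ corner a b (g j) := by
  rw [hp.corner_nested hj hj']
  positivity

/-- The expansion of a vector in the product basis. -/
theorem eq_sum (hp : IsProductBasis e c f g) (v : Specht (twoRow n hn) n) :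
    v = ∑ i : Fin (n - 1), ∑ j : Fin (n - 1),
          (if i.1 + 1 < j.1 then corner (i.1 + 1) (j.1 + 1) v else 0) • f i j
        + ∑ j : Fin (n - 1),
          (if 0 < j.1 ∧ j.1 + 1 < n - 1 then corner (j.1 + 1) (j.1 + 1) v / 2 else 0) • g j := by
  set w := ∑ i : Fin (n - 1), ∑ j : Fin (n - 1),
          (if i.1 + 1 < j.1 then corner (i.1 + 1) (j.1 + 1) v else 0) • f i j
        + ∑ j : Fin (n - 1),
          (if 0 < j.1 ∧ j.1 + 1 < n - 1 then corner (j.1 + 1) (j.1 + 1) v / 2 else 0) • g j with hw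
  have hcw : ∀ a b, corner a b w = ∑ i : Fin (n - 1), ∑ j : Fin (n - 1),
          (if i.1 + 1 < j.1 then corner (i.1 + 1) (j.1 + 1) v else 0) * corner a b (f i j)
        + ∑ j : Fin (n - 1), (if 0 < j.1 ∧ j.1 + 1 < n - 1 then
            corner (j.1 + 1) (j.1 + 1) v / 2 else 0) * corner a b (g j) := by
    intro a b
    rw [hw, map_add, map_sum, map_sum]
    simp only [map_sum, map_smul, smul_eq_mul]
  -- Only the nested forms have nonzero diagonal corners, and the value there is 2; hence the halves
  -- in the expansion.
  have hdiag : ∀ a ≤ n, corner a a w = corner a a v := by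
    intro a ha
    by_cases h0 : a = 0
    · rw [h0, corner_zero_left, corner_zero_left]
    by_cases hn' : a = n
    · rw [hn', corner_self_right, corner_self_right]
    by_cases h1 : a = 1
    · rw [h1, corner_one_one, corner_one_one]
    by_cases hn1 : a = n - 1
    · rw [hn1, corner_pred_pred, corner_pred_pred]
    rw [hcw, Finset.sum_eq_zero, zero_add, Finset.sum_eq_single ⟨a - 1, by omega⟩]
    · rw [if_pos (by simp only; omega), hp.corner_nested_diag (by simp only; omega)
        (by simp only; omega), if_pos (by simp only; omega)]
      simp only [show a - 1 + 1 = a by omega]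
      ring
    · intro j _ hj
      by_cases hj' : 0 < j.1 ∧ j.1 + 1 < n - 1
      · rw [if_pos hj', hp.corner_nested_diag hj'.1 hj'.2, if_neg, mul_zero]
        intro h
        exact hj (Fin.ext (by simp only; omega))
      · rw [if_neg hj', zero_mul]
    · simp
    · intro i _
      refine Finset.sum_eq_zero fun j _ => ?_
      by_cases hij : i.1 + 1 < j.1
      · rw [if_pos hij, hp.corner_of_lt hij le_rfl,
          if_neg (show ¬ (a = i.1 + 1 ∧ a = j.1 + 1) by omega), mul_zero]
      · rw [if_neg hij, zero_mul]
  have hoff : ∀ a b, a + 1 < b → b ≤ n → corner a b w = corner a b v := by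
    intro a b hab hb
    by_cases h0 : a = 0
    · rw [h0, corner_zero_left, corner_zero_left]
    by_cases hn' : b = n
    · rw [hn', corner_self_right, corner_self_right]
    rw [hcw, add_eq_left.2, Finset.sum_eq_single ⟨a - 1, by omega⟩,
      Finset.sum_eq_single ⟨b - 1, by omega⟩]
    · rw [if_pos (by simp only; omega), hp.corner_of_lt (by simp only; omega) (by omega),
        if_pos (by simp only; omega)]
      simp only [show a - 1 + 1 = a by omega, show b - 1 + 1 = b by omega, mul_one]
    · intro j _ hj
      by_cases hij : a - 1 + 1 < j.1
      · rw [if_pos hij, hp.corner_of_lt hij (by omega), if_neg, mul_zero]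
        rintro ⟨-, h⟩
        exact hj (Fin.ext (by simp only; omega))
      · rw [if_neg hij, zero_mul]
    · simp
    · intro i _ hi
      refine Finset.sum_eq_zero fun j _ => ?_
      by_cases hij : i.1 + 1 < j.1
      · rw [if_pos hij, hp.corner_of_lt hij (by omega), if_neg, mul_zero]
        rintro ⟨h, -⟩
        exact hi (Fin.ext (by simp only; omega))
      · rw [if_neg hij, zero_mul]
    · simp
    · refine Finset.sum_eq_zero fun j _ => ?_
      by_cases hj' : 0 < j.1 ∧ j.1 + 1 < n - 1
      · rw [hp.corner_nested_of_lt hj'.1 hj'.2 hab, mul_zero]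
      · rw [if_neg hj', zero_mul]
  rw [← sub_eq_zero]
  refine eq_zero_of_corner fun a b hab hb => ?_
  rw [map_sub, sub_eq_zero]
  -- Index gaps of zero and of at least two are settled; gap one is a mean of diagonal values.
  rcases Nat.lt_or_ge (a + 1) b with h | h
  · exact (hoff a b h hb).symm
  · rcases Nat.eq_or_lt_of_le hab with rfl | h'
    · exact (hdiag a hb).symm
    · obtain rfl : b = a + 1 := by omega
      have h1 := two_mul_corner_succ (i := a) (by omega) v
      have h2 := two_mul_corner_succ (i := a) (by omega) w
      rw [hdiag a (by omega), hdiag (a + 1) hb] at h2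
      linarith

/-- The listed basis elements already span the module, so by linear independence there are no
others. -/
theorem classify (hp : IsProductBasis e c f g) (x : ι) :
    (∃ i j, i.1 + 1 < j.1 ∧ e x = c • f i j) ∨
      ∃ j : Fin (n - 1), 0 < j.1 ∧ j.1 + 1 < n - 1 ∧ e x = c • g j := by
  set S : Set ι := {x | (∃ i j, i.1 + 1 < j.1 ∧ e x = c • f i j) ∨
      ∃ j : Fin (n - 1), 0 < j.1 ∧ j.1 + 1 < n - 1 ∧ e x = c • g j} with hS
  have hmem : ∀ {y : ι} {v : Specht (twoRow n hn) n}, y ∈ S → e y = c • v →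
      v ∈ Submodule.span ℝ (Set.image e S) := by
    intro y v hy hyv
    have h1 : v = c⁻¹ • e y := by rw [hyv, smul_smul, inv_mul_cancel₀ hp.ne_zero, one_smul]
    rw [h1]
    exact Submodule.smul_mem _ _ (Submodule.subset_span ⟨y, hy, rfl⟩)
  have hspan : e x ∈ Submodule.span ℝ (Set.image e S) := by
    rw [hp.eq_sum (e x)]
    refine Submodule.add_mem _ (Submodule.sum_mem _ fun i _ => Submodule.sum_mem _ fun j _ => ?_)
      (Submodule.sum_mem _ fun j _ => ?_)
    · by_cases hij : i.1 + 1 < j.1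
      · obtain ⟨y, hy⟩ := hp.mem i j hij
        exact Submodule.smul_mem _ _ (hmem (Or.inl ⟨i, j, hij, hy⟩) hy)
      · rw [if_neg hij, zero_smul]; exact Submodule.zero_mem _
    · by_cases hj : 0 < j.1 ∧ j.1 + 1 < n - 1
      · obtain ⟨y, hy⟩ := hp.mem_nested j hj.1 hj.2
        exact Submodule.smul_mem _ _ (hmem (Or.inr ⟨j, hj.1, hj.2, hy⟩) hy)
      · rw [if_neg hj, zero_smul]; exact Submodule.zero_mem _
  rw [e.mem_span_image, e.repr_self] at hspan
  have hx : x ∈ S := hspan (by simp)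
  exact hx

theorem coord_eq (hp : IsProductBasis e c f g) {x : ι} {i j : Fin (n - 1)} (hij : i.1 + 1 < j.1)
    (hx : e x = c • f i j) (v : Specht (twoRow n hn) n) :
    e.coord x v = c⁻¹ * corner (i.1 + 1) (j.1 + 1) v := by
  classical
  have h : e.coord x = c⁻¹ • corner (i.1 + 1) (j.1 + 1) := by
    refine e.ext fun y => ?_
    rw [e.coord_apply, e.repr_self, LinearMap.smul_apply, Finsupp.single_apply, smul_eq_mul]
    rcases hp.classify y with ⟨i', j', hij', hy⟩ | ⟨j', hj, hj', hy⟩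
    · rw [hy, map_smul, smul_eq_mul, inv_mul_cancel_left₀ hp.ne_zero,
        hp.corner_of_lt hij' (by omega)]
      by_cases hxy : y = x
      · subst hxy
        have h1 : f i j = f i' j' := smul_right_injective _ hp.ne_zero (hx.symm.trans hy)
        have h2 := congrArg (corner (i.1 + 1) (j.1 + 1)) h1
        rw [hp.corner_of_lt hij (by omega), hp.corner_of_lt hij' (by omega),
          if_pos ⟨rfl, rfl⟩] at h2
        rw [if_pos rfl, ← h2]
      · rw [if_neg hxy, if_neg]
        rintro ⟨h1, h2⟩
        obtain rfl : i = i' := Fin.ext (by omega)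
        obtain rfl : j = j' := Fin.ext (by omega)
        exact hxy (e.injective (hy.trans hx.symm))
    · rw [hy, map_smul, hp.corner_nested_of_lt hj hj' (by omega), smul_zero, mul_zero, if_neg]
      rintro rfl
      have h1 : f i j = g j' := smul_right_injective _ hp.ne_zero (hx.symm.trans hy)
      have h2 := congrArg (corner (i.1 + 1) (j.1 + 1)) h1
      rw [hp.corner_of_lt hij (by omega), hp.corner_nested_of_lt hj hj' (by omega),
        if_pos ⟨rfl, rfl⟩] at h2
      exact one_ne_zero h2
  rw [h, LinearMap.smul_apply, smul_eq_mul]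

theorem coord_eq_nested (hp : IsProductBasis e c f g) {x : ι} {j : Fin (n - 1)} (hj : 0 < j.1)
    (hj' : j.1 + 1 < n - 1) (hx : e x = c • g j) (v : Specht (twoRow n hn) n) :
    e.coord x v = 2⁻¹ * (c⁻¹ * corner (j.1 + 1) (j.1 + 1) v) := by
  classical
  have h : e.coord x = (2⁻¹ * c⁻¹) • corner (j.1 + 1) (j.1 + 1) := by
    refine e.ext fun y => ?_
    rw [e.coord_apply, e.repr_self, LinearMap.smul_apply, Finsupp.single_apply, smul_eq_mul]
    rcases hp.classify y with ⟨i, k, hik, hy⟩ | ⟨k, hk, hk', hy⟩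
    · rw [hy, map_smul, hp.corner_of_lt hik le_rfl,
        if_neg (show ¬ (j.1 + 1 = i.1 + 1 ∧ j.1 + 1 = k.1 + 1) by omega), smul_zero, mul_zero,
        if_neg]
      rintro rfl
      have h1 : f i k = g j := smul_right_injective _ hp.ne_zero (hy.symm.trans hx)
      have h2 := congrArg (corner (i.1 + 1) (k.1 + 1)) h1
      rw [hp.corner_of_lt hik (by omega), hp.corner_nested_of_lt hj hj' (by omega),
        if_pos ⟨rfl, rfl⟩] at h2
      exact one_ne_zero h2
    · rw [hy, map_smul, smul_eq_mul, mul_assoc, inv_mul_cancel_left₀ hp.ne_zero,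
        hp.corner_nested_diag hk hk']
      by_cases hxy : y = x
      · subst hxy
        have h1 : g j = g k := smul_right_injective _ hp.ne_zero (hx.symm.trans hy)
        have h2 := congrArg (corner (j.1 + 1) (j.1 + 1)) h1
        rw [hp.corner_nested_diag hj hj', hp.corner_nested_diag hk hk', if_pos rfl] at h2
        rw [if_pos rfl, ← h2]
        norm_num
      · rw [if_neg hxy, if_neg, mul_zero]
        intro h1
        obtain rfl : j = k := Fin.ext (by omega)
        exact hxy (e.injective (hy.trans hx.symm))
  rw [h, LinearMap.smul_apply, smul_eq_mul, mul_assoc]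

theorem exists_coord (hp : IsProductBasis e c f g) (x : ι) :
    ∃ (a b : ℕ) (κ : ℝ), 1 ≤ a ∧ a ≤ b ∧ b < n ∧ 0 < κ ∧
      ∀ v, e.coord x v = κ * (c⁻¹ * corner a b v) := by
  rcases hp.classify x with ⟨i, j, hij, hx⟩ | ⟨j, hj, hj', hx⟩
  · exact ⟨i.1 + 1, j.1 + 1, 1, by omega, by omega, by omega, one_pos, fun v => by
      rw [one_mul]; exact hp.coord_eq hij hx v⟩
  · exact ⟨j.1 + 1, j.1 + 1, 2⁻¹, by omega, le_rfl, by omega, by norm_num,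
      hp.coord_eq_nested hj hj' hx⟩

theorem exists_coord_outer (hp : IsProductBasis e c f g) :
    ∃ x, ∀ v, e.coord x v = c⁻¹ * corner 1 (n - 1) v := by
  obtain ⟨x, hx⟩ := hp.mem ⟨0, by omega⟩ ⟨n - 2, by omega⟩ (by simp only; omega)
  refine ⟨x, fun v => ?_⟩
  rw [hp.coord_eq (by simp only; omega) hx v]
  simp only [zero_add, show n - 2 + 1 = n - 1 by omega]

theorem corner_apply_nonneg (hp : IsProductBasis e c f g) (x : ι) (a b : ℕ) :
    0 ≤ c⁻¹ * corner a b (e x) := by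
  rcases hp.classify x with ⟨i, j, hij, hx⟩ | ⟨j, hj, hj', hx⟩
  · rw [hx, map_smul, smul_eq_mul, inv_mul_cancel_left₀ hp.ne_zero]
    exact hp.corner_nonneg hij a b
  · rw [hx, map_smul, smul_eq_mul, inv_mul_cancel_left₀ hp.ne_zero]
    exact hp.corner_nested_nonneg hj hj' a b

/-- Composing a corner functional (indices between 1 and n - 1) with 1 + s_t gives a sum of two
corner functionals, as the subtracted term in the reflection formula cancels. All corners are
nonnegative on the basis after division by c. -/
theorem coord_add_simpleRefl_nonneg (hp : IsProductBasis e c f g) (t : Fin (n - 1)) (x y : ι) :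
    0 ≤ e.coord y (e x + spechtRep _ n (simpleRefl t) (e x)) := by
  obtain ⟨a, b, κ, ha, hab, hb, hκ, hy⟩ := hp.exists_coord y
  have hpos := hp.corner_apply_nonneg x
  have key : ∃ a' b' a'' b'', corner a b (e x + spechtRep _ n (simpleRefl t) (e x))
      = corner a' b' (e x) + corner a'' b'' (e x) := by
    rw [map_add]
    by_cases h1 : t.1 + 1 = a
    · subst h1
      by_cases h2 : t.1 + 1 = b
      · subst h2
        refine ⟨t.1, t.1 + 2, t.1, t.1 + 2, ?_⟩
        rw [corner_simpleRefl_diag]; ring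
      · refine ⟨t.1, b, t.1 + 2, b, ?_⟩
        rw [corner_simpleRefl_left t h2]; ring
    · by_cases h2 : t.1 + 1 = b
      · subst h2
        refine ⟨t.1, a, t.1 + 2, a, ?_⟩
        rw [corner_comm, corner_comm a, corner_simpleRefl_left t h1]; ring
      · refine ⟨a, b, a, b, ?_⟩
        rw [corner_simpleRefl_of_ne h1 h2]
  obtain ⟨a', b', a'', b'', h⟩ := key
  rw [hy, h, mul_add]
  exact mul_nonneg hκ.le (add_nonneg (hpos _ _) (hpos _ _))

end IsProductBasis

/-! ### Invariant cones -/

section Cones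

variable {n : ℕ} {μ : YoungDiagram}

theorem sum_sq_spechtRep (σ : Equiv.Perm (Fin n)) (v : Specht μ n) :
    ∑ τ, ((spechtRep μ n σ v).1 τ) ^ 2 = ∑ τ, (v.1 τ) ^ 2 :=
  Fintype.sum_equiv (MulAction.toPerm σ⁻¹) _ _ fun _ => rfl

theorem simpleRefl_apply_apply (t : Fin (n - 1)) (v : Specht μ n) :
    spechtRep μ n (simpleRefl t) (spechtRep μ n (simpleRefl t) v) = v := by
  rw [← Module.End.mul_apply, ← map_mul, simpleRefl_mul_self, map_one, Module.End.one_apply]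

/-- Symmetrization with respect to a parabolic subgroup stays in a closed invariant cone. -/
theorem exists_fixed_mem {C : PointedCone ℝ (Specht μ n)} (hC : IsClosed (C : Set (Specht μ n)))
    {J : Fin (n - 1) → Prop}
    (hJ : ∀ t, J t → ∀ v ∈ C, v + spechtRep μ n (simpleRefl t) v ∈ C)
    {v : Specht μ n} (hv : v ∈ C) :
    ∃ u ∈ C, (∀ t, J t → spechtRep μ n (simpleRefl t) u = u) ∧
      ∀ φ : Specht μ n →ₗ[ℝ] ℝ, (∀ t, J t → ∀ w, φ (spechtRep μ n (simpleRefl t) w) = φ w) →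
        φ u = φ v := by
  set N : Specht μ n → ℝ := fun w => ∑ τ, (w.1 τ) ^ 2 with hN
  have hNc : Continuous N := by
    refine continuous_finsetSum _ fun τ _ => ?_
    exact ((continuous_apply τ).comp continuous_subtype_val).pow 2
  -- As C is stable only under 1 + s and not under s, averaging over the group is replaced by
  -- minimizing an invariant norm on this compact set.
  set Q : Set (Specht μ n) := {w | w ∈ C ∧ (∀ φ : Specht μ n →ₗ[ℝ] ℝ,
    (∀ t, J t → ∀ w, φ (spechtRep μ n (simpleRefl t) w) = φ w) → φ w = φ v) ∧ N w ≤ N v} with hQ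
  have hQc : IsCompact Q := by
    refine Metric.isCompact_of_isClosed_isBounded ?_ ?_
    · refine hC.inter (IsClosed.inter ?_ (isClosed_le hNc continuous_const))
      have : {w : Specht μ n | ∀ φ : Specht μ n →ₗ[ℝ] ℝ,
          (∀ t, J t → ∀ w, φ (spechtRep μ n (simpleRefl t) w) = φ w) → φ w = φ v}
          = ⋂ φ : Specht μ n →ₗ[ℝ] ℝ, ⋂ _ : ∀ t, J t → ∀ w,
            φ (spechtRep μ n (simpleRefl t) w) = φ w, {w | φ w = φ v} := by
        ext w; simp
      change IsClosed {w : Specht μ n | _}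
      rw [this]
      exact isClosed_iInter fun φ => isClosed_iInter fun _ =>
        isClosed_eq φ.continuous_of_finiteDimensional continuous_const
    · refine isBounded_iff_forall_norm_le.2 ⟨Real.sqrt (N v), fun w hw => ?_⟩
      change ‖w.1‖ ≤ _
      rw [pi_norm_le_iff_of_nonneg (Real.sqrt_nonneg _)]
      intro τ
      refine Real.abs_le_sqrt (le_trans ?_ hw.2.2)
      exact Finset.single_le_sum (f := fun τ => (w.1 τ) ^ 2) (fun _ _ => sq_nonneg _)
        (Finset.mem_univ τ)
  obtain ⟨u, hu, hmin⟩ := hQc.exists_isMinOn ⟨v, hv, fun _ _ => rfl, le_rfl⟩ hNc.continuousOn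
  refine ⟨u, hu.1, fun t ht => ?_, hu.2.1⟩
  set s := spechtRep μ n (simpleRefl t) u with hs
  -- Parallelogram law: the midpoint of u and its reflection, which lies in `Q` again, has strictly
  -- smaller norm unless the two agree.
  have hNw : 4 * N ((2⁻¹ : ℝ) • (u + s)) + N (u - s) = 4 * N u := by
    have h1 : N s = N u := sum_sq_spechtRep _ u
    have h2 : 4 * N ((2⁻¹ : ℝ) • (u + s)) + N (u - s) = 2 * N u + 2 * N s := by
      simp only [hN, Finset.mul_sum, ← Finset.sum_add_distrib]
      refine Finset.sum_congr rfl fun τ _ => ?_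
      simp only [Submodule.coe_smul, Submodule.coe_add, Submodule.coe_sub, Pi.smul_apply,
        Pi.add_apply, Pi.sub_apply, smul_eq_mul]
      ring
    rw [h2, h1]; ring
  have hNn : 0 ≤ N (u - s) := Finset.sum_nonneg fun _ _ => sq_nonneg _
  have hw : (2⁻¹ : ℝ) • (u + s) ∈ Q := by
    refine ⟨PointedCone.smul_mem C (by norm_num) (hJ t ht u hu.1), fun φ hφ => ?_, ?_⟩
    · rw [map_smul, map_add, hs, hφ t ht, hu.2.1 φ hφ, smul_eq_mul]; ring
    · have := hu.2.2
      linarith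
  have hle : N u ≤ N ((2⁻¹ : ℝ) • (u + s)) := hmin hw
  have h0 : N (u - s) = 0 := by linarith
  rw [hN, Finset.sum_eq_zero_iff_of_nonneg fun _ _ => sq_nonneg _] at h0
  refine (sub_eq_zero.1 (Subtype.ext (funext fun τ => ?_))).symm
  exact pow_eq_zero_iff (two_ne_zero) |>.1 (h0 τ (Finset.mem_univ τ))

theorem mem_hull_range_iff {V ι : Type*} [AddCommGroup V] [Module ℝ V] [Fintype ι]
    (e : Module.Basis ι ℝ V) (v : V) :
    v ∈ PointedCone.hull ℝ (Set.range e) ↔ ∀ k, 0 ≤ e.coord k v := by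
  classical
  constructor
  · intro hv k
    induction hv using Submodule.span_induction with
    | mem x hx =>
      obtain ⟨l, rfl⟩ := hx
      rw [e.coord_apply, e.repr_self, Finsupp.single_apply]
      split_ifs <;> norm_num
    | zero => simp
    | add x y _ _ hx hy => rw [map_add]; exact add_nonneg hx hy
    | smul a x _ hx =>
      have : e.coord k (a • x) = a.1 * e.coord k x := (e.coord k).map_smul a.1 x
      rw [this]
      exact mul_nonneg a.2 hx
  · intro h
    rw [← e.sum_repr v]
    exact Submodule.sum_mem _ fun k _ =>
      PointedCone.smul_mem _ (h k) (Submodule.subset_span (Set.mem_range_self k))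

theorem isProperInvariantCone_hull {ι : Type*} [Fintype ι] (e : Module.Basis ι ℝ (Specht μ n))
    (h : ∀ t k l, 0 ≤ e.coord l (e k + spechtRep μ n (simpleRefl t) (e k))) :
    IsProperInvariantCone (spechtRep μ n) (PointedCone.hull ℝ (Set.range e)) := by
  classical
  have hset : (PointedCone.hull ℝ (Set.range e) : Set (Specht μ n))
      = ⋂ k, {v | 0 ≤ e.coord k v} := by
    ext v
    simp only [SetLike.mem_coe, mem_hull_range_iff, Set.mem_iInter]
    rfl
  have hcont : ∀ k, Continuous (e.coord k) := fun k => (e.coord k).continuous_of_finiteDimensional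
  refine ⟨?_, ?_, ?_, ?_⟩
  · rw [hset]
    exact isClosed_iInter fun k => isClosed_le continuous_const (hcont k)
  · intro v hv hv'
    rw [mem_hull_range_iff] at hv hv'
    refine e.forall_coord_eq_zero_iff.1 fun k => le_antisymm ?_ (hv k)
    have := hv' k
    rw [map_neg] at this
    linarith
  · refine ⟨∑ k, e k, mem_interior.2 ⟨⋂ k, {v | 0 < e.coord k v}, ?_, ?_, ?_⟩⟩
    · rw [hset]
      exact Set.iInter_mono fun k v (hv : 0 < e.coord k v) =>
        show 0 ≤ e.coord k v from hv.le
    · exact isOpen_iInter_of_finite fun k => isOpen_lt continuous_const (hcont k)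
    · refine Set.mem_iInter.2 fun k => ?_
      have : e.coord k (∑ l, e l) = 1 := by
        have h1 := e.repr_sum_self (fun _ => (1 : ℝ))
        simp only [one_smul] at h1
        rw [e.coord_apply, h1]
      change 0 < e.coord k (∑ l, e l)
      rw [this]
      exact one_pos
  · intro t v hv
    rw [mem_hull_range_iff] at hv ⊢
    intro l
    have h1 : v + spechtRep μ n (simpleRefl t) v
        = ∑ k, e.repr v k • (e k + spechtRep μ n (simpleRefl t) (e k)) := by
      conv_lhs => rw [← e.sum_repr v]
      rw [map_sum, ← Finset.sum_add_distrib]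
      simp only [map_smul, smul_add]
    rw [h1, map_sum]
    refine Finset.sum_nonneg fun k _ => ?_
    rw [map_smul, smul_eq_mul]
    exact mul_nonneg (hv k) (h t k l)

/-- The properties of a basis that make its cone the maximal invariant cone: the coordinate
functional of `k` is invariant under the parabolic subgroup complementary to `E k`, on whose fixed
vectors it is a positive multiple of the coordinate functional of `k₀`; and the latter is faithful
on the fixed vectors of the parabolic subgroup complementary to `E k₀`. -/
structure IsExtremalBasis {ι : Type*} (e : Module.Basis ι ℝ (Specht μ n))
    (E : ι → Fin (n - 1) → Prop) (k₀ : ι) : Prop where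
  nonneg : ∀ t k l, 0 ≤ e.coord l (e k + spechtRep μ n (simpleRefl t) (e k))
  invariant : ∀ k t, ¬ E k t → ∀ v, e.coord k (spechtRep μ n (simpleRefl t) v) = e.coord k v
  pos_mul : ∀ k, ∃ κ : ℝ, 0 < κ ∧ ∀ z, (∀ t, ¬ E k t → spechtRep μ n (simpleRefl t) z = z) →
    e.coord k z = κ * e.coord k₀ z
  faithful : ∀ z, (∀ t, ¬ E k₀ t → spechtRep μ n (simpleRefl t) z = z) → e.coord k₀ z = 0 → z = 0

namespace IsExtremalBasis

variable {ι : Type*} {e : Module.Basis ι ℝ (Specht μ n)} {E : ι → Fin (n - 1) → Prop} {k₀ : ι}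

/-- Faithfulness of one functional means that the fixed space has dimension at most one. -/
theorem smul_eq_smul (he : IsExtremalBasis e E k₀) {u w : Specht μ n}
    (hu : ∀ t, ¬ E k₀ t → spechtRep μ n (simpleRefl t) u = u)
    (hw : ∀ t, ¬ E k₀ t → spechtRep μ n (simpleRefl t) w = w) :
    e.coord k₀ w • u = e.coord k₀ u • w := by
  rw [← sub_eq_zero]
  refine he.faithful _ (fun t ht => ?_) ?_
  · rw [map_sub, map_smul, map_smul, hu t ht, hw t ht]
  · rw [map_sub, map_smul, map_smul, smul_eq_mul, smul_eq_mul]; ring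

/-- Vectors of C with opposite signs would symmetrize to fixed vectors on opposite rays of one line,
contradicting pointedness. -/
theorem sign (he : IsExtremalBasis e E k₀) {C : PointedCone ℝ (Specht μ n)}
    (hC : IsProperInvariantCone (spechtRep μ n) C) :
    (∀ v ∈ C, 0 ≤ e.coord k₀ v) ∨ ∀ v ∈ C, e.coord k₀ v ≤ 0 := by
  by_contra! h
  obtain ⟨⟨v, hv, hv'⟩, w, hw, hw'⟩ := h
  obtain ⟨u, hu, huf, huφ⟩ := exists_fixed_mem hC.isClosed (J := fun t => ¬ E k₀ t)
    (fun t _ => hC.invariant t) hv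
  obtain ⟨y, hy, hyf, hyφ⟩ := exists_fixed_mem hC.isClosed (J := fun t => ¬ E k₀ t)
    (fun t _ => hC.invariant t) hw
  rw [← huφ _ (he.invariant k₀)] at hv'
  rw [← hyφ _ (he.invariant k₀)] at hw'
  have h1 := he.smul_eq_smul huf hyf
  have h2 := hC.pointed (e.coord k₀ y • u) (PointedCone.smul_mem C hw'.le hu) (by
    rw [h1, show -(e.coord k₀ u • y) = (-e.coord k₀ u) • y from (neg_smul _ _).symm]
    exact PointedCone.smul_mem C (by linarith) hy)
  rcases smul_eq_zero.1 h2 with h3 | h3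
  · exact hw'.ne' h3
  · rw [h3, map_zero] at hv'
    exact lt_irrefl _ hv'

theorem isMaximalInvariantCone [Fintype ι] (he : IsExtremalBasis e E k₀) :
    IsMaximalInvariantCone (spechtRep μ n) (PointedCone.hull ℝ (Set.range e)) := by
  refine ⟨isProperInvariantCone_hull e he.nonneg, fun C hC => ?_⟩
  have key : ∀ v ∈ C, ∀ k, ∃ u ∈ C, ∃ κ : ℝ, 0 < κ ∧ e.coord k v = κ * e.coord k₀ u := by
    intro v hv k
    obtain ⟨u, hu, huf, huφ⟩ := exists_fixed_mem hC.isClosed (J := fun t => ¬ E k t)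
      (fun t _ => hC.invariant t) hv
    obtain ⟨κ, hκ, h⟩ := he.pos_mul k
    exact ⟨u, hu, κ, hκ, by rw [← huφ _ (he.invariant k), h u huf]⟩
  refine (he.sign hC).imp (fun h v hv => ?_) (fun h v hv => ?_)
  · rw [mem_hull_range_iff]
    intro k
    obtain ⟨u, hu, κ, hκ, hk⟩ := key v hv k
    rw [hk]
    exact mul_nonneg hκ.le (h u hu)
  · rw [mem_hull_range_iff]
    intro k
    obtain ⟨u, hu, κ, hκ, hk⟩ := key v hv k
    rw [map_neg, hk, ← mul_neg]
    exact mul_nonneg hκ.le (neg_nonneg.2 (h u hu))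

/-- If the coordinate vanishes at an interior point, a small step along `e k` stays in C and makes
it nonzero. -/
theorem exists_mem_coord_ne_zero {C : PointedCone ℝ (Specht μ n)}
    (hC : IsProperInvariantCone (spechtRep μ n) C) (k : ι) : ∃ v ∈ C, e.coord k v ≠ 0 := by
  obtain ⟨x, hx⟩ := hC.solid
  by_cases h0 : e.coord k x = 0
  · have hc : Filter.Tendsto (fun r : ℝ => x + r • e k) (nhds 0) (nhds x) := by
      have : Continuous fun r : ℝ => x + r • e k := by fun_prop
      simpa using this.tendsto 0
    have h1 := hc.eventually (mem_interior_iff_mem_nhds.1 hx)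
    obtain ⟨r, hr, hr0⟩ := ((h1.filter_mono nhdsWithin_le_nhds).and
      (self_mem_nhdsWithin (s := Set.Ioi (0 : ℝ)))).exists
    refine ⟨x + r • e k, hr, ?_⟩
    rw [map_add, h0, map_smul, e.coord_apply, e.repr_self, Finsupp.single_eq_same]
    simpa using (ne_of_gt hr0)
  · exact ⟨x, interior_subset hx, h0⟩

/-- Reflections are self-adjoint for B, so the dual vector `d k` is fixed by the parabolic subgroup
under which the coordinate of k is invariant. Thus ±`d k₀` is found in C by symmetrizing, and a
further symmetrization yields every other `d k` with the same sign. -/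
theorem isMinimalInvariantCone [Fintype ι] [DecidableEq ι] (he : IsExtremalBasis e E k₀)
    (B : LinearMap.BilinForm ℝ (Specht μ n)) (hB : B.Nondegenerate)
    (hinv : ∀ (σ : Equiv.Perm (Fin n)) (v w : Specht μ n),
      B (spechtRep μ n σ v) (spechtRep μ n σ w) = B v w) :
    IsMinimalInvariantCone (spechtRep μ n)
      (PointedCone.hull ℝ (Set.range (B.dualBasis hB e))) := by
  set d := B.dualBasis hB e with hd
  have hadj : ∀ t v w, B (spechtRep μ n (simpleRefl t) v) w
      = B v (spechtRep μ n (simpleRefl t) w) := by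
    intro t v w
    rw [← hinv (simpleRefl t) v, simpleRefl_apply_apply]
  have hdB : ∀ k v, B (d k) v = e.coord k v := by
    intro k v
    have : B (d k) = e.coord k := by
      refine e.ext fun l => ?_
      rw [hd, LinearMap.BilinForm.apply_dualBasis_left, e.coord_apply, e.repr_self,
        Finsupp.single_apply]
    rw [this]
  have hdc : ∀ k v, d.coord k v = B v (e k) := fun k v => by
    rw [d.coord_apply, hd, LinearMap.BilinForm.dualBasis_repr_apply]
  have hext : ∀ v, (∀ w, B v w = 0) → v = 0 := fun v hv =>
    d.forall_coord_eq_zero_iff.1 fun k => by rw [hdc, hv]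
  have hdf : ∀ k t, ¬ E k t → spechtRep μ n (simpleRefl t) (d k) = d k := by
    intro k t ht
    rw [← sub_eq_zero]
    refine hext _ fun w => ?_
    rw [map_sub, LinearMap.sub_apply, hadj, hdB, hdB, he.invariant k t ht, sub_self]
  refine ⟨isProperInvariantCone_hull d fun t k l => ?_, fun C hC => ?_⟩
  · rw [hdc, map_add, LinearMap.add_apply, hadj, hdB, hdB, ← map_add]
    exact he.nonneg t l k
  have key : ∀ r : ℝ, r • d k₀ ∈ C → ∀ v ∈ PointedCone.hull ℝ (Set.range d), r • v ∈ C := by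
    intro r hr v hv
    rw [← d.sum_repr v, Finset.smul_sum]
    refine Submodule.sum_mem _ fun k _ => ?_
    rw [smul_comm]
    refine PointedCone.smul_mem C ((mem_hull_range_iff d v).1 hv k) ?_
    obtain ⟨u, hu, huf, huφ⟩ := exists_fixed_mem hC.isClosed (J := fun t => ¬ E k t)
      (fun t _ => hC.invariant t) hr
    obtain ⟨κ, hκ, h⟩ := he.pos_mul k
    -- Both vectors are fixed by the parabolic subgroup of k, so it suffices to pair them with fixed
    -- vectors z'. There `pos_mul` compares the coordinates of k and `k₀`.
    have hy : r • d k - κ • u = 0 := by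
      refine hext _ fun z => ?_
      obtain ⟨z', -, hzf, hzφ⟩ := exists_fixed_mem (C := (⊤ : PointedCone ℝ (Specht μ n)))
        isClosed_univ (J := fun t => ¬ E k t) (fun _ _ _ _ => trivial) (v := z) trivial
      rw [← hzφ (B (r • d k - κ • u)) fun t ht w => by
        rw [← hadj, map_sub, map_smul, map_smul, hdf k t ht, huf t ht]]
      have h1 : B u z' = B (r • d k₀) z' := huφ (B.flip z') fun t ht w => by
        change B _ z' = B w z'
        rw [hadj, hzf t ht]
      rw [map_sub, LinearMap.sub_apply, map_smul, map_smul, LinearMap.smul_apply,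
        LinearMap.smul_apply, h1, map_smul, LinearMap.smul_apply, hdB, hdB, h z' hzf]
      simp only [smul_eq_mul]
      ring
    rw [sub_eq_zero.1 hy]
    exact PointedCone.smul_mem C hκ.le hu
  obtain ⟨v, hv, hv0⟩ := exists_mem_coord_ne_zero (e := e) hC k₀
  obtain ⟨u, hu, huf, huφ⟩ := exists_fixed_mem hC.isClosed (J := fun t => ¬ E k₀ t)
    (fun t _ => hC.invariant t) hv
  rw [← huφ _ (he.invariant k₀)] at hv0
  -- Both vectors lie on the line fixed by the parabolic subgroup of `k₀`; the sign of the factor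
  -- decides between C and -C.
  have h1 : d k₀ = ((e.coord k₀ u)⁻¹ * e.coord k₀ (d k₀)) • u := by
    rw [mul_smul, he.smul_eq_smul huf (hdf k₀), smul_smul, inv_mul_cancel₀ hv0, one_smul]
  rcases le_total 0 ((e.coord k₀ u)⁻¹ * e.coord k₀ (d k₀)) with h2 | h2
  · refine Or.inl fun w hw => ?_
    have := key 1 (by rw [one_smul, h1]; exact PointedCone.smul_mem C h2 hu) w hw
    rwa [one_smul] at this
  · refine Or.inr fun w hw => ?_
    have := key (-1) (by
      rw [h1, smul_smul]; exact PointedCone.smul_mem C (by linarith) hu) w hw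
    rwa [show (-1 : ℝ) • w = -w from neg_one_smul ℝ w] at this

end IsExtremalBasis

end Cones

/-- The index `k₀` belongs to the pair of outermost reflections, and the positive factors are κ a (n
- b) from `corner_of_fixed`. -/
theorem IsProductBasis.exists_isExtremalBasis {n : ℕ} {hn : 4 ≤ n} {ι : Type*}
    {e : Module.Basis ι ℝ (Specht (twoRow n hn) n)} {c : ℝ}
    {f : Fin (n - 1) → Fin (n - 1) → Specht (twoRow n hn) n}
    {g : Fin (n - 1) → Specht (twoRow n hn) n} (hp : IsProductBasis e c f g) :
    ∃ E k₀, IsExtremalBasis e E k₀ := by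
  classical
  obtain ⟨k₀, hk₀⟩ := hp.exists_coord_outer
  choose a b κ ha hab hb hκ h using hp.exists_coord
  -- The case `k = k₀` is separate because the pair chosen by `exists_coord` is not known to be (1,
  -- n - 1) there.
  set E : ι → Fin (n - 1) → Prop := fun k t =>
    if k = k₀ then t.1 + 1 = 1 ∨ t.1 + 1 = n - 1 else t.1 + 1 = a k ∨ t.1 + 1 = b k with hE
  have hE₀ : ∀ t, E k₀ t ↔ t.1 + 1 = 1 ∨ t.1 + 1 = n - 1 := fun t => by simp [hE]
  have hE₁ : ∀ k, k ≠ k₀ → ∀ t, E k t ↔ t.1 + 1 = a k ∨ t.1 + 1 = b k := fun k hk t => by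
    simp [hE, hk]
  refine ⟨E, k₀, fun t k l => hp.coord_add_simpleRefl_nonneg t k l, ?_, ?_, ?_⟩
  · intro k t ht v
    by_cases hk : k = k₀
    · subst hk
      rw [hE₀, not_or] at ht
      rw [hk₀, hk₀, corner_simpleRefl_of_ne ht.1 ht.2]
    · rw [hE₁ k hk, not_or] at ht
      rw [h, h, corner_simpleRefl_of_ne ht.1 ht.2]
  · intro k
    by_cases hk : k = k₀
    · exact ⟨1, one_pos, fun z _ => by rw [hk, one_mul]⟩
    · refine ⟨κ k * (a k * (n - b k : ℕ)), ?_, fun z hz => ?_⟩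
      · have h1 : (0 : ℝ) < a k := by exact_mod_cast ha k
        have h2 : (0 : ℝ) < (n - b k : ℕ) := by
          have := hb k
          exact_mod_cast (by omega : 0 < n - b k)
        exact mul_pos (hκ k) (mul_pos h1 h2)
      · rw [h, hk₀, corner_of_fixed (ha k) (hab k) (hb k) fun t h1 h2 =>
          hz t (by rw [hE₁ k hk, not_or]; exact ⟨h1, h2⟩)]
        ring
  · intro z hz h0
    refine eq_zero_of_fixed (fun t h1 h2 => hz t (by rw [hE₀, not_or]; exact ⟨h1, h2⟩)) ?_
    rw [hk₀] at h0
    exact (mul_eq_zero.1 h0).resolve_left (inv_ne_zero hp.ne_zero)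

end KLCone

end

theorem mainTheorem5 (n : ℕ) (hn : 4 ≤ n) {ι : Type*} [Fintype ι] [DecidableEq ι]
    (e : Module.Basis ι ℝ (KLCone.Specht (KLCone.twoRow n hn) n))
    (he : KLCone.IsLeftCellBasis (KLCone.spechtRep (KLCone.twoRow n hn) n) e) :
    KLCone.IsMaximalInvariantCone (KLCone.spechtRep (KLCone.twoRow n hn) n)
        (PointedCone.hull ℝ (Set.range e)) ∧
      ∀ (B : LinearMap.BilinForm ℝ (KLCone.Specht (KLCone.twoRow n hn) n))
        (hB : B.Nondegenerate), B.IsSymm →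
        (∀ (σ : Equiv.Perm (Fin n)) (v w : KLCone.Specht (KLCone.twoRow n hn) n),
          B (KLCone.spechtRep (KLCone.twoRow n hn) n σ v)
            (KLCone.spechtRep (KLCone.twoRow n hn) n σ w) = B v w) →
        KLCone.IsMinimalInvariantCone (KLCone.spechtRep (KLCone.twoRow n hn) n)
          (PointedCone.hull ℝ (Set.range (B.dualBasis hB e))) := by
  obtain ⟨D, m, hw⟩ := he.exists_isWGraphBasis
  obtain ⟨c, f, g, hp⟩ := hw.exists_isProductBasis
  obtain ⟨E, k₀, hE⟩ := hp.exists_isExtremalBasis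
  exact ⟨hE.isMaximalInvariantCone, fun B hB _ hinv => hE.isMinimalInvariantCone B hB hinv⟩
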